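/- Let $q\in\mathbb C^\times$ be not a root of unity. All vector spaces and algebras are $\mathbb Z/2$-graded over $\mathbb C$, tensor products of superalgebras follow the sign rule, put $|1|=0$, $|2|=1$, $q_1=q$, $q_2=q^{-1}$, and let $E_{ij}$ be the matrix units of $\mathrm{End}\,\mathbf V$, $\mathbf V=\mathbb C^{1|1}$. Let $$R(z,w)=\sum_{i}(zq_i-wq_i^{-1})E_{ii}\otimes E_{ii}+(z-w)\sum_{i\ne j}E_{ii}\otimes E_{jj}+z\sum_{i<j}(q_i-q_i^{-1})E_{ji}\otimes E_{ij}+w\sum_{i<j}(q_j-q_j^{-1})E_{ij}\otimes E_{ji}.$$ The superalgebra $U_q(\widehat{\mathfrak{gl}}(1,1))$ has generators $s_{ij}^{(n)},t_{ij}^{(n)}$ ($i,j\in\{1,2\}$, $n\ge 0$) of degree $|i|+|j|$ and, with $S(z)=\sum_{n,i,j} s_{ij}^{(n)}z^n\otimes E_{ij}$ and $T(z)=\sum_{n,i,j} t_{ij}^{(n)}z^{-n}\otimes E_{ij}$, the relations $$R_{23}(z,w)X_{12}(z)Y_{13}(w)=Y_{13}(w)X_{12}(z)R_{23}(z,w)\quad\text{for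 }(X,Y)=(T,T),(S,S),(T,S),$$ $t_{12}^{(0)}=s_{21}^{(0)}=0$ and $t_{ii}^{(0)}s_{ii}^{(0)}=1=s_{ii}^{(0)}t_{ii}^{(0)}$. The $q$-Yangian $Y=Y_q(\mathfrak{gl}(1,1))$ is its subalgebra generated by all $s_{ij}^{(n)}$ and $(s_{ii}^{(0)})^{-1}$. It acts on tensor products of $Y$-modules through the coproduct $\Delta(s_{ij}^{(n)})=\sum_{a=0}^n\sum_k(-1)^{(|i|+|k|)(|k|+|j|)}s_{ik}^{(a)}\otimes s_{kj}^{(n-a)}$, with $(x\otimes y)(v\otimes w)=(-1)^{|y||v|}xv\otimes yw$. Write $s_{ij}(z)=\sum_n s_{ij}^{(n)}z^n$. A highest $\ell$-weight vector of a $Y$-module is a non-zero homogeneous vector $v$ with $s_{12}^{(n)}v=0$ and $s_{kk}^{(n)}v\in\mathbb Cv$ for all $n\ge0$ and $k=1,2$. For a rational function $f\in\mathbb C(z)$ with $f(0)=1$, let $V(f)$ be the simple $Y$-module generated by an even highest $\ell$-weight vector $v$ with $s_{11}(z)v=f(z)v$ and $s_{22}(z)v=v$, where $f(z)$ is expanded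 at $z=0$. Let $Z(f)$ and $P(f)$ be the sets of zeros and of poles of $f$ in $\mathbb C\cup\{\infty\}$ (the point $\infty$ included). **Theorem.** Let $s\ge1$, let $f_1,\dots,f_s$ be rational functions with $f_i(0)=1$, let $v_i$ be a highest $\ell$-weight vector of $V(f_i)$, and put $V=V(f_1)\otimes\cdots\otimes V(f_s)$, $v=v_1\otimes\cdots\otimes v_s$. Then (a) $V=Yv$ if and only if $P(f_i)\cap Z(f_j)=\emptyset$ for all $1\le i<j\le s$; (b) $Yv$ is the unique simple $Y$-submodule of $V$ if and only if $Z(f_i)\cap P(f_j)=\emptyset$ for all $1\le i<j\le s$; (c) $V$ is simple if and only if $P(f_i)\cap Z(f_j)=\emptyset$ for all $i\ne j$. -/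

import Mathlib

open scoped TensorProduct PowerSeries

universe u

noncomputable section

namespace QYangian

/-! ## Superalgebras

A superalgebra is handled through its parity automorphism `θ`, `θ x = (-1)^{|x|} x` on homogeneous
elements; its even and odd parts are the eigenspaces of `θ` for `1` and `-1`. -/

/-- The sign `(-1)^p` for `p ∈ ℤ/2`. -/
def sgn (p : ZMod 2) : ℂ := if p = 0 then 1 else -1

theorem sgn_zero : sgn 0 = 1 := by simp [sgn]

theorem sgn_one : sgn 1 = -1 := by simp [sgn]

theorem zmod_two_cases (p : ZMod 2) : p = 0 ∨ p = 1 := by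
  revert p; decide

theorem sgn_add (a b : ZMod 2) : sgn (a + b) = sgn a * sgn b := by
  rcases zmod_two_cases a with rfl | rfl <;> rcases zmod_two_cases b with rfl | rfl <;>
    simp [sgn, show (1 + 1 : ZMod 2) = 0 from rfl]

theorem sgn_mul_self (a : ZMod 2) : sgn a * sgn a = 1 := by
  rcases zmod_two_cases a with rfl | rfl <;> simp [sgn]

theorem sgn_eq_units (a : ZMod 2) : sgn a = ((((-1 : ℤˣ) ^ a : ℤˣ) : ℤ) : ℂ) := by
  rcases zmod_two_cases a with rfl | rfl <;> simp [sgn]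

section Super

variable {A : Type*} [Ring A] [Algebra ℂ A]

/-- The homogeneous part of degree `p ∈ ℤ/2` of a superalgebra with parity automorphism `θ`. -/
def superPart (θ : A →ₐ[ℂ] A) (p : ZMod 2) : Submodule ℂ A :=
  LinearMap.ker (θ.toLinearMap - sgn p • LinearMap.id)

theorem mem_superPart {θ : A →ₐ[ℂ] A} {p : ZMod 2} {x : A} :
    x ∈ superPart θ p ↔ θ x = sgn p • x := by
  simp [superPart, sub_eq_zero]

theorem superPart_gradedMonoid (θ : A →ₐ[ℂ] A) : SetLike.GradedMonoid (superPart θ) where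
  one_mem := by simp [mem_superPart, sgn_zero]
  mul_mem := by
    intro p r x y hx hy
    rw [mem_superPart] at *
    rw [map_mul, hx, hy, sgn_add, smul_mul_smul_comm]

theorem half_mem {θ : A →ₐ[ℂ] A} (h : ∀ x, θ (θ x) = x) (p : ZMod 2) (x : A) :
    ((2⁻¹ : ℂ) • (LinearMap.id + sgn p • θ.toLinearMap) : A →ₗ[ℂ] A) x ∈ superPart θ p := by
  simp only [mem_superPart, LinearMap.smul_apply, LinearMap.add_apply, LinearMap.id_apply,
    AlgHom.toLinearMap_apply, map_smul, map_add, h]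
  rw [smul_comm, smul_add (sgn p), smul_smul, sgn_mul_self, one_smul, add_comm]

/-- The projection `x ↦ (x + (-1)^p θ x) / 2` onto the part of degree `p`. -/
def halfProj (θ : A →ₐ[ℂ] A) (h : ∀ x, θ (θ x) = x) (p : ZMod 2) : A →ₗ[ℂ] superPart θ p :=
  LinearMap.codRestrict _ ((2⁻¹ : ℂ) • (LinearMap.id + sgn p • θ.toLinearMap)) (half_mem h p)

theorem halfProj_coe (θ : A →ₐ[ℂ] A) (h : ∀ x, θ (θ x) = x) (p : ZMod 2) (x : A) :
    (halfProj θ h p x : A) = (2⁻¹ : ℂ) • (x + sgn p • θ x) := rfl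

theorem halfProj_of_mem (θ : A →ₐ[ℂ] A) (h : ∀ x, θ (θ x) = x) (r p : ZMod 2) {x : A}
    (hx : x ∈ superPart θ p) : (halfProj θ h r x : A) = if p = r then x else 0 := by
  rw [halfProj_coe, mem_superPart.1 hx, smul_smul, ← sgn_add]
  rcases zmod_two_cases p with rfl | rfl <;> rcases zmod_two_cases r with rfl | rfl <;>
    simp [sgn, ← two_smul ℂ x, show (1 + 1 : ZMod 2) = 0 from rfl]

/-- The `ℤ/2`-grading of an algebra with an involutive automorphism `θ`. -/
abbrev superGradedAlgebra (θ : A →ₐ[ℂ] A) (h : ∀ x, θ (θ x) = x) :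
    GradedAlgebra (superPart θ) where
  toGradedMonoid := superPart_gradedMonoid θ
  decompose' := fun x =>
    (DirectSum.lof ℂ (ZMod 2) (fun p => superPart θ p) 0 ∘ₗ halfProj θ h 0 +
      DirectSum.lof ℂ (ZMod 2) (fun p => superPart θ p) 1 ∘ₗ halfProj θ h 1) x
  left_inv x := by
    simp only [map_add, DirectSum.coeAddMonoidHom_of, sgn_zero, sgn_one, DirectSum.lof_eq_of,
      LinearMap.add_apply, LinearMap.comp_apply, halfProj_coe, ← smul_add]
    rw [inv_smul_eq_iff₀ two_ne_zero, two_smul, one_smul, neg_smul, one_smul]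
    abel
  right_inv x := by
    induction x using DirectSum.induction_on with
    | zero => simp
    | of p x =>
      have e : ∀ r : ZMod 2, halfProj θ h r (x : A) = if hr : p = r then hr ▸ x else 0 := by
        intro r
        ext
        rw [halfProj_of_mem θ h r p x.2]
        split_ifs with hr
        · subst hr; rfl
        · rfl
      simp only [DirectSum.coeAddMonoidHom_of, LinearMap.add_apply, LinearMap.comp_apply, e]
      rcases zmod_two_cases p with rfl | rfl <;> simp [DirectSum.lof_eq_of]
    | add x y hx hy =>
      dsimp only at hx hy ⊢
      rw [map_add (DirectSum.coeAddMonoidHom (superPart θ)), LinearMap.map_add, hx, hy]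

end Super

/-! ## The RTT relations

The index set `I = {1, 2}` is `Fin 2`, with `0` and `1` in place of `1` and `2`. -/

/-- The parity `|i|` of an index: `|1|` is even, `|2|` is odd. -/
def par (i : Fin 2) : ZMod 2 := if i = 0 then 0 else 1

/-- `q_i = q^{d_i}` with `d_1 = 1`, `d_2 = -1`. -/
def qi (q : ℂ) (i : Fin 2) : ℂ := if i = 0 then q else q⁻¹

/-- The Perk-Schultz matrix
`R(z,w) = ∑_i (z q_i - w q_i⁻¹) E_ii ⊗ E_ii + (z - w) ∑_{i ≠ j} E_ii ⊗ E_jj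
  + z ∑_{i<j} (q_i - q_i⁻¹) E_ji ⊗ E_ij + w ∑_{i<j} (q_j - q_j⁻¹) E_ij ⊗ E_ji`
is written `R(z,w) = ∑ (z * rCoeffZ q a b c d + w * rCoeffW q a b c d) E_ab ⊗ E_cd`.
This is the coefficient of `z E_ab ⊗ E_cd`. -/
def rCoeffZ (q : ℂ) (a b c d : Fin 2) : ℂ :=
  if a = b ∧ c = d then (if a = c then qi q a else 1)
  else if a = d ∧ b = c ∧ b < a then qi q b - (qi q b)⁻¹
  else 0

/-- The coefficient of `w E_ab ⊗ E_cd` in the Perk-Schultz matrix `R(z,w)`. -/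
def rCoeffW (q : ℂ) (a b c d : Fin 2) : ℂ :=
  if a = b ∧ c = d then (if a = c then -(qi q a)⁻¹ else -1)
  else if a = d ∧ b = c ∧ a < b then qi q b - (qi q b)⁻¹
  else 0

section RTT

variable {D : Type*} [Ring D] [Algebra ℂ D]

/-- Let `X = ∑ x_ij ⊗ E_ij` and `Y = ∑ y_ij ⊗ E_ij`, with `x_ij`, `y_ij` of degree `|i| + |j|`
in a superalgebra `D`. This is the coefficient of `E_ij ⊗ E_kl` in
`R_23(α,β) X_12 Y_13 ∈ D ⊗ End 𝕍 ⊗ End 𝕍` (super tensor product). -/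
def rttLeft (q : ℂ) (α β : D) (x y : Fin 2 → Fin 2 → D) (i j k l : Fin 2) : D :=
  ∑ a, ∑ c, (sgn ((par k + par c) * (par a + par j)) * sgn ((par a + par j) * (par c + par l))) •
    ((rCoeffZ q i a k c • α + rCoeffW q i a k c • β) * (x a j * y c l))

/-- The coefficient of `E_ij ⊗ E_kl` in `Y_13 X_12 R_23(α,β) ∈ D ⊗ End 𝕍 ⊗ End 𝕍`
(super tensor product). -/
def rttRight (q : ℂ) (α β : D) (x y : Fin 2 → Fin 2 → D) (i j k l : Fin 2) : D :=
  ∑ b, ∑ d, sgn ((par k + par d) * (par b + par j)) •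
    ((y k d * x i b) * (rCoeffZ q b j d l • α + rCoeffW q b j d l • β))

theorem rttLeft_map {D' : Type*} [Ring D'] [Algebra ℂ D'] (φ : D →ₐ[ℂ] D') (q : ℂ) (α β : D)
    (x y : Fin 2 → Fin 2 → D) (i j k l : Fin 2) :
    φ (rttLeft q α β x y i j k l) =
      rttLeft q (φ α) (φ β) (fun a b => φ (x a b)) (fun a b => φ (y a b)) i j k l := by
  simp only [rttLeft, map_sum, map_smul, map_mul, map_add]

theorem rttRight_map {D' : Type*} [Ring D'] [Algebra ℂ D'] (φ : D →ₐ[ℂ] D') (q : ℂ) (α β : D)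
    (x y : Fin 2 → Fin 2 → D) (i j k l : Fin 2) :
    φ (rttRight q α β x y i j k l) =
      rttRight q (φ α) (φ β) (fun a b => φ (x a b)) (fun a b => φ (y a b)) i j k l := by
  simp only [rttRight, map_sum, map_smul, map_mul, map_add]

theorem rCoeff_even (q : ℂ) (α β : D) (a b c d : Fin 2) :
    rCoeffZ q a b c d • α + rCoeffW q a b c d • β = 0 ∨ par a + par b = par c + par d := by
  fin_cases a <;> fin_cases b <;> fin_cases c <;> fin_cases d <;>
    simp [rCoeffZ, rCoeffW, par, show (1 + 1 : ZMod 2) = 0 from rfl]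

theorem rttLeft_sgn (q : ℂ) (α β : D) (x y : Fin 2 → Fin 2 → D) (i j k l : Fin 2) :
    rttLeft q α β (fun a b => sgn (par a + par b) • x a b) (fun a b => sgn (par a + par b) • y a b)
      i j k l = sgn (par i + par j + par k + par l) • rttLeft q α β x y i j k l := by
  simp only [rttLeft, Finset.smul_sum]
  refine Finset.sum_congr rfl fun a _ => Finset.sum_congr rfl fun c _ => ?_
  rcases rCoeff_even q α β i a k c with h0 | h0
  · rw [h0]; simp
  · simp only [mul_smul_comm, smul_mul_assoc, smul_smul, ← sgn_add]
    congr 2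
    generalize par i = i at *
    generalize par j = j at *
    generalize par k = k at *
    generalize par l = l at *
    generalize par a = a at *
    generalize par c = c at *
    clear * - h0
    grind

theorem rttRight_sgn (q : ℂ) (α β : D) (x y : Fin 2 → Fin 2 → D) (i j k l : Fin 2) :
    rttRight q α β (fun a b => sgn (par a + par b) • x a b)
      (fun a b => sgn (par a + par b) • y a b)
      i j k l = sgn (par i + par j + par k + par l) • rttRight q α β x y i j k l := by
  simp only [rttRight, Finset.smul_sum]
  refine Finset.sum_congr rfl fun b _ => Finset.sum_congr rfl fun d _ => ?_
  rcases rCoeff_even q α β b j d l with h0 | h0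
  · rw [h0]; simp
  · simp only [mul_smul_comm, smul_mul_assoc, smul_smul, ← sgn_add]
    congr 2
    generalize par i = i at *
    generalize par j = j at *
    generalize par k = k at *
    generalize par l = l at *
    generalize par b = b at *
    generalize par d = d at *
    clear * - h0
    grind

theorem sum_comm4 {M : Type*} [AddCommMonoid M] (T : Fin 2 → Fin 2 → Fin 2 → Fin 2 → M) :
    ∑ a, ∑ c, ∑ e, ∑ f, T a c e f = ∑ e, ∑ f, ∑ a, ∑ c, T a c e f := by
  simp only [Fin.sum_univ_two]
  abel

/-- If `X` and `X'` satisfy the RTT relation and their entries supercommute with each other, then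
the product `X X'` satisfies the RTT relation. -/
theorem rtt_mul (q : ℂ) {α β : D}
    {x y x' y' : Fin 2 → Fin 2 → D}
    (h : ∀ i j k l, rttLeft q α β x y i j k l = rttRight q α β x y i j k l)
    (h' : ∀ i j k l, rttLeft q α β x' y' i j k l = rttRight q α β x' y' i j k l)
    (hxy : ∀ i j k l, x' i j * y k l = sgn ((par i + par j) * (par k + par l)) • (y k l * x' i j))
    (hyx : ∀ i j k l, y' i j * x k l = sgn ((par i + par j) * (par k + par l)) • (x k l * y' i j))
    (i j k l : Fin 2) :
    rttLeft q α β (fun i j => ∑ k, sgn ((par i + par k) * (par k + par j)) • (x i k * x' k j))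
      (fun i j => ∑ k, sgn ((par i + par k) * (par k + par j)) • (y i k * y' k j)) i j k l =
    rttRight q α β (fun i j => ∑ k, sgn ((par i + par k) * (par k + par j)) • (x i k * x' k j))
      (fun i j => ∑ k, sgn ((par i + par k) * (par k + par j)) • (y i k * y' k j)) i j k l := by
  have e1 : rttLeft q α β
      (fun i j => ∑ k, sgn ((par i + par k) * (par k + par j)) • (x i k * x' k j))
      (fun i j => ∑ k, sgn ((par i + par k) * (par k + par j)) • (y i k * y' k j)) i j k l =
      ∑ e, ∑ f, sgn ((par i + par e) * (par e + par j) + (par i + par e) * (par f + par l) +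
          (par k + par f) * (par f + par l) + (par e + par j) * (par f + par l)) •
        (rttLeft q α β x y i e k f * (x' e j * y' f l)) := by
    simp only [rttLeft, Finset.sum_mul_sum]
    simp only [Finset.mul_sum, Finset.smul_sum, Finset.sum_mul]
    rw [sum_comm4]
    refine Finset.sum_congr rfl fun e _ => Finset.sum_congr rfl fun f _ =>
      Finset.sum_congr rfl fun a _ => Finset.sum_congr rfl fun c _ => ?_
    rcases rCoeff_even q α β i a k c with h0 | h0
    · rw [h0]; simp
    · have hs : x a e * x' e j * (y c f * y' f l) = sgn ((par e + par j) * (par c + par f)) •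
          (x a e * y c f * (x' e j * y' f l)) := by
        rw [mul_assoc, ← mul_assoc (x' e j), hxy]
        simp only [smul_mul_assoc, mul_smul_comm, mul_assoc]
      simp only [smul_mul_smul_comm, hs]
      simp only [smul_mul_assoc, mul_smul_comm, smul_smul, mul_assoc, ← sgn_add]
      congr 2
      generalize par i = i at *
      generalize par j = j at *
      generalize par k = k at *
      generalize par l = l at *
      generalize par a = a at *
      generalize par c = c at *
      generalize par e = e at *
      generalize par f = f at *
      clear * - h0
      grind
  have e2 : rttRight q α β
      (fun i j => ∑ k, sgn ((par i + par k) * (par k + par j)) • (x i k * x' k j))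
      (fun i j => ∑ k, sgn ((par i + par k) * (par k + par j)) • (y i k * y' k j)) i j k l =
      ∑ d, ∑ b, sgn ((par i + par b) * (par b + par j + par d + par l) +
          (par k + par d) * (par d + par l)) •
        (y k d * x i b * rttRight q α β x' y' b j d l) := by
    simp only [rttRight, Finset.sum_mul_sum]
    simp only [Finset.mul_sum, Finset.smul_sum, Finset.sum_mul]
    rw [sum_comm4]
    refine Finset.sum_congr rfl fun d _ => Finset.sum_congr rfl fun b _ =>
      Finset.sum_congr rfl fun b' _ => Finset.sum_congr rfl fun d' _ => ?_
    rcases rCoeff_even q α β b' j d' l with h0 | h0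
    · rw [h0]; simp
    · have hs : y k d * y' d d' * (x i b * x' b b') = sgn ((par d + par d') * (par i + par b)) •
          (y k d * x i b * (y' d d' * x' b b')) := by
        rw [mul_assoc, ← mul_assoc (y' d d'), hyx]
        simp only [smul_mul_assoc, mul_smul_comm, mul_assoc]
      simp only [smul_mul_smul_comm, hs]
      simp only [smul_mul_assoc, mul_smul_comm, smul_smul, mul_assoc, ← sgn_add]
      congr 2
      generalize par i = i at *
      generalize par j = j at *
      generalize par k = k at *
      generalize par l = l at *
      generalize par b = b at *
      generalize par d = d at *
      generalize par b' = b' at *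
      generalize par d' = d' at *
      clear * - h0
      grind
  rw [e1, e2]
  simp only [h, ← h']
  simp only [rttRight, rttLeft, Finset.sum_mul, Finset.mul_sum, Finset.smul_sum]
  rw [sum_comm4, Finset.sum_comm]
  refine Finset.sum_congr rfl fun d _ => Finset.sum_congr rfl fun b _ =>
    Finset.sum_congr rfl fun e _ => Finset.sum_congr rfl fun f _ => ?_
  rcases rCoeff_even q α β b e d f with h0 | h0
  · rw [h0]; simp
  · simp only [smul_mul_assoc, mul_smul_comm, smul_smul, mul_assoc, ← sgn_add]
    congr 2
    generalize par i = i at *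
    generalize par j = j at *
    generalize par k = k at *
    generalize par l = l at *
    generalize par b = b at *
    generalize par d = d at *
    generalize par e = e at *
    generalize par f = f at *
    clear * - h0
    grind

end RTT

section Series

variable {A : Type*} [Ring A]

/-- The series `∑ a_n u^n` in the first of the two commuting formal variables `u`, `v`;
`A⟦u⟧⟦v⟧` is `A⟦X⟧⟦X⟧`, so that `u` is `C X` and `v` is `X`. -/
def ser₁ (a : ℕ → A) : A⟦X⟧⟦X⟧ := PowerSeries.C (PowerSeries.mk a)

/-- The series `∑ a_n v^n` in the second of the two formal variables. -/
def ser₂ (a : ℕ → A) : A⟦X⟧⟦X⟧ := PowerSeries.map PowerSeries.C (PowerSeries.mk a)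

variable (A) in
/-- The first formal variable `u`. -/
def var₁ : A⟦X⟧⟦X⟧ := PowerSeries.C PowerSeries.X

variable (A) in
/-- The second formal variable `v`. -/
def var₂ : A⟦X⟧⟦X⟧ := PowerSeries.X

theorem series_ext {F G : A⟦X⟧⟦X⟧}
    (h : ∀ m n, PowerSeries.coeff m (PowerSeries.coeff n F) =
      PowerSeries.coeff m (PowerSeries.coeff n G)) : F = G := by
  ext n m
  exact h m n

theorem coeff_ser₁_mul_ser₂ (a b : ℕ → A) (m n : ℕ) :
    PowerSeries.coeff m (PowerSeries.coeff n (ser₁ a * ser₂ b)) = a m * b n := by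
  simp [ser₁, ser₂, PowerSeries.coeff_C_mul, PowerSeries.coeff_mul_C]

theorem coeff_ser₂_mul_ser₁ (a b : ℕ → A) (m n : ℕ) :
    PowerSeries.coeff m (PowerSeries.coeff n (ser₂ b * ser₁ a)) = b n * a m := by
  simp [ser₁, ser₂, PowerSeries.coeff_C_mul, PowerSeries.coeff_mul_C]

variable [Algebra ℂ A]

theorem ser₁_conv (c : Fin 2 → ℂ) (a b : Fin 2 → ℕ → A) :
    ser₁ (fun n => ∑ p ∈ Finset.HasAntidiagonal.antidiagonal n, ∑ k, c k • (a k p.1 * b k p.2)) =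
      ∑ k, c k • (ser₁ (a k) * ser₁ (b k)) := by
  refine series_ext fun m n => ?_
  simp only [ser₁, ← map_mul, map_sum, PowerSeries.coeff_smul, PowerSeries.coeff_C]
  split_ifs
  · rw [PowerSeries.coeff_mk, Finset.sum_comm]
    simp only [PowerSeries.coeff_mul, Finset.smul_sum, PowerSeries.coeff_mk]
  · simp

theorem ser₂_conv (c : Fin 2 → ℂ) (a b : Fin 2 → ℕ → A) :
    ser₂ (fun n => ∑ p ∈ Finset.HasAntidiagonal.antidiagonal n, ∑ k, c k • (a k p.1 * b k p.2)) =
      ∑ k, c k • (ser₂ (a k) * ser₂ (b k)) := by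
  refine series_ext fun m n => ?_
  simp only [ser₂, ← map_mul, map_sum, PowerSeries.coeff_smul, PowerSeries.coeff_map,
    PowerSeries.coeff_C]
  split_ifs
  · rw [PowerSeries.coeff_mk, Finset.sum_comm]
    simp only [PowerSeries.coeff_mul, Finset.smul_sum, PowerSeries.coeff_mk]
  · simp

theorem ser₁_smul (c : ℂ) (a : ℕ → A) : ser₁ (fun n => c • a n) = c • ser₁ a := by
  refine series_ext fun m n => ?_
  simp only [ser₁, PowerSeries.coeff_smul, PowerSeries.coeff_C]
  split_ifs <;> simp

theorem ser₂_smul (c : ℂ) (a : ℕ → A) : ser₂ (fun n => c • a n) = c • ser₂ a := by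
  refine series_ext fun m n => ?_
  simp only [ser₂, PowerSeries.coeff_smul, PowerSeries.coeff_map, PowerSeries.coeff_C]
  split_ifs <;> simp

variable {B : Type*} [Ring B] [Algebra ℂ B]

/-- An algebra morphism applied to the coefficients of power series in two variables. -/
def seriesMap (φ : A →ₐ[ℂ] B) : A⟦X⟧⟦X⟧ →ₐ[ℂ] B⟦X⟧⟦X⟧ :=
  PowerSeries.mapAlgHom (PowerSeries.mapAlgHom φ)

theorem coeff_seriesMap (φ : A →ₐ[ℂ] B) (F : A⟦X⟧⟦X⟧) (m n : ℕ) :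
    PowerSeries.coeff m (PowerSeries.coeff n (seriesMap φ F)) =
      φ (PowerSeries.coeff m (PowerSeries.coeff n F)) := rfl

theorem seriesMap_ser₁ (φ : A →ₐ[ℂ] B) (a : ℕ → A) :
    seriesMap φ (ser₁ a) = ser₁ (fun n => φ (a n)) := by
  refine series_ext fun m n => ?_
  simp only [coeff_seriesMap, ser₁, PowerSeries.coeff_C]
  split_ifs <;> simp

theorem seriesMap_ser₂ (φ : A →ₐ[ℂ] B) (a : ℕ → A) :
    seriesMap φ (ser₂ a) = ser₂ (fun n => φ (a n)) := by
  refine series_ext fun m n => ?_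
  simp only [coeff_seriesMap, ser₂, PowerSeries.coeff_map, PowerSeries.coeff_C]
  split_ifs <;> simp

theorem seriesMap_var₁ (φ : A →ₐ[ℂ] B) : seriesMap φ (var₁ A) = var₁ B := by
  refine series_ext fun m n => ?_
  simp only [coeff_seriesMap, var₁, PowerSeries.coeff_C]
  split_ifs <;> simp [PowerSeries.coeff_X, apply_ite φ]

theorem seriesMap_var₂ (φ : A →ₐ[ℂ] B) : seriesMap φ (var₂ A) = var₂ B := by
  refine series_ext fun m n => ?_
  simp only [coeff_seriesMap, var₂, PowerSeries.coeff_X]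
  split_ifs <;> simp [PowerSeries.coeff_one, apply_ite φ]

end Series

/-! ## The quantum affine superalgebra and the `q`-Yangian -/

/-- The generators `s_ij^(n)`, `t_ij^(n)` of `U_q(ĝl(1,1))`. -/
inductive Gen
  | s (i j : Fin 2) (n : ℕ)
  | t (i j : Fin 2) (n : ℕ)

/-- The free generator `s_ij^(n)`. -/
def sFree (i j : Fin 2) (n : ℕ) : FreeAlgebra ℂ Gen := FreeAlgebra.ι ℂ (Gen.s i j n)

/-- The free generator `t_ij^(n)`. -/
def tFree (i j : Fin 2) (n : ℕ) : FreeAlgebra ℂ Gen := FreeAlgebra.ι ℂ (Gen.t i j n)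

/-- The RTT relation `R_23(α,β) X_12(u) Y_13(v) = Y_13(v) X_12(u) R_23(α,β)` for
`X(u) = ∑ x_ij^(m) u^m ⊗ E_ij`, `Y(v) = ∑ y_ij^(n) v^n ⊗ E_ij`. -/
def IsRTT {A : Type*} [Ring A] [Algebra ℂ A] (q : ℂ) (α β : A⟦X⟧⟦X⟧)
    (x y : Fin 2 → Fin 2 → ℕ → A) : Prop :=
  ∀ i j k l, rttLeft q α β (fun a b => ser₁ (x a b)) (fun a b => ser₂ (y a b)) i j k l =
    rttRight q α β (fun a b => ser₁ (x a b)) (fun a b => ser₂ (y a b)) i j k l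

/-- The relations obtained from `R_23(α,β) X_12(u) Y_13(v) = Y_13(v) X_12(u) R_23(α,β)` by
comparing the coefficients of `u^m v^n ⊗ E_ij ⊗ E_kl`. -/
inductive RTTRel {A : Type*} [Ring A] [Algebra ℂ A] (q : ℂ) (α β : A⟦X⟧⟦X⟧)
    (x y : Fin 2 → Fin 2 → ℕ → A) : A → A → Prop
  | intro (i j k l : Fin 2) (m n : ℕ) : RTTRel q α β x y
      (PowerSeries.coeff m (PowerSeries.coeff n
        (rttLeft q α β (fun a b => ser₁ (x a b)) (fun a b => ser₂ (y a b)) i j k l)))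
      (PowerSeries.coeff m (PowerSeries.coeff n
        (rttRight q α β (fun a b => ser₁ (x a b)) (fun a b => ser₂ (y a b)) i j k l)))

/-- The defining relations of `U_q(ĝl(1,1))`. The series are `S(z) = ∑ S^(n) z^n` and
`T(z) = ∑ T^(n) z^(-n)`.
* `ss`: here `u = z`, `v = w`, and `R(z,w) = R(u,v)`.
* `tt`: here `u = z⁻¹`, `v = w⁻¹`; the relation is multiplied by `u v`, and `u v R(z,w) = R(v,u)`.
* `ts`: here `u = z⁻¹`, `v = w`; the relation is multiplied by `u`, and `u R(z,w) = R(1,u v)`. -/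
inductive Rel (q : ℂ) : FreeAlgebra ℂ Gen → FreeAlgebra ℂ Gen → Prop
  | ss {a b} : RTTRel q (var₁ _) (var₂ _) sFree sFree a b → Rel q a b
  | tt {a b} : RTTRel q (var₂ _) (var₁ _) tFree tFree a b → Rel q a b
  | ts {a b} : RTTRel q 1 (var₁ _ * var₂ _) tFree sFree a b → Rel q a b
  | t_zero : Rel q (tFree 0 1 0) 0
  | s_zero : Rel q (sFree 1 0 0) 0
  | t_mul_s (i : Fin 2) : Rel q (tFree i i 0 * sFree i i 0) 1
  | s_mul_t (i : Fin 2) : Rel q (sFree i i 0 * tFree i i 0) 1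

/-- The quantum affine superalgebra `U_q(ĝl(1,1))`. -/
def U (q : ℂ) : Type := RingQuot (Rel q)

instance (q : ℂ) : Ring (U q) := inferInstanceAs (Ring (RingQuot (Rel q)))

instance (q : ℂ) : Algebra ℂ (U q) := inferInstanceAs (Algebra ℂ (RingQuot (Rel q)))

/-- The quotient map onto `U_q(ĝl(1,1))`. -/
def mkU (q : ℂ) : FreeAlgebra ℂ Gen →ₐ[ℂ] U q := RingQuot.mkAlgHom ℂ (Rel q)

/-- The generator `s_ij^(n)` of `U_q(ĝl(1,1))`. -/
def sU (q : ℂ) (i j : Fin 2) (n : ℕ) : U q := mkU q (sFree i j n)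

/-- The generator `t_ij^(n)` of `U_q(ĝl(1,1))`. -/
def tU (q : ℂ) (i j : Fin 2) (n : ℕ) : U q := mkU q (tFree i j n)

section Lift

variable {A : Type*} [Ring A] [Algebra ℂ A]

theorem map_rttRel {B : Type*} [Ring B] [Algebra ℂ B] (φ : B →ₐ[ℂ] A) {q : ℂ}
    {α β : B⟦X⟧⟦X⟧} {x y : Fin 2 → Fin 2 → ℕ → B} :
    (∀ a b, RTTRel q α β x y a b → φ a = φ b) ↔
      IsRTT q (seriesMap φ α) (seriesMap φ β)
        (fun i j n => φ (x i j n)) (fun i j n => φ (y i j n)) := by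
  have e1 := rttLeft_map (seriesMap φ) q α β (fun a b => ser₁ (x a b)) (fun a b => ser₂ (y a b))
  have e2 := rttRight_map (seriesMap φ) q α β (fun a b => ser₁ (x a b)) (fun a b => ser₂ (y a b))
  simp only [seriesMap_ser₁, seriesMap_ser₂] at e1 e2
  simp only [IsRTT, ← e1, ← e2]
  constructor
  · intro h i j k l
    refine series_ext fun m n => ?_
    rw [coeff_seriesMap, coeff_seriesMap]
    exact h _ _ (RTTRel.intro i j k l m n)
  · rintro h a b ⟨i, j, k, l, m, n⟩
    rw [← coeff_seriesMap, ← coeff_seriesMap, h]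

/-- Elements `s_ij^(n)`, `t_ij^(n)` of an algebra that satisfy the relations of
`U_q(ĝl(1,1))`. -/
structure URelations (q : ℂ) (s t : Fin 2 → Fin 2 → ℕ → A) : Prop where
  ss : IsRTT q (var₁ A) (var₂ A) s s
  tt : IsRTT q (var₂ A) (var₁ A) t t
  ts : IsRTT q 1 (var₁ A * var₂ A) t s
  t_zero : t 0 1 0 = 0
  s_zero : s 1 0 0 = 0
  t_mul_s : ∀ i, t i i 0 * s i i 0 = 1
  s_mul_t : ∀ i, s i i 0 * t i i 0 = 1

theorem uRelations_U (q : ℂ) : URelations q (sU q) (tU q) := by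
  have key : ∀ a b, Rel q a b → mkU q a = mkU q b :=
    fun a b h => RingQuot.mkAlgHom_rel ℂ h
  refine ⟨?_, ?_, ?_, ?_, ?_, ?_, ?_⟩
  · have := (map_rttRel (mkU q)).1 fun a b h => key a b (.ss h)
    rwa [seriesMap_var₁, seriesMap_var₂] at this
  · have := (map_rttRel (mkU q)).1 fun a b h => key a b (.tt h)
    rwa [seriesMap_var₁, seriesMap_var₂] at this
  · have := (map_rttRel (mkU q)).1 fun a b h => key a b (.ts h)
    rwa [map_one, map_mul, seriesMap_var₁, seriesMap_var₂] at this
  · simpa [tU] using key _ _ .t_zero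
  · simpa [sU] using key _ _ .s_zero
  · intro i; simpa [sU, tU] using key _ _ (.t_mul_s i)
  · intro i; simpa [sU, tU] using key _ _ (.s_mul_t i)

/-- The images of the free generators. -/
def genMap (s t : Fin 2 → Fin 2 → ℕ → A) : Gen → A
  | .s i j n => s i j n
  | .t i j n => t i j n

/-- The universal property of `U_q(ĝl(1,1))`. -/
def liftU {q : ℂ} {s t : Fin 2 → Fin 2 → ℕ → A} (h : URelations q s t) : U q →ₐ[ℂ] A :=
  RingQuot.liftAlgHom ℂ ⟨FreeAlgebra.lift ℂ (genMap s t), by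
    have hs : ∀ i j n, FreeAlgebra.lift ℂ (genMap s t) (sFree i j n) = s i j n := by
      intro i j n; simp [sFree, genMap]
    have ht : ∀ i j n, FreeAlgebra.lift ℂ (genMap s t) (tFree i j n) = t i j n := by
      intro i j n; simp [tFree, genMap]
    intro a b hab
    cases hab with
    | ss hab =>
      refine (map_rttRel _).2 ?_ _ _ hab
      simpa only [seriesMap_var₁, seriesMap_var₂, hs] using h.ss
    | tt hab =>
      refine (map_rttRel _).2 ?_ _ _ hab
      simpa only [seriesMap_var₁, seriesMap_var₂, ht] using h.tt
    | ts hab =>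
      refine (map_rttRel _).2 ?_ _ _ hab
      simpa only [map_one, map_mul, seriesMap_var₁, seriesMap_var₂, hs, ht] using h.ts
    | t_zero => rw [ht, h.t_zero, map_zero]
    | s_zero => rw [hs, h.s_zero, map_zero]
    | t_mul_s i => rw [map_mul, ht, hs, h.t_mul_s, map_one]
    | s_mul_t i => rw [map_mul, ht, hs, h.s_mul_t, map_one]⟩

theorem liftU_sU {q : ℂ} {s t : Fin 2 → Fin 2 → ℕ → A} (h : URelations q s t) (i j : Fin 2)
    (n : ℕ) : liftU h (sU q i j n) = s i j n := by
  refine (RingQuot.liftAlgHom_mkAlgHom_apply ℂ (FreeAlgebra.lift ℂ (genMap s t)) _ _).trans ?_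
  rw [sFree, FreeAlgebra.lift_ι_apply, genMap]

theorem liftU_tU {q : ℂ} {s t : Fin 2 → Fin 2 → ℕ → A} (h : URelations q s t) (i j : Fin 2)
    (n : ℕ) : liftU h (tU q i j n) = t i j n := by
  refine (RingQuot.liftAlgHom_mkAlgHom_apply ℂ (FreeAlgebra.lift ℂ (genMap s t)) _ _).trans ?_
  rw [tFree, FreeAlgebra.lift_ι_apply, genMap]

theorem algHom_ext_U {q : ℂ} {φ ψ : U q →ₐ[ℂ] A} (hs : ∀ i j n, φ (sU q i j n) = ψ (sU q i j n))
    (ht : ∀ i j n, φ (tU q i j n) = ψ (tU q i j n)) : φ = ψ := by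
  refine RingQuot.ringQuot_ext' ℂ (s := Rel q) (B := A) φ ψ ?_
  ext g
  cases g with
  | s i j n => exact hs i j n
  | t i j n => exact ht i j n

end Lift

theorem isRTT_sgn {A : Type*} [Ring A] [Algebra ℂ A] {q : ℂ} {α β : A⟦X⟧⟦X⟧}
    {x y : Fin 2 → Fin 2 → ℕ → A} (h : IsRTT q α β x y) :
    IsRTT q α β (fun i j n => sgn (par i + par j) • x i j n)
      (fun i j n => sgn (par i + par j) • y i j n) := by
  intro i j k l
  simp only [ser₁_smul, ser₂_smul]
  rw [rttLeft_sgn, rttRight_sgn, h]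

/-- The parity automorphism of `U_q(ĝl(1,1))`: the generators `s_ij^(n)` and `t_ij^(n)` have
degree `|i| + |j|`. -/
def parityU (q : ℂ) : U q →ₐ[ℂ] U q :=
  liftU (q := q) (s := fun i j n => sgn (par i + par j) • sU q i j n)
    (t := fun i j n => sgn (par i + par j) • tU q i j n)
    { ss := isRTT_sgn (uRelations_U q).ss
      tt := isRTT_sgn (uRelations_U q).tt
      ts := isRTT_sgn (uRelations_U q).ts
      t_zero := by rw [(uRelations_U q).t_zero, smul_zero]
      s_zero := by rw [(uRelations_U q).s_zero, smul_zero]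
      t_mul_s := fun i => by
        rw [smul_mul_smul_comm, sgn_mul_self, one_smul, (uRelations_U q).t_mul_s]
      s_mul_t := fun i => by
        rw [smul_mul_smul_comm, sgn_mul_self, one_smul, (uRelations_U q).s_mul_t] }

theorem parityU_sU (q : ℂ) (i j : Fin 2) (n : ℕ) :
    parityU q (sU q i j n) = sgn (par i + par j) • sU q i j n := liftU_sU _ i j n

theorem parityU_tU (q : ℂ) (i j : Fin 2) (n : ℕ) :
    parityU q (tU q i j n) = sgn (par i + par j) • tU q i j n := liftU_tU _ i j n

theorem parityU_parityU (q : ℂ) (x : U q) : parityU q (parityU q x) = x := by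
  have : (parityU q).comp (parityU q) = AlgHom.id ℂ (U q) := by
    apply algHom_ext_U <;> intro i j n
    · simp [parityU_sU, smul_smul, sgn_mul_self]
    · simp [parityU_tU, smul_smul, sgn_mul_self]
  exact DFunLike.congr_fun this x

/-- The `ℤ/2`-grading of `U_q(ĝl(1,1))`. -/
abbrev gradU (q : ℂ) : ZMod 2 → Submodule ℂ (U q) := superPart (parityU q)

instance (q : ℂ) : GradedAlgebra (gradU q) := superGradedAlgebra _ (parityU_parityU q)

theorem sU_mem (q : ℂ) (i j : Fin 2) (n : ℕ) : sU q i j n ∈ gradU q (par i + par j) :=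
  mem_superPart.2 (parityU_sU q i j n)

theorem tU_mem (q : ℂ) (i j : Fin 2) (n : ℕ) : tU q i j n ∈ gradU q (par i + par j) :=
  mem_superPart.2 (parityU_tU q i j n)

/-! ### The coproduct -/

open GradedTensorProduct in
theorem right_mul_left {A B : Type*} [Ring A] [Algebra ℂ A] [Ring B] [Algebra ℂ B]
    (𝒜 : ZMod 2 → Submodule ℂ A) (ℬ : ZMod 2 → Submodule ℂ B) [GradedAlgebra 𝒜] [GradedAlgebra ℬ]
    {p r : ZMod 2} {a : A} {b : B} (ha : a ∈ 𝒜 p) (hb : b ∈ ℬ r) :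
    (includeRight 𝒜 ℬ b * includeLeft 𝒜 ℬ a : 𝒜 ᵍ⊗[ℂ] ℬ) =
      sgn (r * p) • (includeLeft 𝒜 ℬ a * includeRight 𝒜 ℬ b) := by
  have := tmul_coe_mul_coe_tmul 𝒜 ℬ (1 : A) (⟨b, hb⟩ : ℬ r) (⟨a, ha⟩ : 𝒜 p) (1 : B)
  simp only [one_mul, mul_one] at this
  rw [includeRight_apply, includeLeft_apply, tmul_one_mul_one_tmul, this, Units.smul_def,
    ← Int.cast_smul_eq_zsmul ℂ, ← sgn_eq_units]

section Coproduct

variable {A : Type*} [Ring A] [Algebra ℂ A] (𝒜 : ZMod 2 → Submodule ℂ A) [GradedAlgebra 𝒜]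

/-- `∑_{m + m' = n} ∑_k (-1)^{(|i|+|k|)(|k|+|j|)} x_ik^(m) ⊗ x_kj^(m')`, in the super tensor
product `A ⊗ A`. -/
def coprod (x : Fin 2 → Fin 2 → ℕ → A) (i j : Fin 2) (n : ℕ) : 𝒜 ᵍ⊗[ℂ] 𝒜 :=
  ∑ p ∈ Finset.HasAntidiagonal.antidiagonal n, ∑ k,
    sgn ((par i + par k) * (par k + par j)) • (x i k p.1 ᵍ⊗ₜ[ℂ] x k j p.2)

open GradedTensorProduct in
theorem coprod_eq (x : Fin 2 → Fin 2 → ℕ → A) (i j : Fin 2) :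
    coprod 𝒜 x i j = fun n => ∑ p ∈ Finset.HasAntidiagonal.antidiagonal n, ∑ k,
      sgn ((par i + par k) * (par k + par j)) •
        (includeLeft 𝒜 𝒜 (x i k p.1) * includeRight 𝒜 𝒜 (x k j p.2)) := by
  funext n
  simp only [coprod, includeLeft_apply, includeRight_apply, tmul_one_mul_one_tmul]

open GradedTensorProduct in
theorem isRTT_coprod {q : ℂ} {x y : Fin 2 → Fin 2 → ℕ → A}
    (hx : ∀ i j n, x i j n ∈ 𝒜 (par i + par j)) (hy : ∀ i j n, y i j n ∈ 𝒜 (par i + par j))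
    {α β : A⟦X⟧⟦X⟧} {α' β' : (𝒜 ᵍ⊗[ℂ] 𝒜)⟦X⟧⟦X⟧}
    (hα : ∀ φ : A →ₐ[ℂ] 𝒜 ᵍ⊗[ℂ] 𝒜, seriesMap φ α = α')
    (hβ : ∀ φ : A →ₐ[ℂ] 𝒜 ᵍ⊗[ℂ] 𝒜, seriesMap φ β = β') (h : IsRTT q α β x y) :
    IsRTT q α' β' (coprod 𝒜 x) (coprod 𝒜 y) := by
  have hmap : ∀ φ : A →ₐ[ℂ] 𝒜 ᵍ⊗[ℂ] 𝒜,
      IsRTT q α' β' (fun i j n => φ (x i j n)) (fun i j n => φ (y i j n)) := by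
    intro φ i j k l
    have e := congrArg (seriesMap φ) (h i j k l)
    rw [rttLeft_map, rttRight_map] at e
    simpa only [seriesMap_ser₁, seriesMap_ser₂, hα, hβ] using e
  intro i j k l
  have e₁ : (fun a b => ser₁ (coprod 𝒜 x a b)) = fun a b => ∑ k,
      sgn ((par a + par k) * (par k + par b)) •
        (ser₁ (fun n => includeLeft 𝒜 𝒜 (x a k n)) *
          ser₁ (fun n => includeRight 𝒜 𝒜 (x k b n))) := by
    funext a b
    rw [coprod_eq]
    exact ser₁_conv _ (fun k n => includeLeft 𝒜 𝒜 (x a k n))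
      (fun k n => includeRight 𝒜 𝒜 (x k b n))
  have e₂ : (fun a b => ser₂ (coprod 𝒜 y a b)) = fun a b => ∑ k,
      sgn ((par a + par k) * (par k + par b)) •
        (ser₂ (fun n => includeLeft 𝒜 𝒜 (y a k n)) *
          ser₂ (fun n => includeRight 𝒜 𝒜 (y k b n))) := by
    funext a b
    rw [coprod_eq]
    exact ser₂_conv _ (fun k n => includeLeft 𝒜 𝒜 (y a k n))
      (fun k n => includeRight 𝒜 𝒜 (y k b n))
  rw [e₁, e₂]
  refine rtt_mul q (hmap (includeLeft 𝒜 𝒜)) (hmap (includeRight 𝒜 𝒜)) ?_ ?_ i j k l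
  · intro i j k l
    refine series_ext fun m n => ?_
    simp only [PowerSeries.coeff_smul, coeff_ser₁_mul_ser₂, coeff_ser₂_mul_ser₁]
    exact right_mul_left 𝒜 𝒜 (hy k l n) (hx i j m)
  · intro i j k l
    refine series_ext fun m n => ?_
    simp only [PowerSeries.coeff_smul, coeff_ser₁_mul_ser₂, coeff_ser₂_mul_ser₁]
    exact right_mul_left 𝒜 𝒜 (hx k l m) (hy i j n)

end Coproduct

theorem coprod_tU_zero (q : ℂ) (i : Fin 2) :
    coprod (gradU q) (tU q) i i 0 = (tU q i i 0 ᵍ⊗ₜ[ℂ] tU q i i 0 : gradU q ᵍ⊗[ℂ] gradU q) := by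
  have h0 := (uRelations_U q).t_zero
  fin_cases i <;> simp [coprod, Fin.sum_univ_two, h0, GradedTensorProduct.tmul, par, sgn, show (1 + 1 : ZMod 2) = 0 from rfl]

theorem coprod_sU_zero (q : ℂ) (i : Fin 2) :
    coprod (gradU q) (sU q) i i 0 = (sU q i i 0 ᵍ⊗ₜ[ℂ] sU q i i 0 : gradU q ᵍ⊗[ℂ] gradU q) := by
  have h0 := (uRelations_U q).s_zero
  fin_cases i <;> simp [coprod, Fin.sum_univ_two, h0, GradedTensorProduct.tmul, par, sgn, show (1 + 1 : ZMod 2) = 0 from rfl]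

theorem diag_even (i : Fin 2) : par i + par i = 0 := by
  fin_cases i <;> decide

/-- The coproduct of `U_q(ĝl(1,1))`, with values in the super tensor product:
`Δ(s_ij^(n)) = ∑_{a=0}^n ∑_k (-1)^{(|i|+|k|)(|k|+|j|)} s_ik^(a) ⊗ s_kj^(n-a)`, and the same formula
for `t_ij^(n)`. -/
def comulU (q : ℂ) : U q →ₐ[ℂ] gradU q ᵍ⊗[ℂ] gradU q :=
  liftU (q := q) (s := coprod (gradU q) (sU q)) (t := coprod (gradU q) (tU q))
    { ss := isRTT_coprod _ (sU_mem q) (sU_mem q) seriesMap_var₁ seriesMap_var₂ (uRelations_U q).ss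
      tt := isRTT_coprod _ (tU_mem q) (tU_mem q) seriesMap_var₂ seriesMap_var₁ (uRelations_U q).tt
      ts := isRTT_coprod _ (tU_mem q) (sU_mem q) (fun φ => map_one _)
        (fun φ => by rw [map_mul, seriesMap_var₁, seriesMap_var₂]) (uRelations_U q).ts
      t_zero := by
        have h0 := (uRelations_U q).t_zero
        simp [coprod, Fin.sum_univ_two, h0, GradedTensorProduct.tmul]
      s_zero := by
        have h0 := (uRelations_U q).s_zero
        simp [coprod, Fin.sum_univ_two, h0, GradedTensorProduct.tmul]
      t_mul_s := fun i => by
        rw [coprod_tU_zero, coprod_sU_zero]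
        have hs : sU q i i 0 ∈ gradU q 0 := by simpa [diag_even] using sU_mem q i i 0
        have := GradedTensorProduct.tmul_coe_mul_zero_coe_tmul (gradU q) (gradU q) (tU q i i 0)
          (⟨_, tU_mem q i i 0⟩ : gradU q _) ⟨_, hs⟩ (sU q i i 0)
        rw [this, (uRelations_U q).t_mul_s]
        rfl
      s_mul_t := fun i => by
        rw [coprod_tU_zero, coprod_sU_zero]
        have ht : tU q i i 0 ∈ gradU q 0 := by simpa [diag_even] using tU_mem q i i 0
        have := GradedTensorProduct.tmul_coe_mul_zero_coe_tmul (gradU q) (gradU q) (sU q i i 0)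
          (⟨_, sU_mem q i i 0⟩ : gradU q _) ⟨_, ht⟩ (tU q i i 0)
        rw [this, (uRelations_U q).s_mul_t]
        rfl }

/-- The generators `s_ij^(n)` and `(s_ii^(0))⁻¹ = t_ii^(0)` of the `q`-Yangian. -/
def yGen (q : ℂ) : Set (U q) :=
  {x | ∃ i j n, x = sU q i j n} ∪ {x | ∃ i, x = tU q i i 0}

/-- The `q`-Yangian `Y_q(gl(1,1))`: the subalgebra of `U_q(ĝl(1,1))` generated by the `s_ij^(n)`
and the inverses `(s_ii^(0))⁻¹ = t_ii^(0)`. -/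
def Y (q : ℂ) : Subalgebra ℂ (U q) := Algebra.adjoin ℂ (yGen q)

theorem sU_mem_Y (q : ℂ) (i j : Fin 2) (n : ℕ) : sU q i j n ∈ Y q :=
  Algebra.subset_adjoin (Or.inl ⟨i, j, n, rfl⟩)

theorem tU_mem_Y (q : ℂ) (i : Fin 2) : tU q i i 0 ∈ Y q :=
  Algebra.subset_adjoin (Or.inr ⟨i, rfl⟩)

/-- The generator `s_ij^(n)` of `Y_q(gl(1,1))`. -/
def sY (q : ℂ) (i j : Fin 2) (n : ℕ) : Y q := ⟨sU q i j n, sU_mem_Y q i j n⟩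

/-- The generator `(s_ii^(0))⁻¹` of `Y_q(gl(1,1))`. -/
def sInvY (q : ℂ) (i : Fin 2) : Y q := ⟨tU q i i 0, tU_mem_Y q i⟩

theorem algHom_ext_Y {q : ℂ} {A : Type*} [Ring A] [Algebra ℂ A] {φ ψ : Y q →ₐ[ℂ] A}
    (hs : ∀ i j n, φ (sY q i j n) = ψ (sY q i j n)) (ht : ∀ i, φ (sInvY q i) = ψ (sInvY q i)) :
    φ = ψ := by
  refine AlgHom.adjoin_ext (s := yGen q) ?_
  rintro x (⟨i, j, n, rfl⟩ | ⟨i, rfl⟩)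
  · exact hs i j n
  · exact ht i

theorem parityU_mem_Y (q : ℂ) (x : Y q) : parityU q x ∈ Y q := by
  have : Y q ≤ (Y q).comap (parityU q) := by
    refine Algebra.adjoin_le ?_
    rintro x (⟨i, j, n, rfl⟩ | ⟨i, rfl⟩)
    · simpa [parityU_sU] using (Y q).smul_mem (sU_mem_Y q i j n) _
    · simpa [parityU_tU] using (Y q).smul_mem (tU_mem_Y q i) _
  exact this x.2

/-- The parity automorphism of `Y_q(gl(1,1))`. -/
def parityY (q : ℂ) : Y q →ₐ[ℂ] Y q :=
  ((parityU q).comp (Y q).val).codRestrict (Y q) (parityU_mem_Y q)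

theorem parityY_coe (q : ℂ) (x : Y q) : (parityY q x : U q) = parityU q x := rfl

theorem parityY_sY (q : ℂ) (i j : Fin 2) (n : ℕ) :
    parityY q (sY q i j n) = sgn (par i + par j) • sY q i j n :=
  Subtype.ext (parityU_sU q i j n)

theorem parityY_sInvY (q : ℂ) (i : Fin 2) : parityY q (sInvY q i) = sInvY q i :=
  Subtype.ext (by simp [parityY_coe, sInvY, parityU_tU, diag_even, sgn_zero])

theorem parityY_parityY (q : ℂ) (x : Y q) : parityY q (parityY q x) = x :=
  Subtype.ext (parityU_parityU q x)

/-- The `ℤ/2`-grading of `Y_q(gl(1,1))`. -/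
abbrev gradY (q : ℂ) : ZMod 2 → Submodule ℂ (Y q) := superPart (parityY q)

instance (q : ℂ) : GradedAlgebra (gradY q) := superGradedAlgebra _ (parityY_parityY q)

theorem sY_mem (q : ℂ) (i j : Fin 2) (n : ℕ) : sY q i j n ∈ gradY q (par i + par j) :=
  mem_superPart.2 (parityY_sY q i j n)

theorem gradY_coe {q : ℂ} {p : ZMod 2} {x : Y q} (hx : x ∈ gradY q p) : (x : U q) ∈ gradU q p := by
  rw [mem_superPart] at hx ⊢
  exact congrArg Subtype.val hx

/-- The inclusion `Y ⊗ Y → U ⊗ U` of super tensor products. -/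
def inclYY (q : ℂ) : (gradY q ᵍ⊗[ℂ] gradY q) →ₐ[ℂ] (gradU q ᵍ⊗[ℂ] gradU q) :=
  GradedTensorProduct.lift _ _
    ((GradedTensorProduct.includeLeft (gradU q) (gradU q)).comp (Y q).val)
    ((GradedTensorProduct.includeRight (gradU q) (gradU q)).comp (Y q).val) (by
      intro i j a b
      have := right_mul_left (gradU q) (gradU q) (gradY_coe a.2) (gradY_coe b.2)
      rw [AlgHom.comp_apply, AlgHom.comp_apply, Units.smul_def, ← Int.cast_smul_eq_zsmul ℂ,
        ← sgn_eq_units]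
      erw [this]
      rw [smul_smul, sgn_mul_self, one_smul]
      rfl)

theorem inclYY_tmul (q : ℂ) (x y : Y q) :
    inclYY q (x ᵍ⊗ₜ[ℂ] y) = ((x : U q) ᵍ⊗ₜ[ℂ] (y : U q) : gradU q ᵍ⊗[ℂ] gradU q) := by
  rw [inclYY, GradedTensorProduct.lift_tmul]
  exact GradedTensorProduct.tmul_one_mul_one_tmul _ _ _ _

theorem inclYY_injective (q : ℂ) : Function.Injective (inclYY q) := by
  have h : (inclYY q).toLinearMap ∘ₗ
      (GradedTensorProduct.of ℂ (gradY q) (gradY q)).toLinearMap =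
      (GradedTensorProduct.of ℂ (gradU q) (gradU q)).toLinearMap ∘ₗ
        TensorProduct.map (Y q).val.toLinearMap (Y q).val.toLinearMap := by
    ext x y
    exact inclYY_tmul q x y
  have hinj : Function.Injective
      (TensorProduct.map (Y q).val.toLinearMap (Y q).val.toLinearMap) :=
    TensorProduct.map_injective_of_flat_flat _ _ Subtype.val_injective Subtype.val_injective
  intro a b hab
  have key : ∀ c, inclYY q c = GradedTensorProduct.of ℂ (gradU q) (gradU q)
      (TensorProduct.map (Y q).val.toLinearMap (Y q).val.toLinearMap
        ((GradedTensorProduct.of ℂ (gradY q) (gradY q)).symm c)) := by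
    intro c
    have := LinearMap.congr_fun h ((GradedTensorProduct.of ℂ (gradY q) (gradY q)).symm c)
    simpa using this
  rw [key, key] at hab
  exact (GradedTensorProduct.of ℂ (gradY q) (gradY q)).symm.injective
    (hinj ((GradedTensorProduct.of ℂ (gradU q) (gradU q)).injective hab))

theorem inclYY_coprod (q : ℂ) (i j : Fin 2) (n : ℕ) :
    inclYY q (coprod (gradY q) (sY q) i j n) = comulU q (sU q i j n) := by
  rw [comulU, liftU_sU, coprod, coprod]
  simp only [map_sum, map_smul, inclYY_tmul]
  rfl

theorem inclYY_inv (q : ℂ) (i : Fin 2) :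
    inclYY q (sInvY q i ᵍ⊗ₜ[ℂ] sInvY q i) = comulU q (tU q i i 0) := by
  rw [comulU, liftU_tU, coprod_tU_zero, inclYY_tmul]
  rfl

theorem comulU_mem (q : ℂ) (y : Y q) : comulU q y ∈ (inclYY q).range := by
  have : Y q ≤ (inclYY q).range.comap (comulU q) := by
    refine Algebra.adjoin_le ?_
    rintro x (⟨i, j, n, rfl⟩ | ⟨i, rfl⟩)
    · exact ⟨_, inclYY_coprod q i j n⟩
    · exact ⟨_, inclYY_inv q i⟩
  exact this y.2

/-- The coproduct of `Y_q(gl(1,1))`: the restriction of the coproduct of `U_q(ĝl(1,1))`, which maps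
`Y` to `Y ⊗ Y ⊆ U ⊗ U`. -/
def comulY (q : ℂ) : Y q →ₐ[ℂ] gradY q ᵍ⊗[ℂ] gradY q :=
  (AlgEquiv.ofInjective (inclYY q) (inclYY_injective q)).symm.toAlgHom.comp
    (((comulU q).comp (Y q).val).codRestrict (inclYY q).range (comulU_mem q))

theorem inclYY_comulY (q : ℂ) (y : Y q) : inclYY q (comulY q y) = comulU q y :=
  congrArg Subtype.val ((AlgEquiv.ofInjective (inclYY q) (inclYY_injective q)).apply_symm_apply
    ⟨comulU q y, comulU_mem q y⟩)

theorem comulY_sY (q : ℂ) (i j : Fin 2) (n : ℕ) :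
    comulY q (sY q i j n) = coprod (gradY q) (sY q) i j n :=
  inclYY_injective q ((inclYY_comulY q _).trans (inclYY_coprod q i j n).symm)

theorem comulY_sInvY (q : ℂ) (i : Fin 2) :
    comulY q (sInvY q i) = (sInvY q i ᵍ⊗ₜ[ℂ] sInvY q i : gradY q ᵍ⊗[ℂ] gradY q) :=
  inclYY_injective q ((inclYY_comulY q _).trans (inclYY_inv q i).symm)

/-! ## Representations of the `q`-Yangian -/

/-- A `Y_q(gl(1,1))`-module (in the super sense): a complex vector superspace with an action of
`Y_q(gl(1,1))` compatible with the gradings. The `ℤ/2`-grading of the vector superspace is given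
by its parity involution `v ↦ (-1)^{|v|} v`, whose eigenspaces for `1` and `-1` are the even and
the odd part; the last field says that a homogeneous element of degree `p` maps vectors of degree
`r` to vectors of degree `p + r`. -/
structure YModule (q : ℂ) where
  carrier : Type u
  [addCommGroup : AddCommGroup carrier]
  [module : Module ℂ carrier]
  parity : carrier →ₗ[ℂ] carrier
  parity_parity : ∀ v, parity (parity v) = v
  act : Y q →ₐ[ℂ] Module.End ℂ carrier
  act_parity : ∀ y v, act (parityY q y) (parity v) = parity (act y v)

namespace YModule

variable {q : ℂ}

instance : CoeSort (YModule.{u} q) (Type u) := ⟨carrier⟩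

attribute [instance] addCommGroup module

/-- `v` is homogeneous of degree `p`. -/
def IsHomogeneousOfDegree (V : YModule.{u} q) (v : V) (p : ZMod 2) : Prop :=
  V.parity v = sgn p • v

theorem act_parity' (V : YModule.{u} q) {p : ZMod 2} {y : Y q} (hy : y ∈ gradY q p) (v : V) :
    V.act y (V.parity v) = sgn p • V.parity (V.act y v) := by
  rw [← V.act_parity, mem_superPart.1 hy, map_smul, LinearMap.smul_apply, smul_smul,
    sgn_mul_self, one_smul]

theorem even_odd_add (y : Y q) :
    (halfProj (parityY q) (parityY_parityY q) 0 y : Y q) +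
      (halfProj (parityY q) (parityY_parityY q) 1 y : Y q) = y := by
  rw [halfProj_coe, halfProj_coe, ← smul_add, sgn_zero, sgn_one, inv_smul_eq_iff₀ two_ne_zero,
    two_smul, one_smul, neg_smul, one_smul]
  abel

variable (V W : YModule.{u} q)

/-- The action of `y ⊗ 1` on the tensor product: `(y ⊗ 1)(v ⊗ w) = y v ⊗ w`. -/
def actLeft : Y q →ₐ[ℂ] Module.End ℂ (V ⊗[ℂ] W) :=
  (Module.End.rTensorAlgHom ℂ V W).comp V.act

theorem actLeft_tmul (y : Y q) (v : V) (w : W) : actLeft V W y (v ⊗ₜ w) = V.act y v ⊗ₜ w := rfl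

/-- The action of `1 ⊗ y` on the tensor product:
`(1 ⊗ y)(v ⊗ w) = v ⊗ y w` for `y` even, and `(1 ⊗ y)(v ⊗ w) = (-1)^{|v|} v ⊗ y w` for `y` odd. -/
def actRightLin : Y q →ₗ[ℂ] Module.End ℂ (V ⊗[ℂ] W) :=
  LinearMap.lTensorHom V ∘ₗ W.act.toLinearMap ∘ₗ
      (gradY q 0).subtype ∘ₗ halfProj (parityY q) (parityY_parityY q) 0 +
    LinearMap.mulLeft ℂ (V.parity.rTensor W : Module.End ℂ (V ⊗[ℂ] W)) ∘ₗ
      LinearMap.lTensorHom V ∘ₗ W.act.toLinearMap ∘ₗ (gradY q 1).subtype ∘ₗ halfProj (parityY q) (parityY_parityY q) 1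

theorem actRightLin_of_even {y : Y q} (hy : y ∈ gradY q 0) (v : V) (w : W) :
    actRightLin V W y (v ⊗ₜ w) = v ⊗ₜ W.act y w := by
  simp [actRightLin, halfProj_of_mem _ _ _ _ hy]

theorem actRightLin_of_odd {y : Y q} (hy : y ∈ gradY q 1) (v : V) (w : W) :
    actRightLin V W y (v ⊗ₜ w) = V.parity v ⊗ₜ W.act y w := by
  simp [actRightLin, halfProj_of_mem _ _ _ _ hy]

theorem actRightLin_mul_of_mem {p r : ZMod 2} {x y : Y q} (hx : x ∈ gradY q p)
    (hy : y ∈ gradY q r) :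
    actRightLin V W (x * y) = actRightLin V W x * actRightLin V W y := by
  have hxy := SetLike.mul_mem_graded (A := gradY q) hx hy
  refine TensorProduct.ext' fun v w => ?_
  rcases zmod_two_cases p with rfl | rfl <;> rcases zmod_two_cases r with rfl | rfl
  · rw [actRightLin_of_even V W hxy, Module.End.mul_apply, actRightLin_of_even V W hy,
      actRightLin_of_even V W hx, map_mul, Module.End.mul_apply]
  · rw [zero_add] at hxy
    rw [actRightLin_of_odd V W hxy, Module.End.mul_apply, actRightLin_of_odd V W hy,
      actRightLin_of_even V W hx, map_mul, Module.End.mul_apply]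
  · rw [add_zero] at hxy
    rw [actRightLin_of_odd V W hxy, Module.End.mul_apply, actRightLin_of_even V W hy,
      actRightLin_of_odd V W hx, map_mul, Module.End.mul_apply]
  · rw [show (1 + 1 : ZMod 2) = 0 from rfl] at hxy
    rw [actRightLin_of_even V W hxy, Module.End.mul_apply, actRightLin_of_odd V W hy,
      actRightLin_of_odd V W hx, map_mul, Module.End.mul_apply, parity_parity]

/-- The action of `1 ⊗ y` as an algebra morphism. -/
def actRight : Y q →ₐ[ℂ] Module.End ℂ (V ⊗[ℂ] W) :=
  AlgHom.ofLinearMap (actRightLin V W)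
    (by
      have h1 : (1 : Y q) ∈ gradY q 0 := SetLike.one_mem_graded (gradY q)
      refine TensorProduct.ext' fun v w => ?_
      rw [actRightLin_of_even V W h1, map_one]
      rfl)
    (by
      intro x y
      rw [← even_odd_add x, ← even_odd_add y]
      have hx := fun p => (halfProj (parityY q) (parityY_parityY q) p x).2
      have hy := fun p => (halfProj (parityY q) (parityY_parityY q) p y).2
      simp only [mul_add, add_mul, map_add]
      rw [actRightLin_mul_of_mem V W (hx 0) (hy 0), actRightLin_mul_of_mem V W (hx 0) (hy 1),
        actRightLin_mul_of_mem V W (hx 1) (hy 0), actRightLin_mul_of_mem V W (hx 1) (hy 1)])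

/-- The representation of the super tensor product `Y ⊗ Y` on `V ⊗ W`:
`(x ⊗ y)(v ⊗ w) = (-1)^{|y||v|} x v ⊗ y w`. -/
def actTwo : (gradY q ᵍ⊗[ℂ] gradY q) →ₐ[ℂ] Module.End ℂ (V ⊗[ℂ] W) :=
  GradedTensorProduct.lift _ _ (actLeft V W) (actRight V W) (by
    rintro p r ⟨x, hx⟩ ⟨y, hy⟩
    rw [Units.smul_def, ← Int.cast_smul_eq_zsmul ℂ, ← sgn_eq_units]
    refine TensorProduct.ext' fun v w => ?_
    change actLeft V W x (actRightLin V W y (v ⊗ₜ w)) =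
      sgn (r * p) • actRightLin V W y (actLeft V W x (v ⊗ₜ w))
    rcases zmod_two_cases r with rfl | rfl
    · rw [actRightLin_of_even V W hy, actLeft_tmul, actLeft_tmul, actRightLin_of_even V W hy,
        zero_mul, sgn_zero, one_smul]
    · rw [actRightLin_of_odd V W hy, actLeft_tmul, actLeft_tmul, actRightLin_of_odd V W hy,
        act_parity' V hx, one_mul, TensorProduct.smul_tmul'])

theorem actTwo_tmul {p r : ZMod 2} (x : Y q) {y : Y q} (hy : y ∈ gradY q r) {v : V}
    (hv : V.IsHomogeneousOfDegree v p) (w : W) :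
    actTwo V W (x ᵍ⊗ₜ[ℂ] y) (v ⊗ₜ w) = sgn (r * p) • (V.act x v ⊗ₜ[ℂ] W.act y w) := by
  change actLeft V W x (actRightLin V W y (v ⊗ₜ w)) = _
  rcases zmod_two_cases r with rfl | rfl
  · rw [actRightLin_of_even V W hy, actLeft_tmul, zero_mul, sgn_zero, one_smul]
  · rw [actRightLin_of_odd V W hy, actLeft_tmul, hv, one_mul, map_smul, TensorProduct.smul_tmul']

theorem actTwo_parity {p r : ZMod 2} {x y : Y q} (hx : x ∈ gradY q p) (hy : y ∈ gradY q r)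
    (z : V ⊗[ℂ] W) :
    actTwo V W (x ᵍ⊗ₜ[ℂ] y) (TensorProduct.map V.parity W.parity z) =
      sgn (p + r) • TensorProduct.map V.parity W.parity (actTwo V W (x ᵍ⊗ₜ[ℂ] y) z) := by
  induction z using TensorProduct.induction_on with
  | zero => simp
  | add a b ha hb => rw [map_add, map_add, map_add, map_add, smul_add, ha, hb]
  | tmul v w =>
    change actLeft V W x (actRightLin V W y (V.parity v ⊗ₜ W.parity w)) =
      sgn (p + r) • TensorProduct.map V.parity W.parity
        (actLeft V W x (actRightLin V W y (v ⊗ₜ w)))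
    rw [sgn_add, mul_comm]
    rcases zmod_two_cases r with rfl | rfl
    · rw [actRightLin_of_even V W hy, actRightLin_of_even V W hy, actLeft_tmul, actLeft_tmul,
        TensorProduct.map_tmul, act_parity' V hx, act_parity' W hy, TensorProduct.smul_tmul_smul,
        mul_comm]
    · rw [actRightLin_of_odd V W hy, actRightLin_of_odd V W hy, actLeft_tmul, actLeft_tmul,
        TensorProduct.map_tmul, act_parity' V hx, act_parity' W hy, TensorProduct.smul_tmul_smul,
        mul_comm]

theorem map_parity_parity (z : V ⊗[ℂ] W) :
    TensorProduct.map V.parity W.parity (TensorProduct.map V.parity W.parity z) = z := by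
  induction z using TensorProduct.induction_on with
  | zero => simp
  | add a b ha hb => rw [map_add, map_add, ha, hb]
  | tmul v w => simp [parity_parity]

/-- Conjugation by the parity involution of `V ⊗ W`. -/
def conjParity : Module.End ℂ (V ⊗[ℂ] W) →ₐ[ℂ] Module.End ℂ (V ⊗[ℂ] W) :=
  AlgHom.ofLinearMap
    ((LinearMap.mulLeft ℂ (TensorProduct.map V.parity W.parity : Module.End ℂ (V ⊗[ℂ] W))) ∘ₗ
      LinearMap.mulRight ℂ (TensorProduct.map V.parity W.parity : Module.End ℂ (V ⊗[ℂ] W)))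
    (by
      refine LinearMap.ext fun z => ?_
      simp [map_parity_parity])
    (by
      intro f g
      refine LinearMap.ext fun z => ?_
      simp [map_parity_parity])

theorem tensor_act_parity (y : Y q) (z : V ⊗[ℂ] W) :
    actTwo V W (comulY q (parityY q y)) (TensorProduct.map V.parity W.parity z) =
      TensorProduct.map V.parity W.parity (actTwo V W (comulY q y) z) := by
  have h : (actTwo V W).comp ((comulY q).comp (parityY q)) =
      (conjParity V W).comp ((actTwo V W).comp (comulY q)) := by
    refine algHom_ext_Y ?_ ?_
    · intro i j n
      refine LinearMap.ext fun z => ?_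
      simp only [AlgHom.comp_apply, parityY_sY, map_smul, comulY_sY, coprod, map_sum,
        LinearMap.smul_apply, LinearMap.sum_apply, Finset.smul_sum]
      refine Finset.sum_congr rfl fun m _ => Finset.sum_congr rfl fun k _ => ?_
      change _ = sgn _ • TensorProduct.map V.parity W.parity
        (actTwo V W (sY q i k m.1 ᵍ⊗ₜ[ℂ] sY q k j m.2) (TensorProduct.map V.parity W.parity z))
      rw [actTwo_parity V W (sY_mem q i k _) (sY_mem q k j _), map_smul, map_parity_parity,
        smul_comm]
      congr 3
      linear_combination -diag_even k
    · intro i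
      refine LinearMap.ext fun z => ?_
      have hi : sInvY q i ∈ gradY q 0 := mem_superPart.2 (by rw [parityY_sInvY, sgn_zero, one_smul])
      simp only [AlgHom.comp_apply, parityY_sInvY, comulY_sInvY]
      change _ = TensorProduct.map V.parity W.parity
        (actTwo V W (sInvY q i ᵍ⊗ₜ[ℂ] sInvY q i) (TensorProduct.map V.parity W.parity z))
      rw [actTwo_parity V W hi hi, map_smul, map_parity_parity, add_zero, sgn_zero, one_smul]
  have := LinearMap.congr_fun (DFunLike.congr_fun h y) (TensorProduct.map V.parity W.parity z)
  change _ = TensorProduct.map V.parity W.parity (actTwo V W (comulY q y)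
    (TensorProduct.map V.parity W.parity (TensorProduct.map V.parity W.parity z))) at this
  rwa [map_parity_parity] at this

/-- The tensor product of two `Y_q(gl(1,1))`-modules: `V ⊗ W`, graded by
`|v ⊗ w| = |v| + |w|`, on which `Y_q(gl(1,1))` acts through its coproduct. -/
def tensor : YModule.{u} q where
  carrier := V ⊗[ℂ] W
  parity := TensorProduct.map V.parity W.parity
  parity_parity := map_parity_parity V W
  act := (actTwo V W).comp (comulY q)
  act_parity := tensor_act_parity V W

/-- The tensor product `V_0 ⊗ (V_1 ⊗ (⋯ ⊗ V_s))`. -/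
def tensorFamily : (s : ℕ) → (Fin (s + 1) → YModule.{u} q) → YModule.{u} q
  | 0, V => V 0
  | s + 1, V => tensor (V 0) (tensorFamily s fun i => V i.succ)

/-- The vector `v_0 ⊗ (v_1 ⊗ (⋯ ⊗ v_s))`. -/
def tensorVector : (s : ℕ) → (V : Fin (s + 1) → YModule.{u} q) → (∀ i, V i) → tensorFamily s V
  | 0, _, v => v 0
  | s + 1, V, v => (v 0 ⊗ₜ[ℂ] tensorVector s (fun i => V i.succ) fun i => v i.succ :
      V 0 ⊗[ℂ] tensorFamily s fun i => V i.succ)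

variable {V W}
variable (V)

/-- A submodule of a `Y_q(gl(1,1))`-module: a graded subspace stable under the action. -/
def IsSub (W : Submodule ℂ V) : Prop :=
  (∀ w ∈ W, V.parity w ∈ W) ∧ ∀ (y : Y q), ∀ w ∈ W, V.act y w ∈ W

/-- A simple submodule. -/
def IsSimpleSub (W : Submodule ℂ V) : Prop :=
  V.IsSub W ∧ W ≠ ⊥ ∧ ∀ W' : Submodule ℂ V, V.IsSub W' → W' ≤ W → W' = ⊥ ∨ W' = W

/-- `V` is a simple module. -/
def IsSimple : Prop := V.IsSimpleSub ⊤

/-- The subspace `Y_q(gl(1,1)) v`. -/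
def generated (v : V) : Submodule ℂ V := LinearMap.range (V.act.toLinearMap.flip v)

theorem mem_generated (v w : V) : w ∈ V.generated v ↔ ∃ y, V.act y v = w := Iff.rfl

/-- `v` is a highest `ℓ`-weight vector: non-zero, homogeneous, annihilated by the `s_12^(n)`, and
an eigenvector of the `s_11^(n)` and the `s_22^(n)`. -/
def IsHighestLWeightVector (v : V) : Prop :=
  v ≠ 0 ∧ (∃ p, V.IsHomogeneousOfDegree v p) ∧ (∀ n, V.act (sY q 0 1 n) v = 0) ∧
    ∀ k n, ∃ c : ℂ, V.act (sY q k k n) v = c • v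

end YModule

/-! ## Rational functions -/

/-- The expansion at `z = 0` of a rational function that is regular at `0`. -/
def expansion (f : RatFunc ℂ) : ℂ⟦X⟧ := (f.num : ℂ⟦X⟧) * (f.denom : ℂ⟦X⟧)⁻¹

/-- The set of zeros of a non-zero rational function, as a meromorphic function on the Riemann
sphere `ℂ ∪ {∞}`. -/
def zeros (f : RatFunc ℂ) : Set (OnePoint ℂ) :=
  {x | (∃ a : ℂ, x = (a : OnePoint ℂ) ∧ f.num.eval a = 0) ∨
    (x = OnePoint.infty ∧ f.num.natDegree < f.denom.natDegree)}

/-- The set of poles of a non-zero rational function, as a meromorphic function on the Riemann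
sphere `ℂ ∪ {∞}`. -/
def poles (f : RatFunc ℂ) : Set (OnePoint ℂ) :=
  {x | (∃ a : ℂ, x = (a : OnePoint ℂ) ∧ f.denom.eval a = 0) ∨
    (x = OnePoint.infty ∧ f.denom.natDegree < f.num.natDegree)}

/-- `V` is (a model of) the simple module `V(f)`: it is simple and generated by an even highest
`ℓ`-weight vector `v` with `s_11(z) v = f(z) v` and `s_22(z) v = v`. -/
def IsSimpleOfHighestLWeight {q : ℂ} (V : YModule.{u} q) (f : RatFunc ℂ) : Prop :=
  V.IsSimple ∧ ∃ v : V, V.IsHighestLWeightVector v ∧ V.IsHomogeneousOfDegree v 0 ∧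
    V.generated v = ⊤ ∧
    (∀ n, V.act (sY q 0 0 n) v = PowerSeries.coeff n (expansion f) • v) ∧
    ∀ n, V.act (sY q 1 1 n) v = PowerSeries.coeff n (1 : ℂ⟦X⟧) • v

end QYangian

end

/-! Write A, B, C, D for the series s_11, s_12, s_21, s_22. The Gauss decomposition E = D⁻¹B, F =
D⁻¹C, H = D⁻¹A - FE brings the q-Yangian close to a loop algebra of gl(1|1). Let e_m, h_m be the
modes of E, H and g_m those of z⁻¹F(q⁻²z). The RTT relations give g_m g_n + g_n g_m = 0, e_m g_n +
g_n e_m = κ h_(m+n+1) and h_m g_n = g_n h_m (`gY_mul_gY`, `eY_mul_gY`, `hY_mul_gY`). The coproduct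
becomes Δ(E) = H⊗E + E⊗1 and Δ(G) = G⊗H + 1⊗G (`comul_ES`, `comul_gY`). On V(f) the series H acts by
the scalar series f. The eigenvalues of d_0 = s_22^(0) separate the highest vector (eigenvalue 1)
from all others (q⁻¹, q⁻², …), because q is not a root of unity.

Hence Yv is what the g_m generate from v, and Yv is the unique simple submodule exactly when the
common kernel of the e_m is the line of v (`generated_eq_lowerSpan`, `isSimpleSub_generated_iff`).
Parts (a) and (b) are thus mirror statements, cyclicity of v under the g_m and cocyclicity under the
e_m; part (c) is their conjunction.

Let f = p/Q have order n. On V(f) every matrix coefficient of G or E is a/Q with deg a < n, and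
non-degeneracy of the Hankel matrix of f makes every such numerator occur next to v
(`isRational_of_isSimpleOfHighestLWeight`, `exists_of_finrank_le`). On V⊗W, with weights p/Q and
p'/Q', a linear form applied to G gives (p'/Q')(a/Q) + b/Q' = (ap' + bQ)/(QQ'). If Q and p' have no
common zero on the sphere, this vanishes only for a = b = 0, so the span generated by v⊗w is stable
under the g_m of each factor and fills V⊗W. A common zero supplies a non-zero pair (a, b) with ap' +
bQ = 0, realised by a non-zero form vanishing on everything generated by v⊗w. For E the same
computation involves p and Q'. This gives `isCyclicVector_tensor_iff` and
`isCocyclicVector_tensor_iff`, and `tensorFamily_spec` iterates them. -/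

noncomputable section

namespace QYangian

/-! ## Consequences of the RTT relations over a commutative ring of spectral parameters -/

section RTTAlgebra

variable {R S : Type*} [CommRing R] [Ring S] [Algebra R S] {q p z w : R}
  {a₁ a₂ b₁ b₂ c₁ c₂ d₁ d₂ i₁ i₂ : S}

/-- Swapping the two spectral parameters in the relation between `B` and `D`. -/
theorem swap_b_d (hqp : q * p = 1) (hβ : ∀ x : S, (z * p - w * q) • x = 0 → x = 0)
    (h₁ : (z - w) • (b₁ * d₂) - (w * (q - p)) • (d₁ * b₂) = (z * p - w * q) • (d₂ * b₁))
    (h₂ : (z - w) • (d₁ * b₂) - (z * (q - p)) • (b₁ * d₂) = (z * p - w * q) • (b₂ * d₁)) :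
    (w - z) • (b₂ * d₁) - (z * (q - p)) • (d₂ * b₁) = (w * p - z * q) • (d₁ * b₂) := by
  refine sub_eq_zero.1 (hβ _ ?_)
  -- As a linear system in `b₁ * d₂` and `d₁ * b₂`, the hypotheses have determinant (z - w)² - zw(q
  -- - p)². Since qp = 1 it factors through zp - wq, which can then be cancelled.
  have e : (z * p - w * q) * (w * p - z * q) = - ((z - w) ^ 2 - z * w * (q - p) ^ 2) := by
    linear_combination (- (z ^ 2 + w ^ 2 - 2 * z * w)) * hqp
  have e2 : (z * p - w * q) • ((w * p - z * q) • (d₁ * b₂)) =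
      (- ((z - w) ^ 2 - z * w * (q - p) ^ 2)) • (d₁ * b₂) := by rw [smul_smul, e]
  rw [smul_sub, smul_sub, e2]
  linear_combination (norm := module) (z - w) • h₂ + (z * (q - p)) • h₁

/-- Swapping the two spectral parameters in the relation between `C` and `D`. -/
theorem swap_c_d (hqp : q * p = 1) (hβ : ∀ x : S, (z * p - w * q) • x = 0 → x = 0)
    (h₁ : (z * p - w * q) • (c₁ * d₂) = (z - w) • (d₂ * c₁) - (z * (q - p)) • (c₂ * d₁))
    (h₂ : (z * p - w * q) • (d₁ * c₂) = (z - w) • (c₂ * d₁) - (w * (q - p)) • (d₂ * c₁)) :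
    (w * p - z * q) • (d₂ * c₁) = (w - z) • (c₁ * d₂) - (z * (q - p)) • (d₁ * c₂) := by
  refine sub_eq_zero.1 (hβ _ ?_)
  have e : (z * p - w * q) * (w * p - z * q) = - ((z - w) ^ 2 - z * w * (q - p) ^ 2) := by
    linear_combination (- (z ^ 2 + w ^ 2 - 2 * z * w)) * hqp
  have e2 : (z * p - w * q) • ((w * p - z * q) • (d₂ * c₁)) =
      (- ((z - w) ^ 2 - z * w * (q - p) ^ 2)) • (d₂ * c₁) := by rw [smul_smul, e]
  rw [smul_sub, smul_sub, e2]
  linear_combination (norm := module) (z - w) • h₁ + (z * (q - p)) • h₂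

theorem inv_comm_of_comm (h₁ : d₁ * i₁ = 1) (h₁' : i₁ * d₁ = 1) (hd : d₁ * d₂ = d₂ * d₁) :
    i₁ * d₂ = d₂ * i₁ := by
  calc i₁ * d₂ = i₁ * (d₂ * d₁) * i₁ := by rw [mul_assoc, mul_assoc, h₁, mul_one]
    _ = d₂ * i₁ := by rw [← hd, ← mul_assoc, h₁', one_mul]

/-- Conjugation of `E = D⁻¹ B` by `D`. -/
theorem e_mul_d (h₁ : d₁ * i₁ = 1) (h₁' : i₁ * d₁ = 1) (h₂ : d₂ * i₂ = 1)
    (hd : d₁ * d₂ = d₂ * d₁)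
    (h : (z - w) • (b₁ * d₂) - (w * (q - p)) • (d₁ * b₂) = (z * p - w * q) • (d₂ * b₁)) :
    (z - w) • (i₁ * b₁ * d₂) =
      d₂ * ((w * (q - p)) • (i₂ * b₂) + (z * p - w * q) • (i₁ * b₁)) := by
  have e := congrArg (i₁ * ·) h
  simp only [mul_sub, mul_smul_comm, ← mul_assoc, h₁', one_mul,
    inv_comm_of_comm h₁ h₁' hd] at e
  simp only [mul_add, mul_smul_comm, ← mul_assoc, h₂, one_mul]
  linear_combination (norm := module) e

/-- Conjugation of `F = D⁻¹ C` by `D`. -/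
theorem f_mul_d (h₁ : d₁ * i₁ = 1) (h₂ : d₂ * i₂ = 1) (h₂' : i₂ * d₂ = 1)
    (hd : d₁ * d₂ = d₂ * d₁)
    (h : (z * p - w * q) • (d₁ * c₂) = (z - w) • (c₂ * d₁) - (w * (q - p)) • (d₂ * c₁)) :
    (z - w) • (i₂ * c₂ * d₁) =
      d₁ * ((w * (q - p)) • (i₁ * c₁) + (z * p - w * q) • (i₂ * c₂)) := by
  have e := congrArg (i₂ * ·) h
  simp only [mul_sub, mul_smul_comm, ← mul_assoc, h₂', one_mul,
    inv_comm_of_comm h₂ h₂' hd.symm] at e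
  simp only [mul_add, mul_smul_comm, ← mul_assoc, h₁, one_mul]
  linear_combination (norm := module) -e

theorem d_mul_d_cancel {x : S} (h₁' : i₁ * d₁ = 1) (h₂' : i₂ * d₂ = 1) (h : d₁ * d₂ * x = 0) :
    x = 0 := by
  have e := congrArg (fun y => i₂ * (i₁ * y)) h
  simpa only [mul_zero, ← mul_assoc, h₁', one_mul, mul_assoc i₂, h₂'] using e

/-- The relation between `E(z)` and `E(w)`, up to the squares `E(z)²` and `E(w)²`. -/
theorem e_mul_e {e₁ e₂ : S}
    (h₁' : i₁ * d₁ = 1) (h₂' : i₂ * d₂ = 1) (hd : d₁ * d₂ = d₂ * d₁)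
    (hb₁ : b₁ = d₁ * e₁) (hb₂ : b₂ = d₂ * e₂)
    (h : (z - w) • (e₁ * d₂) = d₂ * ((w * (q - p)) • e₂ + (z * p - w * q) • e₁))
    (h' : (w - z) • (e₂ * d₁) = d₁ * ((z * (q - p)) • e₁ + (w * p - z * q) • e₂))
    (hb : -((z * q - w * p) • (b₁ * b₂)) = (z * p - w * q) • (b₂ * b₁)) :
    ((z * q - w * p) * (z * p - w * q)) • (e₁ * e₂ + e₂ * e₁) =
      (q - p) • (((z * p - w * q) * z) • (e₁ * e₁) - ((z * q - w * p) * w) • (e₂ * e₂)) := by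
  have x₁ : (z - w) • (b₁ * b₂) =
      d₁ * d₂ * ((w * (q - p)) • (e₂ * e₂) + (z * p - w * q) • (e₁ * e₂)) := by
    rw [hb₁, hb₂, mul_assoc d₁, ← mul_assoc e₁, ← mul_smul_comm, ← smul_mul_assoc, h]
    simp only [mul_add, add_mul, mul_smul_comm, smul_mul_assoc, mul_assoc]
  have x₂ : (w - z) • (b₂ * b₁) =
      d₁ * d₂ * ((z * (q - p)) • (e₁ * e₁) + (w * p - z * q) • (e₂ * e₁)) := by
    rw [hb₁, hb₂, mul_assoc d₂, ← mul_assoc e₂, ← mul_smul_comm, ← smul_mul_assoc, h', hd]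
    simp only [mul_add, add_mul, mul_smul_comm, smul_mul_assoc, mul_assoc]
  refine sub_eq_zero.1 (d_mul_d_cancel h₁' h₂' ?_)
  -- The relation between B(z) and B(w), multiplied by w - z and with both D's moved to the left,
  -- where D(z)D(w) can be stripped off.
  have x₃ : (z * q - w * p) • (d₁ * d₂ * ((w * (q - p)) • (e₂ * e₂) +
      (z * p - w * q) • (e₁ * e₂))) = (z * p - w * q) • (d₁ * d₂ * ((z * (q - p)) • (e₁ * e₁) +
      (w * p - z * q) • (e₂ * e₁))) := by
    rw [← x₁, ← x₂]
    linear_combination (norm := module) (w - z) • hb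
  simp only [mul_add, mul_sub, mul_smul_comm, smul_add, smul_sub] at x₃ ⊢
  linear_combination (norm := module) x₃

/-- The relation between `F(z)` and `F(w)`, up to the squares `F(z)²` and `F(w)²`. -/
theorem f_mul_f {f₁ f₂ : S} (h₁' : i₁ * d₁ = 1) (h₂' : i₂ * d₂ = 1) (hd : d₁ * d₂ = d₂ * d₁)
    (hc₁ : c₁ = d₁ * f₁) (hc₂ : c₂ = d₂ * f₂)
    (h : (z - w) • (f₂ * d₁) = d₁ * ((w * (q - p)) • f₁ + (z * p - w * q) • f₂))
    (h' : (w - z) • (f₁ * d₂) = d₂ * ((z * (q - p)) • f₂ + (w * p - z * q) • f₁))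
    (hc : -((z * p - w * q) • (c₁ * c₂)) = (z * q - w * p) • (c₂ * c₁)) :
    ((z * q - w * p) * (z * p - w * q)) • (f₁ * f₂ + f₂ * f₁) =
      (q - p) • (((z * p - w * q) * z) • (f₂ * f₂) - ((z * q - w * p) * w) • (f₁ * f₁)) := by
  have x₁ : (w - z) • (c₁ * c₂) =
      d₁ * d₂ * ((z * (q - p)) • (f₂ * f₂) + (w * p - z * q) • (f₁ * f₂)) := by
    rw [hc₁, hc₂, mul_assoc d₁, ← mul_assoc f₁, ← mul_smul_comm, ← smul_mul_assoc, h']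
    simp only [mul_add, add_mul, mul_smul_comm, smul_mul_assoc, mul_assoc]
  have x₂ : (z - w) • (c₂ * c₁) =
      d₁ * d₂ * ((w * (q - p)) • (f₁ * f₁) + (z * p - w * q) • (f₂ * f₁)) := by
    rw [hc₁, hc₂, mul_assoc d₂, ← mul_assoc f₂, ← mul_smul_comm, ← smul_mul_assoc, h, hd]
    simp only [mul_add, add_mul, mul_smul_comm, smul_mul_assoc, mul_assoc]
  refine sub_eq_zero.1 (d_mul_d_cancel h₁' h₂' ?_)
  have x₃ : (z * p - w * q) • (d₁ * d₂ * ((z * (q - p)) • (f₂ * f₂) +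
      (w * p - z * q) • (f₁ * f₂))) = (z * q - w * p) • (d₁ * d₂ * ((w * (q - p)) • (f₁ * f₁) +
      (z * p - w * q) • (f₂ * f₁))) := by
    rw [← x₁, ← x₂]
    linear_combination (norm := module) (z - w) • hc
  simp only [mul_add, mul_sub, mul_smul_comm, smul_add, smul_sub] at x₃ ⊢
  linear_combination (norm := module) -x₃

/-- The relation between `E(z)` and `F(w)`. -/
theorem e_mul_f {e₁ e₂ f₁ f₂ : S}
    (h₁' : i₁ * d₁ = 1) (h₂' : i₂ * d₂ = 1) (h₁ : d₁ * i₁ = 1) (h₂ : d₂ * i₂ = 1)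
    (hd : d₁ * d₂ = d₂ * d₁) (hb₁ : b₁ = d₁ * e₁) (hc₂ : c₂ = d₂ * f₂)
    (he : (z - w) • (e₁ * d₂) = d₂ * ((w * (q - p)) • e₂ + (z * p - w * q) • e₁))
    (hf : (z - w) • (f₂ * d₁) = d₁ * ((w * (q - p)) • f₁ + (z * p - w * q) • f₂))
    (h : (z - w) • (b₁ * c₂ + c₂ * b₁) = (w * (q - p)) • (d₂ * a₁ - d₁ * a₂)) :
    (z * p - w * q) • (e₁ * f₂ + f₂ * e₁) =
      (w * (q - p)) • ((i₁ * a₁ - f₁ * e₁) - (i₂ * a₂ + e₂ * f₂)) := by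
  have x₁ : (z - w) • (b₁ * c₂) =
      d₁ * d₂ * ((w * (q - p)) • (e₂ * f₂) + (z * p - w * q) • (e₁ * f₂)) := by
    rw [hb₁, hc₂, mul_assoc d₁, ← mul_assoc e₁, ← mul_smul_comm, ← smul_mul_assoc, he]
    simp only [mul_add, add_mul, mul_smul_comm, smul_mul_assoc, mul_assoc]
  have x₂ : (z - w) • (c₂ * b₁) =
      d₁ * d₂ * ((w * (q - p)) • (f₁ * e₁) + (z * p - w * q) • (f₂ * e₁)) := by
    rw [hb₁, hc₂, mul_assoc d₂, ← mul_assoc f₂, ← mul_smul_comm, ← smul_mul_assoc, hf, hd]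
    simp only [mul_add, add_mul, mul_smul_comm, smul_mul_assoc, mul_assoc]
  have x₃ : d₂ * a₁ = d₁ * d₂ * (i₁ * a₁) := by
    rw [hd, mul_assoc, ← mul_assoc d₁, h₁, one_mul]
  have x₄ : d₁ * a₂ = d₁ * d₂ * (i₂ * a₂) := by
    rw [mul_assoc, ← mul_assoc d₂, h₂, one_mul]
  refine sub_eq_zero.1 (d_mul_d_cancel h₁' h₂' ?_)
  rw [smul_add, x₁, x₂, x₃, x₄] at h
  simp only [mul_add, mul_sub, mul_smul_comm, smul_add, smul_sub] at h ⊢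
  linear_combination (norm := module) h

end RTTAlgebra

/-! ## Two-variable power series as an algebra over the ring of scalar power series -/

section TwoVariables

variable {A : Type*} [Ring A] [Algebra ℂ A]

/-- A series in the first variable. -/
def inVar₁ : A⟦X⟧ →+* A⟦X⟧⟦X⟧ := PowerSeries.C

/-- A series in the second variable. -/
def inVar₂ : A⟦X⟧ →+* A⟦X⟧⟦X⟧ := PowerSeries.map PowerSeries.C

/-- Applied once per variable, this makes scalar series central in `A⟦X⟧⟦X⟧` and so supports
`scalarAlgebra`. -/
theorem map_central {K B : Type*} [CommRing K] [Ring B] {φ : K →+* B}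
    (h : ∀ r x, φ r * x = x * φ r) (r : K⟦X⟧) (x : B⟦X⟧) :
    PowerSeries.map φ r * x = x * PowerSeries.map φ r := by
  ext n
  rw [PowerSeries.coeff_mul, PowerSeries.coeff_mul, ← Finset.Nat.sum_antidiagonal_swap]
  refine Finset.sum_congr rfl fun m _ => ?_
  simp [h]

/-- The ring of scalar power series in the two spectral parameters. -/
def Scalar : Type := ℂ⟦X⟧⟦X⟧

instance : CommRing Scalar := inferInstanceAs (CommRing ℂ⟦X⟧⟦X⟧)

/-- The first spectral parameter. -/
def varZ : Scalar := var₁ ℂ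

/-- The second spectral parameter. -/
def varW : Scalar := var₂ ℂ

variable (A) in
/-- The inclusion of the scalar power series in `A⟦u⟧⟦v⟧`. -/
def scalarMap : Scalar →+* A⟦X⟧⟦X⟧ := PowerSeries.map (PowerSeries.map (algebraMap ℂ A))

/-- `A⟦u⟧⟦v⟧` is an algebra over the scalar power series. -/
instance scalarAlgebra : Algebra Scalar A⟦X⟧⟦X⟧ :=
  (scalarMap A).toAlgebra' (map_central (map_central Algebra.commutes))

/-- A complex number as a scalar power series. -/
def cst : ℂ →+* Scalar := PowerSeries.C.comp PowerSeries.C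

theorem var₁_smul (x : A⟦X⟧⟦X⟧) : varZ • x = var₁ A * x := by
  change PowerSeries.map (PowerSeries.map (algebraMap ℂ A)) (PowerSeries.C PowerSeries.X) * x = _
  rw [PowerSeries.map_C, PowerSeries.map_X, var₁]

theorem var₂_smul (x : A⟦X⟧⟦X⟧) : varW • x = var₂ A * x := by
  change PowerSeries.map (PowerSeries.map (algebraMap ℂ A)) PowerSeries.X * x = _
  rw [PowerSeries.map_X, var₂]

theorem cst_smul (r : ℂ) (x : A⟦X⟧⟦X⟧) : cst r • x = r • x := by
  change PowerSeries.map (PowerSeries.map (algebraMap ℂ A)) (PowerSeries.C (PowerSeries.C r)) * x = _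
  rw [PowerSeries.map_C, PowerSeries.map_C]
  refine series_ext fun m n => ?_
  rw [PowerSeries.coeff_C_mul, PowerSeries.coeff_C_mul, PowerSeries.coeff_smul,
    PowerSeries.coeff_smul, Algebra.smul_def]

/-- The coefficient of `u^m v^n`. -/
def coeff₂ (m n : ℕ) (x : A⟦X⟧⟦X⟧) : A := PowerSeries.coeff m (PowerSeries.coeff n x)

omit [Algebra ℂ A] in
theorem coeff₂_add (m n : ℕ) (x y : A⟦X⟧⟦X⟧) :
    coeff₂ m n (x + y) = coeff₂ m n x + coeff₂ m n y := by simp [coeff₂]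

omit [Algebra ℂ A] in
theorem coeff₂_sub (m n : ℕ) (x y : A⟦X⟧⟦X⟧) :
    coeff₂ m n (x - y) = coeff₂ m n x - coeff₂ m n y := by simp [coeff₂]

theorem coeff₂_cst_smul (m n : ℕ) (r : ℂ) (x : A⟦X⟧⟦X⟧) :
    coeff₂ m n (cst r • x) = r • coeff₂ m n x := by
  rw [cst_smul, coeff₂, PowerSeries.coeff_smul, PowerSeries.coeff_smul, coeff₂]

theorem coeff₂_var₁_succ (m n : ℕ) (x : A⟦X⟧⟦X⟧) :
    coeff₂ (m + 1) n (varZ • x) = coeff₂ m n x := by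
  rw [var₁_smul, coeff₂, var₁, PowerSeries.coeff_C_mul, PowerSeries.coeff_succ_X_mul, coeff₂]

theorem coeff₂_var₁_zero (n : ℕ) (x : A⟦X⟧⟦X⟧) : coeff₂ 0 n (varZ • x) = 0 := by
  rw [var₁_smul, coeff₂, var₁, PowerSeries.coeff_C_mul, PowerSeries.coeff_zero_X_mul]

theorem coeff₂_var₂_succ (m n : ℕ) (x : A⟦X⟧⟦X⟧) :
    coeff₂ m (n + 1) (varW • x) = coeff₂ m n x := by
  rw [var₂_smul, coeff₂, var₂, PowerSeries.coeff_succ_X_mul, coeff₂]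

theorem coeff₂_var₂_zero (m : ℕ) (x : A⟦X⟧⟦X⟧) : coeff₂ m 0 (varW • x) = 0 := by
  rw [var₂_smul, coeff₂, var₂, PowerSeries.coeff_zero_X_mul, map_zero]

omit [Algebra ℂ A] in
theorem coeff₂_ext {x y : A⟦X⟧⟦X⟧} (h : ∀ m n, coeff₂ m n x = coeff₂ m n y) : x = y :=
  series_ext h

/-- `r u - s v` is not a zero divisor if `r ≠ 0`. -/
theorem linear_nonZeroDivisor {r : ℂ} (hr : r ≠ 0) (s : ℂ) (x : A⟦X⟧⟦X⟧)
    (h : (varZ * cst r - varW * cst s) • x = 0) : x = 0 := by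
  have h' : ∀ m n, coeff₂ m n (varZ • cst r • x) = coeff₂ m n (varW • cst s • x) := by
    intro m n
    rw [sub_smul, mul_smul, mul_smul, sub_eq_zero] at h
    rw [h]
  refine coeff₂_ext fun m n => ?_
  -- Induction on the power of v: the coefficient of u^(m+1) v^n in the product is r x_(m,n) minus s
  -- x_(m+1,n-1), and the second term is already zero.
  have : ∀ n m, coeff₂ m n x = 0 := by
    intro n
    induction n with
    | zero =>
      intro m
      have := h' (m + 1) 0
      rw [coeff₂_var₁_succ, coeff₂_var₂_zero, coeff₂_cst_smul] at this
      exact (smul_eq_zero_iff_right hr).1 this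
    | succ n ih =>
      intro m
      have := h' (m + 1) (n + 1)
      rw [coeff₂_var₁_succ, coeff₂_var₂_succ, coeff₂_cst_smul, coeff₂_cst_smul, ih,
        smul_zero] at this
      exact (smul_eq_zero_iff_right hr).1 this
  rw [this]
  simp [coeff₂]

/-- The coefficient of `u^N` in `x(u, t u)`. -/
def evalCoeff (t : ℂ) (N : ℕ) (x : A⟦X⟧⟦X⟧) : A :=
  ∑ m ∈ Finset.HasAntidiagonal.antidiagonal N, t ^ m.2 • coeff₂ m.1 m.2 x

theorem evalCoeff_sub (t : ℂ) (N : ℕ) (x y : A⟦X⟧⟦X⟧) :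
    evalCoeff t N (x - y) = evalCoeff t N x - evalCoeff t N y := by
  simp only [evalCoeff, coeff₂_sub, smul_sub, Finset.sum_sub_distrib]

theorem evalCoeff_cst_smul (t : ℂ) (N : ℕ) (r : ℂ) (x : A⟦X⟧⟦X⟧) :
    evalCoeff t N (cst r • x) = r • evalCoeff t N x := by
  simp only [evalCoeff, coeff₂_cst_smul, Finset.smul_sum, smul_comm r]

theorem evalCoeff_var₁_succ (t : ℂ) (N : ℕ) (x : A⟦X⟧⟦X⟧) :
    evalCoeff t (N + 1) (varZ • x) = evalCoeff t N x := by
  rw [evalCoeff, Finset.Nat.sum_antidiagonal_succ]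
  simp only [coeff₂_var₁_zero, coeff₂_var₁_succ, smul_zero, zero_add, evalCoeff]

theorem evalCoeff_var₂_succ (t : ℂ) (N : ℕ) (x : A⟦X⟧⟦X⟧) :
    evalCoeff t (N + 1) (varW • x) = t • evalCoeff t N x := by
  rw [evalCoeff, Finset.Nat.sum_antidiagonal_succ']
  simp only [coeff₂_var₂_zero, coeff₂_var₂_succ, smul_zero, zero_add, evalCoeff, Finset.smul_sum,
    smul_smul, pow_succ']

theorem evalCoeff_linear_succ (t r s : ℂ) (N : ℕ) (x : A⟦X⟧⟦X⟧) :
    evalCoeff t (N + 1) ((varZ * cst r - varW * cst s) • x) =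
      (r - t * s) • evalCoeff t N x := by
  rw [sub_smul, mul_smul, mul_smul, evalCoeff_sub, evalCoeff_var₁_succ, evalCoeff_var₂_succ,
    evalCoeff_cst_smul, evalCoeff_cst_smul, sub_smul, mul_smul]

theorem evalCoeff_inVar₁ (t : ℂ) (N : ℕ) (G : A⟦X⟧) :
    evalCoeff t N (inVar₁ G) = PowerSeries.coeff N G := by
  rw [evalCoeff, Finset.sum_eq_single (N, 0)]
  · simp [coeff₂, inVar₁]
  · rintro ⟨a, b⟩ hab hne
    have : b ≠ 0 := by
      rintro rfl
      exact hne (by simpa using hab)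
    simp [coeff₂, inVar₁, PowerSeries.coeff_C, this]
  · simp

theorem evalCoeff_inVar₂ (t : ℂ) (N : ℕ) (G : A⟦X⟧) :
    evalCoeff t N (inVar₂ G) = t ^ N • PowerSeries.coeff N G := by
  rw [evalCoeff, Finset.sum_eq_single (0, N)]
  · simp [coeff₂, inVar₂]
  · rintro ⟨a, b⟩ hab hne
    have : a ≠ 0 := by
      rintro rfl
      exact hne (by simpa using hab)
    simp [coeff₂, inVar₂, PowerSeries.coeff_C, this]
  · simp

/-- On the line w = q²z the factor zq - wq⁻¹ vanishes, while zq⁻¹ - wq becomes (q⁻¹ - q³)z, which is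
non-zero because q⁴ ≠ 1. So the restriction of y to this line is zero. -/
theorem evalCoeff_eq_zero {q : ℂ} (hq₀ : q ≠ 0) (hq : q ^ 4 ≠ 1) {x y : A⟦X⟧⟦X⟧}
    (h : (varZ * cst q - varW * cst q⁻¹) • x =
      (varZ * cst q⁻¹ - varW * cst q) • varZ • y) (N : ℕ) : evalCoeff (q ^ 2) N y = 0 := by
  have e := congrArg (evalCoeff (q ^ 2) (N + 2)) h
  rw [evalCoeff_linear_succ, evalCoeff_linear_succ, evalCoeff_var₁_succ,
    show q - q ^ 2 * q⁻¹ = 0 by field_simp; ring, zero_smul, eq_comm, smul_eq_zero_iff_right] at e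
  · exact e
  · intro h0
    apply hq
    field_simp at h0
    linear_combination -h0

end TwoVariables

/-! ## Gauss decomposition of the generating matrix of the `q`-Yangian -/

section Gauss

variable {q : ℂ}

theorem isRTT_sY (q : ℂ) : IsRTT q (var₁ (Y q)) (var₂ (Y q)) (sY q) (sY q) := by
  intro i j k l
  have h := (uRelations_U q).ss i j k l
  have e1 := rttLeft_map (seriesMap (Y q).val) q (var₁ (Y q)) (var₂ (Y q))
    (fun a b => ser₁ (sY q a b)) (fun a b => ser₂ (sY q a b)) i j k l
  have e2 := rttRight_map (seriesMap (Y q).val) q (var₁ (Y q)) (var₂ (Y q))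
    (fun a b => ser₁ (sY q a b)) (fun a b => ser₂ (sY q a b)) i j k l
  simp only [seriesMap_ser₁, seriesMap_ser₂, seriesMap_var₁, seriesMap_var₂] at e1 e2
  have h' := (e1.trans h).trans e2.symm
  refine series_ext fun m n => Subtype.val_injective ?_
  have := congrArg (fun F => PowerSeries.coeff m (PowerSeries.coeff n F)) h'
  exact this

/-- The generating series `s_ij(z)`. -/
def SY (q : ℂ) (i j : Fin 2) : (Y q)⟦X⟧ := PowerSeries.mk (sY q i j)

/-- The coefficients of the Perk-Schultz matrix as scalar power series. -/
def rScalar (q : ℂ) (a b c d : Fin 2) : Scalar :=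
  varZ * cst (rCoeffZ q a b c d) + varW * cst (rCoeffW q a b c d)

theorem rScalar_smul {A : Type*} [Ring A] [Algebra ℂ A] (q : ℂ) (a b c d : Fin 2) (x : A⟦X⟧⟦X⟧) :
    rScalar q a b c d • x = (rCoeffZ q a b c d • var₁ A + rCoeffW q a b c d • var₂ A) * x := by
  rw [rScalar, add_smul, mul_smul, mul_smul, var₁_smul, var₂_smul, cst_smul, cst_smul, add_mul,
    smul_mul_assoc, smul_mul_assoc, mul_smul_comm, mul_smul_comm]

theorem smul_mul_rScalar {A : Type*} [Ring A] [Algebra ℂ A] (q : ℂ) (a b c d : Fin 2)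
    (x : A⟦X⟧⟦X⟧) :
    x * (rCoeffZ q a b c d • var₁ A + rCoeffW q a b c d • var₂ A) = rScalar q a b c d • x := by
  have h : rCoeffZ q a b c d • var₁ A + rCoeffW q a b c d • var₂ A =
      rScalar q a b c d • (1 : A⟦X⟧⟦X⟧) := by rw [rScalar_smul, mul_one]
  rw [h, mul_smul_comm, mul_one]

/-- The spectral parameters now act as scalars, so each entry is a linear identity over `Scalar`
that `module` can handle. -/
theorem rtt_SY (q : ℂ) (i j k l : Fin 2) :
    ∑ a, ∑ c, (sgn ((par k + par c) * (par a + par j)) * sgn ((par a + par j) * (par c + par l))) •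
      (rScalar q i a k c • (inVar₁ (SY q a j) * inVar₂ (SY q c l))) =
    ∑ b, ∑ d, sgn ((par k + par d) * (par b + par j)) •
      (rScalar q b j d l • (inVar₂ (SY q k d) * inVar₁ (SY q i b))) := by
  have h := isRTT_sY q i j k l
  simp only [rttLeft, rttRight, ← rScalar_smul, smul_mul_rScalar] at h
  exact h

theorem one_add_one_zmod : (1 + 1 : ZMod 2) = 0 := rfl

/-- Each lemma `relation_*` is one matrix entry of the RTT relation; the four indices given to
`rtt_SY` select it. -/
theorem relation_b_d (q : ℂ) :
    (varZ - varW) • (inVar₁ (SY q 0 1) * inVar₂ (SY q 1 1)) -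
      (varW * (cst q - cst q⁻¹)) • (inVar₁ (SY q 1 1) * inVar₂ (SY q 0 1)) =
    (varZ * cst q⁻¹ - varW * cst q) • (inVar₂ (SY q 1 1) * inVar₁ (SY q 0 1)) := by
  have h := rtt_SY q 0 1 1 1
  simp [Fin.sum_univ_two, rScalar, rCoeffZ, rCoeffW, qi, par, sgn, one_add_one_zmod] at h
  linear_combination (norm := module) h

theorem relation_d_b (q : ℂ) :
    (varZ - varW) • (inVar₁ (SY q 1 1) * inVar₂ (SY q 0 1)) -
      (varZ * (cst q - cst q⁻¹)) • (inVar₁ (SY q 0 1) * inVar₂ (SY q 1 1)) =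
    (varZ * cst q⁻¹ - varW * cst q) • (inVar₂ (SY q 0 1) * inVar₁ (SY q 1 1)) := by
  have h := rtt_SY q 1 1 0 1
  simp [Fin.sum_univ_two, rScalar, rCoeffZ, rCoeffW, qi, par, sgn, one_add_one_zmod] at h
  linear_combination (norm := module) h

theorem relation_c_d (q : ℂ) :
    (varZ * cst q⁻¹ - varW * cst q) • (inVar₁ (SY q 1 0) * inVar₂ (SY q 1 1)) =
      (varZ - varW) • (inVar₂ (SY q 1 1) * inVar₁ (SY q 1 0)) -
        (varZ * (cst q - cst q⁻¹)) • (inVar₂ (SY q 1 0) * inVar₁ (SY q 1 1)) := by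
  have h := rtt_SY q 1 0 1 1
  simp [Fin.sum_univ_two, rScalar, rCoeffZ, rCoeffW, qi, par, sgn, one_add_one_zmod] at h
  linear_combination (norm := module) h

theorem relation_d_c (q : ℂ) :
    (varZ * cst q⁻¹ - varW * cst q) • (inVar₁ (SY q 1 1) * inVar₂ (SY q 1 0)) =
      (varZ - varW) • (inVar₂ (SY q 1 0) * inVar₁ (SY q 1 1)) -
        (varW * (cst q - cst q⁻¹)) • (inVar₂ (SY q 1 1) * inVar₁ (SY q 1 0)) := by
  have h := rtt_SY q 1 1 1 0
  simp [Fin.sum_univ_two, rScalar, rCoeffZ, rCoeffW, qi, par, sgn, one_add_one_zmod] at h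
  linear_combination (norm := module) h

theorem relation_b_b (q : ℂ) :
    -((varZ * cst q - varW * cst q⁻¹) • (inVar₁ (SY q 0 1) * inVar₂ (SY q 0 1))) =
      (varZ * cst q⁻¹ - varW * cst q) • (inVar₂ (SY q 0 1) * inVar₁ (SY q 0 1)) := by
  have h := rtt_SY q 0 1 0 1
  simp [Fin.sum_univ_two, rScalar, rCoeffZ, rCoeffW, qi, par, sgn, one_add_one_zmod] at h
  linear_combination (norm := module) h

theorem relation_c_c (q : ℂ) :
    -((varZ * cst q⁻¹ - varW * cst q) • (inVar₁ (SY q 1 0) * inVar₂ (SY q 1 0))) =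
      (varZ * cst q - varW * cst q⁻¹) • (inVar₂ (SY q 1 0) * inVar₁ (SY q 1 0)) := by
  have h := rtt_SY q 1 0 1 0
  simp [Fin.sum_univ_two, rScalar, rCoeffZ, rCoeffW, qi, par, sgn, one_add_one_zmod] at h
  linear_combination (norm := module) h

/-- Both sides of this entry carry the same factor zq⁻¹ - wq, which is not a zero divisor. -/
theorem relation_d_d (hq₀ : q ≠ 0) :
    inVar₁ (SY q 1 1) * inVar₂ (SY q 1 1) = inVar₂ (SY q 1 1) * inVar₁ (SY q 1 1) := by
  have h := rtt_SY q 1 1 1 1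
  have r₀ : rScalar q 1 1 1 1 = varZ * cst q⁻¹ - varW * cst q := by
    simp [rScalar, rCoeffZ, rCoeffW, qi, sub_eq_add_neg]
  have r₁ : rScalar q 1 0 1 0 = 0 := by simp [rScalar, rCoeffZ, rCoeffW]
  have r₂ : rScalar q 1 0 1 1 = 0 := by simp [rScalar, rCoeffZ, rCoeffW]
  have r₃ : rScalar q 1 1 1 0 = 0 := by simp [rScalar, rCoeffZ, rCoeffW]
  have r₄ : rScalar q 0 1 0 1 = 0 := by simp [rScalar, rCoeffZ, rCoeffW]
  have r₅ : rScalar q 0 1 1 1 = 0 := by simp [rScalar, rCoeffZ, rCoeffW]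
  have r₆ : rScalar q 1 1 0 1 = 0 := by simp [rScalar, rCoeffZ, rCoeffW]
  simp only [Fin.sum_univ_two, r₀, r₁, r₂, r₃, r₄, r₅, r₆, zero_smul, smul_zero, zero_add,
    diag_even, mul_zero, sgn_zero, one_smul, mul_one] at h
  exact sub_eq_zero.1 (linear_nonZeroDivisor (inv_ne_zero hq₀) q _
    ((smul_sub _ _ _).trans (sub_eq_zero.2 h)))

theorem relation_b_c (q : ℂ) :
    (varZ - varW) • (inVar₁ (SY q 0 1) * inVar₂ (SY q 1 0) +
      inVar₂ (SY q 1 0) * inVar₁ (SY q 0 1)) =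
    (varW * (cst q - cst q⁻¹)) • (inVar₂ (SY q 1 1) * inVar₁ (SY q 0 0) -
      inVar₁ (SY q 1 1) * inVar₂ (SY q 0 0)) := by
  have h := rtt_SY q 0 1 1 0
  simp [Fin.sum_univ_two, rScalar, rCoeffZ, rCoeffW, qi, par, sgn, one_add_one_zmod] at h
  linear_combination (norm := module) -h

theorem relation_a_d (q : ℂ) :
    (varZ - varW) • (inVar₁ (SY q 0 0) * inVar₂ (SY q 1 1)) -
      (varW * (cst q - cst q⁻¹)) • (inVar₁ (SY q 1 0) * inVar₂ (SY q 0 1)) =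
    (varZ - varW) • (inVar₂ (SY q 1 1) * inVar₁ (SY q 0 0)) -
      (varZ * (cst q - cst q⁻¹)) • (inVar₂ (SY q 1 0) * inVar₁ (SY q 0 1)) := by
  have h := rtt_SY q 0 0 1 1
  simp [Fin.sum_univ_two, rScalar, rCoeffZ, rCoeffW, qi, par, sgn, one_add_one_zmod] at h
  linear_combination (norm := module) h

theorem relation_a_c (q : ℂ) :
    (varZ - varW) • (inVar₁ (SY q 0 0) * inVar₂ (SY q 1 0)) +
      (varW * (cst q - cst q⁻¹)) • (inVar₁ (SY q 1 0) * inVar₂ (SY q 0 0)) =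
    (varZ * cst q - varW * cst q⁻¹) • (inVar₂ (SY q 1 0) * inVar₁ (SY q 0 0)) := by
  have h := rtt_SY q 0 0 1 0
  simp [Fin.sum_univ_two, rScalar, rCoeffZ, rCoeffW, qi, par, sgn, one_add_one_zmod] at h
  linear_combination (norm := module) h

theorem sY_mul_sInvY (q : ℂ) (i : Fin 2) : sY q i i 0 * sInvY q i = 1 :=
  Subtype.ext ((uRelations_U q).s_mul_t i)

theorem sInvY_mul_sY (q : ℂ) (i : Fin 2) : sInvY q i * sY q i i 0 = 1 :=
  Subtype.ext ((uRelations_U q).t_mul_s i)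

theorem sY_one_zero_zero (q : ℂ) : sY q 1 0 0 = 0 := Subtype.ext (uRelations_U q).s_zero

/-- The invertible element `s_22^(0)`. -/
def dUnit (q : ℂ) : (Y q)ˣ := ⟨sY q 1 1 0, sInvY q 1, sY_mul_sInvY q 1, sInvY_mul_sY q 1⟩

/-- The series `s_22(z)⁻¹`. -/
def DInv (q : ℂ) : (Y q)⟦X⟧ := PowerSeries.invOfUnit (SY q 1 1) (dUnit q)

theorem SY_mul_DInv (q : ℂ) : SY q 1 1 * DInv q = 1 :=
  PowerSeries.mul_invOfUnit _ _ (by simp [SY, dUnit])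

theorem DInv_mul_SY (q : ℂ) : DInv q * SY q 1 1 = 1 :=
  PowerSeries.invOfUnit_mul _ _ (by simp [SY, dUnit])

theorem coeff_zero_DInv (q : ℂ) : PowerSeries.coeff 0 (DInv q) = sInvY q 1 := by
  simp [DInv, dUnit]

/-- The series `E(z) = s_22(z)⁻¹ s_12(z)`. -/
def ES (q : ℂ) : (Y q)⟦X⟧ := DInv q * SY q 0 1

/-- The series `F(z) = s_22(z)⁻¹ s_21(z)`. -/
def FS (q : ℂ) : (Y q)⟦X⟧ := DInv q * SY q 1 0

/-- The series `H(z) = s_22(z)⁻¹ s_11(z) - F(z) E(z)`. -/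
def HS (q : ℂ) : (Y q)⟦X⟧ := DInv q * SY q 0 0 - FS q * ES q

/-- The series `H'(z) = s_22(z)⁻¹ s_11(z) + E(z) F(z)`. -/
def HS' (q : ℂ) : (Y q)⟦X⟧ := DInv q * SY q 0 0 + ES q * FS q

theorem SY_mul_ES (q : ℂ) : SY q 1 1 * ES q = SY q 0 1 := by
  rw [ES, ← mul_assoc, SY_mul_DInv, one_mul]

theorem SY_mul_FS (q : ℂ) : SY q 1 1 * FS q = SY q 1 0 := by
  rw [FS, ← mul_assoc, SY_mul_DInv, one_mul]

theorem cst_mul_inv (hq₀ : q ≠ 0) : cst q * cst q⁻¹ = 1 := by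
  rw [← map_mul, mul_inv_cancel₀ hq₀, map_one]

theorem inVar_D_DInv (φ : (Y q)⟦X⟧ →+* (Y q)⟦X⟧⟦X⟧) : φ (SY q 1 1) * φ (DInv q) = 1 := by
  rw [← map_mul, SY_mul_DInv, map_one]

theorem inVar_DInv_D (φ : (Y q)⟦X⟧ →+* (Y q)⟦X⟧⟦X⟧) : φ (DInv q) * φ (SY q 1 1) = 1 := by
  rw [← map_mul, DInv_mul_SY, map_one]

/-- D(w) moves to the left past E(z) at the cost of a term in E(w). The primed versions exchange the
two parameters, which needs the swapped relations `swap_b_d` and `swap_c_d`. -/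
theorem ES_mul_D (hq₀ : q ≠ 0) : (varZ - varW) • (inVar₁ (ES q) * inVar₂ (SY q 1 1)) =
    inVar₂ (SY q 1 1) * ((varW * (cst q - cst q⁻¹)) • inVar₂ (ES q) +
      (varZ * cst q⁻¹ - varW * cst q) • inVar₁ (ES q)) := by
  have := e_mul_d (R := Scalar) (S := (Y q)⟦X⟧⟦X⟧)
    (q := cst q) (p := cst q⁻¹) (z := varZ) (w := varW) (d₁ := inVar₁ (SY q 1 1)) (i₁ := inVar₁ (DInv q)) (b₁ := inVar₁ (SY q 0 1)) (d₂ := inVar₂ (SY q 1 1)) (i₂ := inVar₂ (DInv q)) (b₂ := inVar₂ (SY q 0 1))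
    (inVar_D_DInv inVar₁) (inVar_DInv_D inVar₁) (inVar_D_DInv inVar₂)
    (relation_d_d hq₀) (relation_b_d q)
  simpa only [ES, map_mul] using this

theorem ES_mul_D' (hq₀ : q ≠ 0) : (varW - varZ) • (inVar₂ (ES q) * inVar₁ (SY q 1 1)) =
    inVar₁ (SY q 1 1) * ((varZ * (cst q - cst q⁻¹)) • inVar₁ (ES q) +
      (varW * cst q⁻¹ - varZ * cst q) • inVar₂ (ES q)) := by
  have := e_mul_d (R := Scalar) (S := (Y q)⟦X⟧⟦X⟧)
    (q := cst q) (p := cst q⁻¹) (z := varW) (w := varZ) (d₁ := inVar₂ (SY q 1 1)) (i₁ := inVar₂ (DInv q)) (b₁ := inVar₂ (SY q 0 1)) (d₂ := inVar₁ (SY q 1 1)) (i₂ := inVar₁ (DInv q)) (b₂ := inVar₁ (SY q 0 1))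
    (inVar_D_DInv inVar₂) (inVar_DInv_D inVar₂) (inVar_D_DInv inVar₁)
    (relation_d_d hq₀).symm (swap_b_d (cst_mul_inv hq₀)
      (linear_nonZeroDivisor (inv_ne_zero hq₀) q) (relation_b_d q) (relation_d_b q))
  simpa only [ES, map_mul] using this

theorem FS_mul_D (hq₀ : q ≠ 0) : (varZ - varW) • (inVar₂ (FS q) * inVar₁ (SY q 1 1)) =
    inVar₁ (SY q 1 1) * ((varW * (cst q - cst q⁻¹)) • inVar₁ (FS q) +
      (varZ * cst q⁻¹ - varW * cst q) • inVar₂ (FS q)) := by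
  have := f_mul_d (R := Scalar) (S := (Y q)⟦X⟧⟦X⟧)
    (q := cst q) (p := cst q⁻¹) (z := varZ) (w := varW) (d₁ := inVar₁ (SY q 1 1)) (i₁ := inVar₁ (DInv q)) (c₁ := inVar₁ (SY q 1 0)) (d₂ := inVar₂ (SY q 1 1)) (i₂ := inVar₂ (DInv q)) (c₂ := inVar₂ (SY q 1 0))
    (inVar_D_DInv inVar₁) (inVar_D_DInv inVar₂) (inVar_DInv_D inVar₂)
    (relation_d_d hq₀) (relation_d_c q)
  simpa only [FS, map_mul] using this

theorem FS_mul_D' (hq₀ : q ≠ 0) : (varW - varZ) • (inVar₁ (FS q) * inVar₂ (SY q 1 1)) =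
    inVar₂ (SY q 1 1) * ((varZ * (cst q - cst q⁻¹)) • inVar₂ (FS q) +
      (varW * cst q⁻¹ - varZ * cst q) • inVar₁ (FS q)) := by
  have := f_mul_d (R := Scalar) (S := (Y q)⟦X⟧⟦X⟧)
    (q := cst q) (p := cst q⁻¹) (z := varW) (w := varZ) (d₁ := inVar₂ (SY q 1 1)) (i₁ := inVar₂ (DInv q)) (c₁ := inVar₂ (SY q 1 0)) (d₂ := inVar₁ (SY q 1 1)) (i₂ := inVar₁ (DInv q)) (c₂ := inVar₁ (SY q 1 0))
    (inVar_D_DInv inVar₂) (inVar_D_DInv inVar₁) (inVar_DInv_D inVar₁)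
    (relation_d_d hq₀).symm (swap_c_d (cst_mul_inv hq₀)
      (linear_nonZeroDivisor (inv_ne_zero hq₀) q) (relation_c_d q) (relation_d_c q))
  simpa only [FS, map_mul] using this

theorem SY_mul_ES' (φ : (Y q)⟦X⟧ →+* (Y q)⟦X⟧⟦X⟧) : φ (SY q 0 1) = φ (SY q 1 1) * φ (ES q) := by
  rw [← map_mul, SY_mul_ES]

theorem SY_mul_FS' (φ : (Y q)⟦X⟧ →+* (Y q)⟦X⟧⟦X⟧) : φ (SY q 1 0) = φ (SY q 1 1) * φ (FS q) := by
  rw [← map_mul, SY_mul_FS]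

theorem ES_anticomm_aux (hq₀ : q ≠ 0) :
    ((varZ * cst q - varW * cst q⁻¹) * (varZ * cst q⁻¹ - varW * cst q)) •
      (inVar₁ (ES q) * inVar₂ (ES q) + inVar₂ (ES q) * inVar₁ (ES q)) =
    (cst q - cst q⁻¹) • (((varZ * cst q⁻¹ - varW * cst q) * varZ) • (inVar₁ (ES q) * inVar₁ (ES q)) -
      ((varZ * cst q - varW * cst q⁻¹) * varW) • (inVar₂ (ES q) * inVar₂ (ES q))) :=
  e_mul_e (inVar_DInv_D inVar₁) (inVar_DInv_D inVar₂) (relation_d_d hq₀) (SY_mul_ES' _)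
    (SY_mul_ES' _) (ES_mul_D hq₀) (ES_mul_D' hq₀) (relation_b_b q)

theorem FS_anticomm_aux (hq₀ : q ≠ 0) :
    ((varZ * cst q - varW * cst q⁻¹) * (varZ * cst q⁻¹ - varW * cst q)) •
      (inVar₁ (FS q) * inVar₂ (FS q) + inVar₂ (FS q) * inVar₁ (FS q)) =
    (cst q - cst q⁻¹) • (((varZ * cst q⁻¹ - varW * cst q) * varZ) • (inVar₂ (FS q) * inVar₂ (FS q)) -
      ((varZ * cst q - varW * cst q⁻¹) * varW) • (inVar₁ (FS q) * inVar₁ (FS q))) :=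
  f_mul_f (inVar_DInv_D inVar₁) (inVar_DInv_D inVar₂) (relation_d_d hq₀) (SY_mul_FS' _)
    (SY_mul_FS' _) (FS_mul_D hq₀) (FS_mul_D' hq₀) (relation_c_c q)

theorem ES_mul_FS (hq₀ : q ≠ 0) : (varZ * cst q⁻¹ - varW * cst q) •
    (inVar₁ (ES q) * inVar₂ (FS q) + inVar₂ (FS q) * inVar₁ (ES q)) =
      (varW * (cst q - cst q⁻¹)) • (inVar₁ (HS q) - inVar₂ (HS' q)) := by
  have := e_mul_f (R := Scalar) (S := (Y q)⟦X⟧⟦X⟧)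
    (q := cst q) (p := cst q⁻¹) (z := varZ) (w := varW) (d₁ := inVar₁ (SY q 1 1)) (i₁ := inVar₁ (DInv q)) (a₁ := inVar₁ (SY q 0 0)) (e₁ := inVar₁ (ES q)) (f₁ := inVar₁ (FS q)) (d₂ := inVar₂ (SY q 1 1)) (i₂ := inVar₂ (DInv q)) (a₂ := inVar₂ (SY q 0 0)) (e₂ := inVar₂ (ES q)) (f₂ := inVar₂ (FS q)) (b₁ := inVar₁ (SY q 0 1)) (c₂ := inVar₂ (SY q 1 0))
    (inVar_DInv_D inVar₁) (inVar_DInv_D inVar₂) (inVar_D_DInv inVar₁)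
    (inVar_D_DInv inVar₂) (relation_d_d hq₀) (SY_mul_ES' _) (SY_mul_FS' _) (ES_mul_D hq₀)
    (FS_mul_D hq₀) (relation_b_c q)
  have e₁ : inVar₁ (HS q) = inVar₁ (DInv q) * inVar₁ (SY q 0 0) - inVar₁ (FS q) * inVar₁ (ES q) := by
    rw [HS, map_sub, map_mul, map_mul]
  have e₂ : inVar₂ (HS' q) = inVar₂ (DInv q) * inVar₂ (SY q 0 0) + inVar₂ (ES q) * inVar₂ (FS q) := by
    rw [HS', map_add, map_mul, map_mul]
  rw [e₁, e₂]
  exact this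

theorem sub_inv_ne_zero (hq₀ : q ≠ 0) (hq : ∀ n : ℕ, 0 < n → q ^ n ≠ 1) : q - q⁻¹ ≠ 0 := by
  intro h
  apply hq 2 two_pos
  field_simp at h
  linear_combination h

/-- In `ES_anticomm_aux` every term but (zq⁻¹ - wq) z E(z)² is divisible by zq - wq⁻¹; restricting
to w = q²z isolates E(z)². -/
theorem ES_sq (hq₀ : q ≠ 0) (hq : ∀ n : ℕ, 0 < n → q ^ n ≠ 1) : ES q * ES q = 0 := by
  have h := ES_anticomm_aux hq₀
  have key := evalCoeff_eq_zero (q := q) (A := Y q) hq₀ (hq 4 (by norm_num))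
    (x := (varZ * cst q⁻¹ - varW * cst q) •
      (inVar₁ (ES q) * inVar₂ (ES q) + inVar₂ (ES q) * inVar₁ (ES q)) +
        ((cst q - cst q⁻¹) * varW) • (inVar₂ (ES q) * inVar₂ (ES q)))
    (y := cst (q - q⁻¹) • inVar₁ (ES q * ES q)) (by
      rw [map_sub, map_mul]
      linear_combination (norm := module) h)
  ext N
  have := key N
  rw [evalCoeff_cst_smul, evalCoeff_inVar₁, smul_eq_zero_iff_right (sub_inv_ne_zero hq₀ hq)] at this
  rw [this, map_zero]

/-- As for E, except that the surviving square is F(w)², so the restriction to w = q²z contributes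
an extra factor q^(2N) in degree N. -/
theorem FS_sq (hq₀ : q ≠ 0) (hq : ∀ n : ℕ, 0 < n → q ^ n ≠ 1) : FS q * FS q = 0 := by
  have h := FS_anticomm_aux hq₀
  have key := evalCoeff_eq_zero (q := q) (A := Y q) hq₀ (hq 4 (by norm_num))
    (x := (varZ * cst q⁻¹ - varW * cst q) •
      (inVar₁ (FS q) * inVar₂ (FS q) + inVar₂ (FS q) * inVar₁ (FS q)) +
        ((cst q - cst q⁻¹) * varW) • (inVar₁ (FS q) * inVar₁ (FS q)))
    (y := cst (q - q⁻¹) • inVar₂ (FS q * FS q)) (by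
      rw [map_sub, map_mul]
      linear_combination (norm := module) h)
  ext N
  have := key N
  rw [evalCoeff_cst_smul, evalCoeff_inVar₂, smul_eq_zero_iff_right (sub_inv_ne_zero hq₀ hq),
    smul_eq_zero_iff_right (pow_ne_zero _ (pow_ne_zero _ hq₀))] at this
  rw [this, map_zero]

/-- Once the squares vanish, the two linear factors on the left are regular and cancel. -/
theorem FS_anticomm (hq₀ : q ≠ 0) (hq : ∀ n : ℕ, 0 < n → q ^ n ≠ 1) :
    inVar₁ (FS q) * inVar₂ (FS q) + inVar₂ (FS q) * inVar₁ (FS q) = 0 := by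
  have h := FS_anticomm_aux hq₀
  rw [← map_mul, ← map_mul, FS_sq hq₀ hq, map_zero, map_zero, smul_zero, smul_zero, sub_zero,
    smul_zero, mul_smul] at h
  exact linear_nonZeroDivisor (inv_ne_zero hq₀) _ _ (linear_nonZeroDivisor hq₀ _ _ h)

end Gauss

/-! ## Relations between the modes -/

section Modes

section CoeffTwo

variable {A : Type*} [Ring A]

theorem coeff₂_inVar₁_mul_inVar₂ (a b : A⟦X⟧) (m n : ℕ) :
    coeff₂ m n (inVar₁ a * inVar₂ b) = PowerSeries.coeff m a * PowerSeries.coeff n b := by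
  simp [coeff₂, inVar₁, inVar₂, PowerSeries.coeff_C_mul, PowerSeries.coeff_mul_C]

theorem coeff₂_inVar₂_mul_inVar₁ (a b : A⟦X⟧) (m n : ℕ) :
    coeff₂ m n (inVar₂ b * inVar₁ a) = PowerSeries.coeff n b * PowerSeries.coeff m a := by
  simp [coeff₂, inVar₁, inVar₂, PowerSeries.coeff_C_mul, PowerSeries.coeff_mul_C]

theorem coeff₂_inVar₁ (a : A⟦X⟧) (m n : ℕ) :
    coeff₂ m n (inVar₁ a) = if n = 0 then PowerSeries.coeff m a else 0 := by
  rw [coeff₂, inVar₁, PowerSeries.coeff_C]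
  split_ifs <;> simp

theorem coeff₂_inVar₂ (a : A⟦X⟧) (m n : ℕ) :
    coeff₂ m n (inVar₂ a) = if m = 0 then PowerSeries.coeff n a else 0 := by
  rw [coeff₂, inVar₂, PowerSeries.coeff_map, PowerSeries.coeff_C]

end CoeffTwo

variable {q : ℂ}

/-- The mode `d_n = s_22^(n)`. -/
def dY (q : ℂ) (n : ℕ) : Y q := sY q 1 1 n

/-- The modes of `E(z)`. -/
def eY (q : ℂ) (n : ℕ) : Y q := PowerSeries.coeff n (ES q)

/-- The modes of `F(z)`. -/
def fY (q : ℂ) (n : ℕ) : Y q := PowerSeries.coeff n (FS q)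

/-- The modes of `H(z)`. -/
def hY (q : ℂ) (n : ℕ) : Y q := PowerSeries.coeff n (HS q)

/-- The modes of `G(z) = z⁻¹ F(q⁻² z)`. -/
def gY (q : ℂ) (n : ℕ) : Y q := (q⁻¹) ^ (2 * (n + 1)) • fY q (n + 1)

theorem coeff_SY (i j : Fin 2) (n : ℕ) : PowerSeries.coeff n (SY q i j) = sY q i j n :=
  PowerSeries.coeff_mk _ _

theorem coeff_zero_mul {A : Type*} [Ring A] (a b : A⟦X⟧) :
    PowerSeries.coeff 0 (a * b) = PowerSeries.coeff 0 a * PowerSeries.coeff 0 b := by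
  simp

theorem fY_zero (q : ℂ) : fY q 0 = 0 := by
  rw [fY, FS, coeff_zero_mul, coeff_SY, sY_one_zero_zero, mul_zero]

theorem fY_succ (hq₀ : q ≠ 0) (n : ℕ) : fY q (n + 1) = q ^ (2 * (n + 1)) • gY q n := by
  rw [gY, smul_smul, ← mul_pow, mul_inv_cancel₀ hq₀, one_pow, one_smul]

theorem fY_mul_fY (hq₀ : q ≠ 0) (hq : ∀ n : ℕ, 0 < n → q ^ n ≠ 1) (m n : ℕ) :
    fY q m * fY q n + fY q n * fY q m = 0 := by
  have h := congrArg (coeff₂ m n) (FS_anticomm hq₀ hq)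
  rw [coeff₂_add, coeff₂_inVar₁_mul_inVar₂, coeff₂_inVar₂_mul_inVar₁] at h
  rw [fY, fY, h]
  simp [coeff₂]

theorem gY_mul_gY (hq₀ : q ≠ 0) (hq : ∀ n : ℕ, 0 < n → q ^ n ≠ 1) (m n : ℕ) :
    gY q m * gY q n + gY q n * gY q m = 0 := by
  rw [gY, gY, smul_mul_smul_comm, smul_mul_smul_comm, mul_comm (q⁻¹ ^ (2 * (n + 1))), ← smul_add,
    fY_mul_fY hq₀ hq, smul_zero]

theorem coeff₂_linear_succ_succ {A : Type*} [Ring A] [Algebra ℂ A] (r s : ℂ) (m n : ℕ)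
    (x : A⟦X⟧⟦X⟧) : coeff₂ (m + 1) (n + 1) ((varZ * cst r - varW * cst s) • x) =
      r • coeff₂ m (n + 1) x - s • coeff₂ (m + 1) n x := by
  rw [sub_smul, mul_smul, mul_smul, coeff₂_sub, coeff₂_var₁_succ, coeff₂_var₂_succ,
    coeff₂_cst_smul, coeff₂_cst_smul]

theorem coeff₂_linear_zero_succ {A : Type*} [Ring A] [Algebra ℂ A] (r s : ℂ) (n : ℕ)
    (x : A⟦X⟧⟦X⟧) : coeff₂ 0 (n + 1) ((varZ * cst r - varW * cst s) • x) =
      -(s • coeff₂ 0 n x) := by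
  rw [sub_smul, mul_smul, mul_smul, coeff₂_sub, coeff₂_var₁_zero, coeff₂_var₂_succ,
    coeff₂_cst_smul, zero_sub]

theorem coeff₂_linear_succ_zero {A : Type*} [Ring A] [Algebra ℂ A] (r s : ℂ) (m : ℕ)
    (x : A⟦X⟧⟦X⟧) : coeff₂ (m + 1) 0 ((varZ * cst r - varW * cst s) • x) =
      r • coeff₂ m 0 x := by
  rw [sub_smul, mul_smul, mul_smul, coeff₂_sub, coeff₂_var₁_succ, coeff₂_var₂_zero,
    coeff₂_cst_smul, sub_zero]

theorem coeff₂_varW_cst_succ {A : Type*} [Ring A] [Algebra ℂ A] (r : ℂ) (m n : ℕ)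
    (x : A⟦X⟧⟦X⟧) : coeff₂ m (n + 1) ((varW * cst r) • x) = r • coeff₂ m n x := by
  rw [mul_smul, coeff₂_var₂_succ, coeff₂_cst_smul]

theorem coeff₂_varW_cst_zero {A : Type*} [Ring A] [Algebra ℂ A] (r : ℂ) (m : ℕ)
    (x : A⟦X⟧⟦X⟧) : coeff₂ m 0 ((varW * cst r) • x) = 0 := by
  rw [mul_smul, coeff₂_var₂_zero]

theorem varZ_sub_varW : varZ - varW = varZ * cst 1 - varW * cst 1 := by
  rw [map_one, mul_one, mul_one]

theorem coeff₂_anticomm (m n : ℕ) :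
    coeff₂ m n (inVar₁ (ES q) * inVar₂ (FS q) + inVar₂ (FS q) * inVar₁ (ES q)) =
      eY q m * fY q n + fY q n * eY q m := by
  rw [coeff₂_add, coeff₂_inVar₁_mul_inVar₂, coeff₂_inVar₂_mul_inVar₁, eY, fY]

/-- The coefficient of z^(m+1) w^(n+1) in `ES_mul_FS` moves an index from f to e with a factor q².
For n = 0 it produces h_(m+1), because f_0 = 0. The series H'(w) never contributes, since the power
of z is positive. -/
theorem eY_mul_fY_succ (hq₀ : q ≠ 0) (m n : ℕ) : eY q m * fY q (n + 1) + fY q (n + 1) * eY q m =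
    (q ^ (2 * n + 1) * (q - q⁻¹)) • hY q (m + n + 1) := by
  induction n generalizing m with
  | zero =>
    have h := congrArg (coeff₂ (m + 1) (0 + 1)) (ES_mul_FS hq₀)
    rw [← map_sub, coeff₂_linear_succ_succ, coeff₂_varW_cst_succ, coeff₂_anticomm, coeff₂_anticomm,
      coeff₂_sub, coeff₂_inVar₁, coeff₂_inVar₂, fY_zero, zero_mul, mul_zero, add_zero, smul_zero,
      sub_zero, if_pos rfl, if_neg m.succ_ne_zero, sub_zero] at h
    have h' := congrArg (q • ·) h
    simp only [smul_smul, mul_inv_cancel₀ hq₀, one_smul] at h'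
    rw [h', hY]
    simp
  | succ n ih =>
    have h := congrArg (coeff₂ (m + 1) (n + 1 + 1)) (ES_mul_FS hq₀)
    rw [← map_sub, coeff₂_linear_succ_succ, coeff₂_varW_cst_succ, coeff₂_anticomm, coeff₂_anticomm,
      coeff₂_sub, coeff₂_inVar₁, coeff₂_inVar₂, if_neg n.succ_ne_zero, if_neg m.succ_ne_zero,
      sub_zero, smul_zero, sub_eq_zero, ih] at h
    have h' := congrArg (q • ·) h
    simp only [smul_smul, mul_inv_cancel₀ hq₀, one_smul] at h'
    rw [h', show m + 1 + n + 1 = m + (n + 1) + 1 by ring]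
    congr 1
    ring

/-- The structure constant in the relation between `E` and `G`. -/
def kap (q : ℂ) : ℂ := q⁻¹ * (q - q⁻¹)

theorem kap_ne_zero (hq₀ : q ≠ 0) (hq : ∀ n : ℕ, 0 < n → q ^ n ≠ 1) : kap q ≠ 0 :=
  mul_ne_zero (inv_ne_zero hq₀) (sub_inv_ne_zero hq₀ hq)

/-- The shift and rescaling in `gY` absorb the powers of q, so that the anticommutator depends on m
+ n only. This is the source of the Hankel matrices below. -/
theorem eY_mul_gY (hq₀ : q ≠ 0) (m n : ℕ) :
    eY q m * gY q n + gY q n * eY q m = kap q • hY q (m + n + 1) := by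
  rw [gY, mul_smul_comm, smul_mul_assoc, ← smul_add, eY_mul_fY_succ hq₀, smul_smul, kap]
  congr 1
  rw [← mul_assoc]
  congr 1
  rw [inv_pow]
  field_simp
  ring

/-- The part of `ES_mul_FS` of degree 0 in z says H'(z) = H(q²z). With the rescaling of `gY`, the
series H' in Δ(F) therefore turns into H. -/
theorem coeff_HS' (hq₀ : q ≠ 0) (hq : ∀ n : ℕ, 0 < n → q ^ n ≠ 1) (n : ℕ) :
    PowerSeries.coeff n (HS' q) = q ^ (2 * n) • hY q n := by
  have h := congrArg (coeff₂ 0 (n + 1)) (ES_mul_FS hq₀)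
  rw [← map_sub, coeff₂_linear_zero_succ, coeff₂_varW_cst_succ, coeff₂_anticomm,
    coeff₂_sub, coeff₂_inVar₁, coeff₂_inVar₂, if_pos rfl] at h
  refine smul_right_injective _ (sub_inv_ne_zero hq₀ hq) ?_
  simp only
  cases n with
  | zero =>
    rw [fY_zero, zero_mul, mul_zero, add_zero, smul_zero, neg_zero, if_pos rfl, smul_sub, eq_comm,
      sub_eq_zero] at h
    rw [← h, hY]
    simp
  | succ n =>
    rw [if_neg n.succ_ne_zero, zero_sub, smul_neg, neg_inj, eY_mul_fY_succ hq₀, zero_add] at h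
    rw [← h, smul_smul, smul_smul]
    congr 1
    ring

theorem eY_mul_dY_zero (hq₀ : q ≠ 0) (m : ℕ) : eY q m * dY q 0 = q⁻¹ • (dY q 0 * eY q m) := by
  have h := congrArg (coeff₂ (m + 1) 0) (ES_mul_D hq₀)
  rw [← map_sub, mul_add, mul_smul_comm, mul_smul_comm, coeff₂_add, coeff₂_varW_cst_zero,
    varZ_sub_varW, coeff₂_linear_succ_zero, coeff₂_linear_succ_zero, coeff₂_inVar₁_mul_inVar₂,
    coeff₂_inVar₂_mul_inVar₁, coeff_SY, one_smul, zero_add] at h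
  exact h

theorem eY_mul_dY_succ (hq₀ : q ≠ 0) (m n : ℕ) : eY q m * dY q (n + 1) =
    eY q (m + 1) * dY q n + q⁻¹ • (dY q (n + 1) * eY q m) - q • (dY q n * eY q (m + 1)) := by
  have h := congrArg (coeff₂ (m + 1) (n + 1)) (ES_mul_D hq₀)
  rw [← map_sub, mul_add, mul_smul_comm, mul_smul_comm, ← map_mul, coeff₂_add,
    coeff₂_varW_cst_succ, coeff₂_inVar₂, if_neg m.succ_ne_zero, smul_zero, zero_add,
    varZ_sub_varW, coeff₂_linear_succ_succ, coeff₂_linear_succ_succ, coeff₂_inVar₁_mul_inVar₂,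
    coeff₂_inVar₁_mul_inVar₂, coeff₂_inVar₂_mul_inVar₁, coeff₂_inVar₂_mul_inVar₁, coeff_SY,
    coeff_SY, one_smul, one_smul, sub_eq_iff_eq_add] at h
  rw [eY, dY, h, eY, dY]
  abel

theorem dY_zero_mul_gY (hq₀ : q ≠ 0) (n : ℕ) : dY q 0 * gY q n = q⁻¹ • (gY q n * dY q 0) := by
  have h := congrArg (coeff₂ 0 (n + 1 + 1)) (FS_mul_D hq₀)
  rw [← map_sub, mul_add, mul_smul_comm, mul_smul_comm, ← map_mul, coeff₂_add,
    coeff₂_varW_cst_succ, coeff₂_inVar₁, if_neg n.succ_ne_zero, smul_zero, zero_add,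
    varZ_sub_varW, coeff₂_linear_zero_succ, coeff₂_linear_zero_succ, coeff₂_inVar₂_mul_inVar₁,
    coeff₂_inVar₁_mul_inVar₂, coeff_SY, one_smul, neg_inj] at h
  rw [gY, mul_smul_comm, smul_mul_assoc, smul_comm q⁻¹, fY, dY, h, smul_smul q⁻¹,
    inv_mul_cancel₀ hq₀, one_smul]

theorem dY_succ_mul_gY (hq₀ : q ≠ 0) (m n : ℕ) : dY q (m + 1) * gY q n =
    dY q m * gY q (n + 1) - q • (gY q (n + 1) * dY q m) + q⁻¹ • (gY q n * dY q (m + 1)) := by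
  have h := congrArg (coeff₂ (m + 1) (n + 1 + 1)) (FS_mul_D hq₀)
  rw [← map_sub, mul_add, mul_smul_comm, mul_smul_comm, ← map_mul, coeff₂_add,
    coeff₂_varW_cst_succ, coeff₂_inVar₁, if_neg n.succ_ne_zero, smul_zero, zero_add,
    varZ_sub_varW, coeff₂_linear_succ_succ, coeff₂_linear_succ_succ, coeff₂_inVar₂_mul_inVar₁,
    coeff₂_inVar₂_mul_inVar₁, coeff₂_inVar₁_mul_inVar₂, coeff₂_inVar₁_mul_inVar₂, coeff_SY,
    coeff_SY, one_smul, one_smul] at h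
  change fY q (n + 1 + 1) * dY q m - fY q (n + 1) * dY q (m + 1) =
    q⁻¹ • (dY q m * fY q (n + 1 + 1)) - q • (dY q (m + 1) * fY q (n + 1)) at h
  simp only [fY_succ hq₀, mul_smul_comm, smul_mul_assoc] at h
  have h' := congrArg ((q⁻¹) ^ (2 * n + 3) • ·) h
  simp only [smul_sub, smul_smul] at h'
  rw [show q⁻¹ ^ (2 * n + 3) * q ^ (2 * (n + 1 + 1)) = q by rw [inv_pow]; field_simp; ring,
    show q⁻¹ ^ (2 * n + 3) * q ^ (2 * (n + 1)) = q⁻¹ by rw [inv_pow]; field_simp; ring,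
    show q⁻¹ ^ (2 * n + 3) * (q⁻¹ * q ^ (2 * (n + 1 + 1))) = 1 by rw [inv_pow]; field_simp; ring,
    show q⁻¹ ^ (2 * n + 3) * (q * q ^ (2 * (n + 1))) = 1 by rw [inv_pow]; field_simp; ring,
    one_smul, one_smul] at h'
  linear_combination (norm := module) h'

theorem dY_comm (hq₀ : q ≠ 0) (m n : ℕ) : dY q m * dY q n = dY q n * dY q m := by
  have h := congrArg (coeff₂ m n) (relation_d_d hq₀)
  rwa [coeff₂_inVar₁_mul_inVar₂, coeff₂_inVar₂_mul_inVar₁, coeff_SY, coeff_SY] at h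

theorem sY_zero_mul_c (q : ℂ) (n : ℕ) :
    sY q 0 0 0 * sY q 1 0 n = q⁻¹ • (sY q 1 0 n * sY q 0 0 0) := by
  have h := congrArg (coeff₂ 0 (n + 1)) (relation_a_c q)
  rw [← map_sub, coeff₂_add, coeff₂_varW_cst_succ, varZ_sub_varW, coeff₂_linear_zero_succ,
    coeff₂_linear_zero_succ, coeff₂_inVar₁_mul_inVar₂, coeff₂_inVar₁_mul_inVar₂,
    coeff₂_inVar₂_mul_inVar₁, coeff_SY, coeff_SY, coeff_SY, coeff_SY, sY_one_zero_zero, zero_mul,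
    smul_zero, add_zero, one_smul, neg_inj] at h
  exact h

theorem sY_zero_mul_d (q : ℂ) (n : ℕ) : sY q 0 0 0 * sY q 1 1 n = sY q 1 1 n * sY q 0 0 0 := by
  have h := congrArg (coeff₂ 0 (n + 1)) (relation_a_d q)
  rw [← map_sub, coeff₂_sub, coeff₂_sub, coeff₂_varW_cst_succ, mul_smul varZ, coeff₂_var₁_zero,
    varZ_sub_varW, coeff₂_linear_zero_succ, coeff₂_linear_zero_succ, coeff₂_inVar₁_mul_inVar₂,
    coeff₂_inVar₁_mul_inVar₂, coeff₂_inVar₂_mul_inVar₁, coeff_SY, coeff_SY, coeff_SY, coeff_SY,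
    sY_one_zero_zero, zero_mul, smul_zero, sub_zero, sub_zero, one_smul, one_smul, neg_inj] at h
  exact h

theorem sY_zero_mul_DInv (q : ℂ) :
    PowerSeries.C (sY q 0 0 0) * DInv q = DInv q * PowerSeries.C (sY q 0 0 0) := by
  have h : SY q 1 1 * PowerSeries.C (sY q 0 0 0) = PowerSeries.C (sY q 0 0 0) * SY q 1 1 := by
    ext n
    rw [PowerSeries.coeff_C_mul, PowerSeries.coeff_mul_C, coeff_SY, sY_zero_mul_d]
  exact (inv_comm_of_comm (SY_mul_DInv q) (DInv_mul_SY q) h).symm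

theorem hY_zero (q : ℂ) : hY q 0 = sInvY q 1 * sY q 0 0 0 := by
  rw [hY, HS, map_sub, coeff_zero_mul, coeff_zero_mul, coeff_zero_DInv,
    coeff_SY, ← fY, fY_zero, zero_mul, sub_zero]

theorem sY_zero_mul_f (q : ℂ) (n : ℕ) : sY q 0 0 0 * fY q n = q⁻¹ • (fY q n * sY q 0 0 0) := by
  have h : PowerSeries.C (sY q 0 0 0) * FS q = q⁻¹ • (FS q * PowerSeries.C (sY q 0 0 0)) := by
    have h' : PowerSeries.C (sY q 0 0 0) * SY q 1 0 =
        q⁻¹ • (SY q 1 0 * PowerSeries.C (sY q 0 0 0)) := by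
      ext n
      rw [PowerSeries.coeff_C_mul, PowerSeries.coeff_smul, PowerSeries.coeff_mul_C, coeff_SY,
        sY_zero_mul_c]
    rw [FS, ← mul_assoc, sY_zero_mul_DInv, mul_assoc, h', mul_smul_comm, mul_assoc]
  have h' := congrArg (PowerSeries.coeff n) h
  rwa [PowerSeries.coeff_C_mul, PowerSeries.coeff_smul, PowerSeries.coeff_mul_C] at h'

/-- Both s_11^(0) and s_22^(0) pick up a factor q⁻¹ when moved to the right past g_n, so their
quotient h_0 commutes with it. -/
theorem hY_zero_mul_gY (hq₀ : q ≠ 0) (n : ℕ) : hY q 0 * gY q n = gY q n * hY q 0 := by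
  have h₁ : sY q 0 0 0 * gY q n = q⁻¹ • (gY q n * sY q 0 0 0) := by
    rw [gY, mul_smul_comm, sY_zero_mul_f, smul_mul_assoc, smul_comm]
  have h₂ : gY q n * sInvY q 1 = q⁻¹ • (sInvY q 1 * gY q n) := by
    have h := congrArg (fun x => sInvY q 1 * x * sInvY q 1) (dY_zero_mul_gY hq₀ n)
    simp only [dY, mul_smul_comm, smul_mul_assoc] at h
    rwa [← mul_assoc, sInvY_mul_sY, one_mul, mul_assoc, mul_assoc, sY_mul_sInvY, mul_one] at h
  rw [hY_zero, mul_assoc, h₁, mul_smul_comm, ← mul_assoc, ← mul_assoc, h₂, smul_mul_assoc]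

/-- Since κ h_(m+n+1) is the anticommutator of e_m and g_n and the g's anticommute, the Jacobi
identity makes [h_(m+n+1), g_k] antisymmetric in n and k. The case n = k = 0 kills every [h_(m+1),
g_0], and then the case n = 0 gives all k. -/
theorem hY_mul_gY (hq₀ : q ≠ 0) (hq : ∀ n : ℕ, 0 < n → q ^ n ≠ 1) (m n : ℕ) :
    hY q m * gY q n = gY q n * hY q m := by
  cases m with
  | zero => exact hY_zero_mul_gY hq₀ n
  | succ m =>
    have key : ∀ m n k, hY q (m + n + 1) * gY q k - gY q k * hY q (m + n + 1) =
        -(hY q (m + k + 1) * gY q n - gY q n * hY q (m + k + 1)) := by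
      intro m n k
      refine smul_right_injective _ (kap_ne_zero hq₀ hq) ?_
      simp only
      rw [smul_neg, smul_sub, smul_sub, ← smul_mul_assoc, ← mul_smul_comm, ← smul_mul_assoc,
        ← mul_smul_comm, ← eY_mul_gY hq₀, ← eY_mul_gY hq₀]
      have h := gY_mul_gY hq₀ hq n k
      have h₁ := congrArg (eY q m * ·) h
      have h₂ := congrArg (· * eY q m) h
      simp only [mul_add, add_mul, mul_zero, zero_mul, mul_assoc] at h₁ h₂ ⊢
      linear_combination (norm := noncomm_ring) h₁ - h₂
    have h₁ := key m 0 n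
    have h₂ := key (m + n) 0 0
    simp only [add_zero] at h₁ h₂
    rw [eq_neg_iff_add_eq_zero, ← two_smul ℂ, smul_eq_zero_iff_right two_ne_zero] at h₂
    rw [h₂, neg_zero, sub_eq_zero] at h₁
    exact h₁

/-! ### Parity of the modes -/

theorem map_parity_SY (q : ℂ) (i j : Fin 2) :
    PowerSeries.map (parityY q : Y q →+* Y q) (SY q i j) = sgn (par i + par j) • SY q i j := by
  ext n
  simp [coeff_SY, parityY_sY]

theorem map_parity_D (q : ℂ) : PowerSeries.map (parityY q : Y q →+* Y q) (SY q 1 1) = SY q 1 1 := by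
  rw [map_parity_SY, diag_even, sgn_zero, one_smul]

theorem map_parity_DInv (q : ℂ) :
    PowerSeries.map (parityY q : Y q →+* Y q) (DInv q) = DInv q := by
  have h := congrArg (PowerSeries.map (parityY q : Y q →+* Y q)) (DInv_mul_SY q)
  rw [map_mul, map_parity_D, map_one] at h
  rw [← mul_one (PowerSeries.map _ _), ← SY_mul_DInv, ← mul_assoc, h, one_mul]

theorem map_parity_ES (q : ℂ) : PowerSeries.map (parityY q : Y q →+* Y q) (ES q) = -ES q := by
  rw [ES, map_mul, map_parity_DInv, map_parity_SY]
  simp [par, sgn]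

theorem map_parity_FS (q : ℂ) : PowerSeries.map (parityY q : Y q →+* Y q) (FS q) = -FS q := by
  rw [FS, map_mul, map_parity_DInv, map_parity_SY]
  simp [par, sgn]

theorem map_parity_HS (q : ℂ) : PowerSeries.map (parityY q : Y q →+* Y q) (HS q) = HS q := by
  rw [HS, map_sub, map_mul, map_mul, map_parity_ES, map_parity_FS, map_parity_DInv, map_parity_SY,
    neg_mul_neg, diag_even, sgn_zero, one_smul]

theorem eY_mem (q : ℂ) (n : ℕ) : eY q n ∈ gradY q 1 := by
  have h := congrArg (PowerSeries.coeff n) (map_parity_ES q)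
  rw [PowerSeries.coeff_map, map_neg] at h
  rw [mem_superPart, sgn_one, neg_one_smul]
  exact h

theorem fY_mem (q : ℂ) (n : ℕ) : fY q n ∈ gradY q 1 := by
  have h := congrArg (PowerSeries.coeff n) (map_parity_FS q)
  rw [PowerSeries.coeff_map, map_neg] at h
  rw [mem_superPart, sgn_one, neg_one_smul]
  exact h

theorem gY_mem (q : ℂ) (n : ℕ) : gY q n ∈ gradY q 1 := (gradY q 1).smul_mem _ (fY_mem q _)

theorem hY_mem (q : ℂ) (n : ℕ) : hY q n ∈ gradY q 0 := by
  have h := congrArg (PowerSeries.coeff n) (map_parity_HS q)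
  rw [PowerSeries.coeff_map] at h
  rw [mem_superPart, sgn_zero, one_smul]
  exact h

theorem dY_mem (q : ℂ) (n : ℕ) : dY q n ∈ gradY q 0 := by
  rw [← diag_even 1]
  exact sY_mem q 1 1 n

end Modes

/-! ## Generation by the modes and the coproduct of the modes -/

section Coproduct

variable {q : ℂ}

theorem sY_zero_one (q : ℂ) (n : ℕ) :
    sY q 0 1 n = ∑ p ∈ Finset.HasAntidiagonal.antidiagonal n, dY q p.1 * eY q p.2 := by
  rw [← coeff_SY, ← SY_mul_ES, PowerSeries.coeff_mul]
  simp only [coeff_SY, dY, eY]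

theorem sY_one_zero (q : ℂ) (n : ℕ) :
    sY q 1 0 n = ∑ p ∈ Finset.HasAntidiagonal.antidiagonal n, dY q p.1 * fY q p.2 := by
  rw [← coeff_SY, ← SY_mul_FS, PowerSeries.coeff_mul]
  simp only [coeff_SY, dY, fY]

theorem SY_mul_HS (q : ℂ) : SY q 1 1 * HS q + SY q 1 0 * ES q = SY q 0 0 := by
  rw [HS, mul_sub, ← mul_assoc, SY_mul_DInv, one_mul, ← mul_assoc, SY_mul_FS, sub_add_cancel]

theorem SY_mul_HS' (q : ℂ) : SY q 1 1 * HS' q - SY q 0 1 * FS q = SY q 0 0 := by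
  rw [HS', mul_add, ← mul_assoc, SY_mul_DInv, one_mul, ← mul_assoc, SY_mul_ES, add_sub_cancel_right]

theorem sY_zero_zero (q : ℂ) (n : ℕ) :
    sY q 0 0 n = ∑ p ∈ Finset.HasAntidiagonal.antidiagonal n,
      (dY q p.1 * hY q p.2 + sY q 1 0 p.1 * eY q p.2) := by
  rw [← coeff_SY, ← SY_mul_HS, map_add, PowerSeries.coeff_mul, PowerSeries.coeff_mul,
    ← Finset.sum_add_distrib]
  simp only [coeff_SY, dY, eY, hY]

/-- A subalgebra of `Y_q(gl(1,1))` that contains the generators is everything. -/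
theorem subalgebra_eq_top (S : Subalgebra ℂ (Y q)) (hs : ∀ i j n, sY q i j n ∈ S)
    (ht : ∀ i, sInvY q i ∈ S) (y : Y q) : y ∈ S := by
  obtain ⟨y, hy⟩ := y
  induction hy using Algebra.adjoin_induction with
  | mem x hx =>
    rcases hx with ⟨i, j, n, rfl⟩ | ⟨i, rfl⟩
    · exact hs i j n
    · exact ht i
  | algebraMap r => exact S.algebraMap_mem r
  | add x y hx hy h₁ h₂ => exact S.add_mem h₁ h₂
  | mul x y hx hy h₁ h₂ => exact S.mul_mem h₁ h₂

/-- `Y ⊗ Y`. -/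
abbrev YY (q : ℂ) : Type := gradY q ᵍ⊗[ℂ] gradY q

/-- `x ↦ x ⊗ 1`. -/
def inL (q : ℂ) : Y q →ₐ[ℂ] YY q := GradedTensorProduct.includeLeft _ _

/-- `x ↦ 1 ⊗ x`. -/
def inR (q : ℂ) : Y q →ₐ[ℂ] YY q := GradedTensorProduct.includeRight _ _

/-- An algebra morphism applied to the coefficients of a power series. -/
def mapSer {A B : Type*} [Ring A] [Algebra ℂ A] [Ring B] [Algebra ℂ B] (φ : A →ₐ[ℂ] B) :
    A⟦X⟧ →+* B⟦X⟧ := PowerSeries.map (φ : A →+* B)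

theorem coeff_mapSer {A B : Type*} [Ring A] [Algebra ℂ A] [Ring B] [Algebra ℂ B] (φ : A →ₐ[ℂ] B)
    (x : A⟦X⟧) (n : ℕ) : PowerSeries.coeff n (mapSer φ x) = φ (PowerSeries.coeff n x) := by
  simp [mapSer]

theorem inR_mul_inL {p r : ZMod 2} {x y : (Y q)⟦X⟧}
    (hx : ∀ n, PowerSeries.coeff n x ∈ gradY q p) (hy : ∀ n, PowerSeries.coeff n y ∈ gradY q r) :
    mapSer (inR q) y * mapSer (inL q) x = sgn (r * p) • (mapSer (inL q) x * mapSer (inR q) y) := by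
  ext n
  rw [PowerSeries.coeff_smul, PowerSeries.coeff_mul, PowerSeries.coeff_mul, Finset.smul_sum,
    ← Finset.Nat.sum_antidiagonal_swap]
  refine Finset.sum_congr rfl fun m _ => ?_
  rw [Prod.fst_swap, Prod.snd_swap, coeff_mapSer, coeff_mapSer]
  exact right_mul_left _ _ (hx _) (hy _)

theorem SY_mem (i j : Fin 2) (n : ℕ) : PowerSeries.coeff n (SY q i j) ∈ gradY q (par i + par j) := by
  rw [coeff_SY]
  exact sY_mem q i j n

theorem mapSer_comul_SY (q : ℂ) (i j : Fin 2) : mapSer (comulY q) (SY q i j) =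
    ∑ k, sgn ((par i + par k) * (par k + par j)) •
      (mapSer (inL q) (SY q i k) * mapSer (inR q) (SY q k j)) := by
  ext n
  rw [coeff_mapSer, coeff_SY, comulY_sY, coprod_eq, map_sum]
  beta_reduce
  rw [Finset.sum_comm]
  refine Finset.sum_congr rfl fun k _ => ?_
  rw [PowerSeries.coeff_smul, PowerSeries.coeff_mul, Finset.smul_sum]
  simp only [coeff_mapSer, coeff_SY]
  rfl

theorem comul_D (q : ℂ) : mapSer (comulY q) (SY q 1 1) =
    mapSer (inL q) (SY q 1 1) * mapSer (inR q) (SY q 1 1) -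
      mapSer (inL q) (SY q 1 0) * mapSer (inR q) (SY q 0 1) := by
  rw [mapSer_comul_SY, Fin.sum_univ_two]
  simp [par, sgn, one_add_one_zmod]
  abel

theorem comul_B (q : ℂ) : mapSer (comulY q) (SY q 0 1) =
    mapSer (inL q) (SY q 0 0) * mapSer (inR q) (SY q 0 1) +
      mapSer (inL q) (SY q 0 1) * mapSer (inR q) (SY q 1 1) := by
  rw [mapSer_comul_SY, Fin.sum_univ_two]
  simp [par, sgn, one_add_one_zmod]

theorem comul_C (q : ℂ) : mapSer (comulY q) (SY q 1 0) =
    mapSer (inL q) (SY q 1 0) * mapSer (inR q) (SY q 0 0) +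
      mapSer (inL q) (SY q 1 1) * mapSer (inR q) (SY q 1 0) := by
  rw [mapSer_comul_SY, Fin.sum_univ_two]
  simp [par, sgn, one_add_one_zmod]

/-- Δ(D) is invertible, so Δ(D⁻¹y) is the only solution t of Δ(D) t = Δ(y). The coproducts of E and
F can thus be checked instead of derived. -/
theorem comul_solve {x y : (Y q)⟦X⟧} {t : (YY q)⟦X⟧} (hx : x = DInv q * y)
    (h : mapSer (comulY q) (SY q 1 1) * t = mapSer (comulY q) y) : mapSer (comulY q) x = t := by
  rw [hx, map_mul, ← h, ← mul_assoc, ← map_mul, DInv_mul_SY, map_one, one_mul]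

theorem B_mul_ES (hq₀ : q ≠ 0) (hq : ∀ n : ℕ, 0 < n → q ^ n ≠ 1) : SY q 0 1 * ES q = 0 := by
  rw [← SY_mul_ES, mul_assoc, ES_sq hq₀ hq, mul_zero]

theorem C_mul_FS (hq₀ : q ≠ 0) (hq : ∀ n : ℕ, 0 < n → q ^ n ≠ 1) : SY q 1 0 * FS q = 0 := by
  rw [← SY_mul_FS, mul_assoc, FS_sq hq₀ hq, mul_zero]

/-- Multiply the candidate by Δ(D) = D⊗D - C⊗B. The product of C⊗B with H⊗E vanishes because BE =
DE² = 0, and the remaining terms recombine through A = DH + CE. -/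
theorem comul_ES (hq₀ : q ≠ 0) (hq : ∀ n : ℕ, 0 < n → q ^ n ≠ 1) : mapSer (comulY q) (ES q) =
    mapSer (inL q) (HS q) * mapSer (inR q) (ES q) + mapSer (inL q) (ES q) := by
  refine comul_solve rfl ?_
  have h₁ := inR_mul_inL (q := q) (hY_mem q) (SY_mem 1 1)
  have h₂ := inR_mul_inL (q := q) (hY_mem q) (SY_mem 0 1)
  have h₃ := inR_mul_inL (q := q) (eY_mem q) (SY_mem 1 1)
  have h₄ := inR_mul_inL (q := q) (eY_mem q) (SY_mem 0 1)
  simp only [par, sgn, one_add_one_zmod, if_true, if_false, mul_zero, one_smul, mul_one,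
    zero_add, one_ne_zero, neg_one_smul] at h₁ h₂ h₃ h₄
  have e₁ : mapSer (inL q) (SY q 1 1) * mapSer (inR q) (SY q 1 1) *
      (mapSer (inL q) (HS q) * mapSer (inR q) (ES q)) =
      mapSer (inL q) (SY q 1 1 * HS q) * mapSer (inR q) (SY q 0 1) := by
    rw [mul_assoc, ← mul_assoc (mapSer (inR q) _), h₁, mul_assoc, ← map_mul, SY_mul_ES, ← mul_assoc,
      ← map_mul]
  have e₂ : mapSer (inL q) (SY q 1 1) * mapSer (inR q) (SY q 1 1) * mapSer (inL q) (ES q) =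
      mapSer (inL q) (SY q 0 1) * mapSer (inR q) (SY q 1 1) := by
    rw [mul_assoc, h₃, ← mul_assoc, ← map_mul, SY_mul_ES]
  have e₃ : mapSer (inL q) (SY q 1 0) * mapSer (inR q) (SY q 0 1) *
      (mapSer (inL q) (HS q) * mapSer (inR q) (ES q)) = 0 := by
    rw [mul_assoc, ← mul_assoc (mapSer (inR q) _), h₂, mul_assoc, ← map_mul, B_mul_ES hq₀ hq,
      map_zero, mul_zero, mul_zero]
  have e₄ : mapSer (inL q) (SY q 1 0) * mapSer (inR q) (SY q 0 1) * mapSer (inL q) (ES q) =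
      -(mapSer (inL q) (SY q 1 0 * ES q) * mapSer (inR q) (SY q 0 1)) := by
    rw [mul_assoc, h₄, mul_neg, ← mul_assoc, ← map_mul]
  rw [comul_D, comul_B, sub_mul, mul_add, mul_add, e₁, e₂, e₃, e₄, ← SY_mul_HS, map_add, add_mul]
  abel

/-- Mirror image of `comul_ES`: CF = DF² = 0 removes one term, and A = DH' - BF recombines the
others. This is where H' enters in place of H. -/
theorem comul_FS (hq₀ : q ≠ 0) (hq : ∀ n : ℕ, 0 < n → q ^ n ≠ 1) : mapSer (comulY q) (FS q) =
    mapSer (inL q) (FS q) * mapSer (inR q) (HS' q) + mapSer (inR q) (FS q) := by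
  refine comul_solve rfl ?_
  have h₃ := inR_mul_inL (q := q) (fY_mem q) (SY_mem 1 1)
  have h₄ := inR_mul_inL (q := q) (fY_mem q) (SY_mem 0 1)
  simp only [par, sgn, one_add_one_zmod, if_true, if_false, one_smul, mul_one,
    zero_add, one_ne_zero, neg_one_smul] at h₃ h₄
  have e₁ : mapSer (inL q) (SY q 1 1) * mapSer (inR q) (SY q 1 1) *
      (mapSer (inL q) (FS q) * mapSer (inR q) (HS' q)) =
      mapSer (inL q) (SY q 1 0) * mapSer (inR q) (SY q 1 1 * HS' q) := by
    rw [mul_assoc, ← mul_assoc (mapSer (inR q) _), h₃, mul_assoc, ← map_mul, ← mul_assoc,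
      ← map_mul, SY_mul_FS]
  have e₂ : mapSer (inL q) (SY q 1 1) * mapSer (inR q) (SY q 1 1) * mapSer (inR q) (FS q) =
      mapSer (inL q) (SY q 1 1) * mapSer (inR q) (SY q 1 0) := by
    rw [mul_assoc, ← map_mul, SY_mul_FS]
  have e₃ : mapSer (inL q) (SY q 1 0) * mapSer (inR q) (SY q 0 1) *
      (mapSer (inL q) (FS q) * mapSer (inR q) (HS' q)) = 0 := by
    rw [mul_assoc, ← mul_assoc (mapSer (inR q) _), h₄, neg_mul, mul_neg, mul_assoc, ← mul_assoc,
      ← map_mul, C_mul_FS hq₀ hq, map_zero, zero_mul, neg_zero]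
  have e₄ : mapSer (inL q) (SY q 1 0) * mapSer (inR q) (SY q 0 1) * mapSer (inR q) (FS q) =
      mapSer (inL q) (SY q 1 0) * mapSer (inR q) (SY q 0 1 * FS q) := by
    rw [mul_assoc, ← map_mul]
  rw [comul_D, comul_C, sub_mul, mul_add, mul_add, e₁, e₂, e₃, e₄, ← SY_mul_HS', map_sub, mul_sub]
  abel

theorem comul_eY (hq₀ : q ≠ 0) (hq : ∀ n : ℕ, 0 < n → q ^ n ≠ 1) (n : ℕ) : comulY q (eY q n) =
    ∑ p ∈ Finset.HasAntidiagonal.antidiagonal n, inL q (hY q p.1) * inR q (eY q p.2) +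
      inL q (eY q n) := by
  have h := congrArg (PowerSeries.coeff n) (comul_ES hq₀ hq)
  rw [map_add, PowerSeries.coeff_mul, coeff_mapSer, coeff_mapSer] at h
  simp only [coeff_mapSer] at h
  exact h

/-- Substituting q⁻²z for z turns H' into H, and the division by z is harmless because f_0 = 0. -/
theorem comul_gY (hq₀ : q ≠ 0) (hq : ∀ n : ℕ, 0 < n → q ^ n ≠ 1) (n : ℕ) : comulY q (gY q n) =
    ∑ p ∈ Finset.HasAntidiagonal.antidiagonal n, inL q (gY q p.1) * inR q (hY q p.2) +
      inR q (gY q n) := by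
  have h := congrArg (PowerSeries.coeff (n + 1)) (comul_FS hq₀ hq)
  rw [map_add, PowerSeries.coeff_mul, coeff_mapSer, coeff_mapSer,
    Finset.Nat.sum_antidiagonal_succ] at h
  simp only [coeff_mapSer, coeff_HS' hq₀ hq] at h
  have h0 : PowerSeries.coeff 0 (FS q) = 0 := fY_zero q
  rw [h0, map_zero, zero_mul, zero_add] at h
  change comulY q (fY q (n + 1)) = _ at h
  rw [gY, map_smul, h, smul_add, map_smul, Finset.smul_sum]
  congr 1
  refine Finset.sum_congr rfl fun p hp => ?_
  rw [Finset.HasAntidiagonal.mem_antidiagonal] at hp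
  change _ • (inL q (fY q (p.1 + 1)) * _) = _
  rw [fY_succ hq₀, map_smul, map_smul, smul_mul_smul_comm, smul_smul, ← hp]
  convert one_smul ℂ _
  rw [inv_pow]
  field_simp
  ring

end Coproduct

/-! ### Action of the modes on a tensor product of two modules. -/

namespace YModule

variable {q : ℂ} (V W : YModule.{u} q)

/-- The action of `Y_q(gl(1,1))` on `V ⊗ W`. -/
def tact : Y q →ₐ[ℂ] Module.End ℂ (V ⊗[ℂ] W) := (actTwo V W).comp (comulY q)

theorem tact_apply (y : Y q) : tact V W y = actTwo V W (comulY q y) := rfl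

theorem actTwo_inL (y : Y q) : actTwo V W (inL q y) = actLeft V W y := by
  rw [actTwo, inL, GradedTensorProduct.includeLeft_apply, GradedTensorProduct.lift_tmul, map_one,
    mul_one]

theorem actTwo_inR (y : Y q) : actTwo V W (inR q y) = actRight V W y := by
  rw [actTwo, inR, GradedTensorProduct.includeRight_apply, GradedTensorProduct.lift_tmul, map_one,
    one_mul]

theorem actRight_of_even {y : Y q} (hy : y ∈ gradY q 0) (v : V) (w : W) :
    actRight V W y (v ⊗ₜ w) = v ⊗ₜ W.act y w := actRightLin_of_even V W hy v w

theorem actRight_of_odd {y : Y q} (hy : y ∈ gradY q 1) (v : V) (w : W) :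
    actRight V W y (v ⊗ₜ w) = V.parity v ⊗ₜ W.act y w := actRightLin_of_odd V W hy v w

theorem tact_e (hq₀ : q ≠ 0) (hq : ∀ n : ℕ, 0 < n → q ^ n ≠ 1) (n : ℕ) (v : V) (w : W) :
    tact V W (eY q n) (v ⊗ₜ[ℂ] w : V ⊗[ℂ] W) =
      (∑ p ∈ Finset.HasAntidiagonal.antidiagonal n,
        V.act (hY q p.1) (V.parity v) ⊗ₜ[ℂ] W.act (eY q p.2) w +
      V.act (eY q n) v ⊗ₜ[ℂ] w : V ⊗[ℂ] W) := by
  rw [tact_apply, comul_eY hq₀ hq, map_add, map_sum]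
  simp only [map_mul, actTwo_inL, actTwo_inR]
  rw [LinearMap.add_apply, LinearMap.sum_apply]
  simp only [Module.End.mul_apply, actRight_of_odd V W (eY_mem q _), actLeft_tmul]

theorem tact_g (hq₀ : q ≠ 0) (hq : ∀ n : ℕ, 0 < n → q ^ n ≠ 1) (n : ℕ) (v : V) (w : W) :
    tact V W (gY q n) (v ⊗ₜ[ℂ] w : V ⊗[ℂ] W) =
      (∑ p ∈ Finset.HasAntidiagonal.antidiagonal n,
        V.act (gY q p.1) v ⊗ₜ[ℂ] W.act (hY q p.2) w +
      V.parity v ⊗ₜ[ℂ] W.act (gY q n) w : V ⊗[ℂ] W) := by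
  rw [tact_apply, comul_gY hq₀ hq, map_add, map_sum]
  simp only [map_mul, actTwo_inL, actTwo_inR]
  rw [LinearMap.add_apply, LinearMap.sum_apply]
  simp only [Module.End.mul_apply, actRight_of_odd V W (gY_mem q _),
    actRight_of_even V W (hY_mem q _), actLeft_tmul]

/-- The term C⊗B of Δ(D) drops out because s_12 kills w. -/
theorem tact_d (n : ℕ) (v : V) (w : W) (hw : ∀ n, W.act (sY q 0 1 n) w = 0) :
    tact V W (dY q n) (v ⊗ₜ[ℂ] w : V ⊗[ℂ] W) =
      (∑ p ∈ Finset.HasAntidiagonal.antidiagonal n,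
        V.act (dY q p.1) v ⊗ₜ[ℂ] W.act (dY q p.2) w : V ⊗[ℂ] W) := by
  have h := congrArg (PowerSeries.coeff n) (comul_D q)
  rw [map_sub, PowerSeries.coeff_mul, PowerSeries.coeff_mul, coeff_mapSer] at h
  simp only [coeff_mapSer, coeff_SY] at h
  rw [tact_apply, dY, h, map_sub, map_sum, map_sum]
  simp only [map_mul, actTwo_inL, actTwo_inR]
  rw [LinearMap.sub_apply, LinearMap.sum_apply, LinearMap.sum_apply]
  have h₁ : ∀ n, sY q 0 1 n ∈ gradY q 1 := fun n => by simpa [par] using sY_mem q 0 1 n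
  have h₂ : ∀ n, sY q 1 1 n ∈ gradY q 0 := dY_mem q
  simp only [Module.End.mul_apply, actRight_of_odd V W (h₁ _),
    actRight_of_even V W (h₂ _), actLeft_tmul, hw, TensorProduct.tmul_zero,
    Finset.sum_const_zero, sub_zero, map_zero, dY]

/-- Since s_21^(0) = 0, the element d_0 is group-like and its eigenvalues multiply. -/
theorem tact_d_zero (v : V) (w : W) :
    tact V W (dY q 0) (v ⊗ₜ[ℂ] w : V ⊗[ℂ] W) =
      (V.act (dY q 0) v ⊗ₜ[ℂ] W.act (dY q 0) w : V ⊗[ℂ] W) := by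
  have h := congrArg (PowerSeries.coeff 0) (comul_D q)
  rw [map_sub, coeff_zero_mul, coeff_zero_mul, coeff_mapSer] at h
  simp only [coeff_mapSer, coeff_SY, sY_one_zero_zero, map_zero, zero_mul, sub_zero] at h
  rw [tact_apply, dY, h, map_mul, actTwo_inL, actTwo_inR, Module.End.mul_apply, ← dY,
    actRight_of_even V W (dY_mem q _), actLeft_tmul]

/-- The anticommutators of e and g reach only h_1, h_2, …, so h_0 has to be treated apart. -/
theorem tact_h_zero (v : V) (w : W) :
    tact V W (hY q 0) (v ⊗ₜ[ℂ] w : V ⊗[ℂ] W) =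
      (V.act (hY q 0) v ⊗ₜ[ℂ] W.act (hY q 0) w : V ⊗[ℂ] W) := by
  have h := congrArg (PowerSeries.coeff 0) (mapSer_comul_SY q 0 0)
  rw [Fin.sum_univ_two, map_add, PowerSeries.coeff_smul, PowerSeries.coeff_smul, coeff_zero_mul,
    coeff_zero_mul, coeff_mapSer] at h
  simp only [coeff_mapSer, coeff_SY, sY_one_zero_zero, map_zero, mul_zero, smul_zero, add_zero,
    diag_even, sgn_zero, one_smul] at h
  have h₁ : comulY q (sInvY q 1) = inL q (sInvY q 1) * inR q (sInvY q 1) := by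
    rw [comulY_sInvY, inL, inR, GradedTensorProduct.includeLeft_apply,
      GradedTensorProduct.includeRight_apply, GradedTensorProduct.tmul_one_mul_one_tmul]
  have e₁ : sInvY q 1 ∈ gradY q 0 := mem_superPart.2 (by rw [parityY_sInvY, sgn_zero, one_smul])
  have e₂ : sY q 0 0 0 ∈ gradY q 0 := by
    rw [← diag_even 0]
    exact sY_mem q 0 0 0
  rw [hY_zero, tact_apply, map_mul, h, h₁, map_mul, map_mul, map_mul, map_mul, map_mul]
  simp only [actTwo_inL, actTwo_inR, Module.End.mul_apply, actRight_of_even V W e₁,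
    actRight_of_even V W e₂, actLeft_tmul]

end YModule

/-! ## Linear recurrences and polynomials -/

section Recurrence

open Finset.HasAntidiagonal

variable {M N : Type*} [AddCommGroup M] [Module ℂ M] [AddCommGroup N] [Module ℂ N]

/-- The sequence `s` satisfies the linear recurrence with characteristic polynomial `Q`, of
order `n`. -/
def IsRec (Q : Polynomial ℂ) (n : ℕ) (s : ℕ → M) : Prop :=
  ∀ j, ∑ x ∈ antidiagonal n, Q.coeff x.1 • s (x.2 + j) = 0

theorem IsRec.map {Q : Polynomial ℂ} {n : ℕ} {s : ℕ → M} (h : IsRec Q n s) (L : M →ₗ[ℂ] N) :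
    IsRec Q n fun m => L (s m) := by
  intro j
  have := congrArg L (h j)
  simpa only [map_sum, map_smul, map_zero] using this

theorem coeff_mul_coe {Q : Polynomial ℂ} {n : ℕ} (hQ : Q.natDegree ≤ n) (s : ℂ⟦X⟧) (j : ℕ) :
    PowerSeries.coeff (n + j) (s * (Q : ℂ⟦X⟧)) =
      ∑ x ∈ antidiagonal n, Q.coeff x.1 • PowerSeries.coeff (x.2 + j) s := by
  rw [mul_comm, PowerSeries.coeff_mul,
    Finset.Nat.sum_antidiagonal_eq_sum_range_succ_mk, Finset.Nat.sum_antidiagonal_eq_sum_range_succ_mk]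
  symm
  refine Finset.sum_subset_zero_on_sdiff (Finset.range_mono (by omega)) ?_ ?_
  · intro k hk
    simp only [Finset.mem_sdiff, Finset.mem_range] at hk
    rw [Polynomial.coeff_coe, Polynomial.coeff_eq_zero_of_natDegree_lt (by omega), zero_mul]
  · intro k hk
    rw [Finset.mem_range] at hk
    rw [Polynomial.coeff_coe, smul_eq_mul]
    congr 3
    omega

/-- The j-th instance of the recurrence is the coefficient of degree n + j of the product with Q, so
the recurrence says that this product stops below degree n. -/
theorem isRec_iff {Q : Polynomial ℂ} {n : ℕ} (hQ : Q.natDegree ≤ n) (s : ℕ → ℂ) :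
    IsRec Q n s ↔ ∃ r : Polynomial ℂ, r.degree < n ∧ PowerSeries.mk s * (Q : ℂ⟦X⟧) = r := by
  have e : ∀ j, ∑ x ∈ antidiagonal n, Q.coeff x.1 • s (x.2 + j) =
      PowerSeries.coeff (n + j) (PowerSeries.mk s * (Q : ℂ⟦X⟧)) := fun j => by
    rw [coeff_mul_coe hQ]
    simp only [PowerSeries.coeff_mk]
  constructor
  · intro h
    refine ⟨PowerSeries.trunc n (PowerSeries.mk s * (Q : ℂ⟦X⟧)), PowerSeries.degree_trunc_lt _ _, ?_⟩
    ext m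
    rw [Polynomial.coeff_coe, PowerSeries.coeff_trunc]
    split_ifs with hm
    · rfl
    · obtain ⟨j, rfl⟩ := Nat.exists_eq_add_of_le (not_lt.1 hm)
      rw [← e, h j]
  · rintro ⟨r, hr, h⟩ j
    rw [e, h, Polynomial.coeff_coe]
    exact Polynomial.coeff_eq_zero_of_degree_lt (hr.trans_le (by exact_mod_cast Nat.le_add_right n j))

/-- Here p may have degree exactly n, so the coefficients of h obey the recurrence only from degree
n + 1 on; hence the shift by l + 1. -/
theorem isRec_coeff {p Q : Polynomial ℂ} {n : ℕ} {h : ℂ⟦X⟧} (hQ : Q.natDegree ≤ n)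
    (hp : p.natDegree ≤ n) (e : h * (Q : ℂ⟦X⟧) = p) (l : ℕ) :
    IsRec Q n fun m => PowerSeries.coeff (m + l + 1) h := by
  intro j
  have := coeff_mul_coe hQ h (j + (l + 1))
  rw [e, Polynomial.coeff_coe, Polynomial.coeff_eq_zero_of_natDegree_lt (by omega)] at this
  rw [this]
  refine Finset.sum_congr rfl fun x _ => ?_
  congr 2
  ring_nf

theorem coe_ne_zero {Q : Polynomial ℂ} (hQ : Q.coeff 0 ≠ 0) : (Q : ℂ⟦X⟧) ≠ 0 := fun h =>
  hQ (by rw [← Polynomial.coeff_coe, h, map_zero])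

/-- `X` and `Y`, as sections of `𝒪(n)` and `𝒪(m)` on the projective line, have no common zero. -/
def NoCommonZero (X : Polynomial ℂ) (n : ℕ) (Y : Polynomial ℂ) (m : ℕ) : Prop :=
  IsCoprime X Y ∧ (X.natDegree = n ∨ Y.natDegree = m)

theorem eq_zero_of_dvd {X r : Polynomial ℂ} {n : ℕ} (hn : X.natDegree = n) (hr : r.degree < n)
    (h : X ∣ r) : r = 0 := by
  by_contra h0
  have := Polynomial.natDegree_le_of_dvd h h0
  rw [← Polynomial.natDegree_lt_iff_degree_lt h0] at hr
  omega

/-- Coprimality gives X ∣ r and Y ∣ r'. Whichever of X, Y has full degree, that is, no zero at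
infinity, forces its multiple to vanish, and the equation kills the other one. -/
theorem NoCommonZero.eq_zero {X Y r r' : Polynomial ℂ} {n m : ℕ} (h : NoCommonZero X n Y m)
    (hX : X ≠ 0) (hY : Y ≠ 0) (hr : r.degree < n) (hr' : r'.degree < m)
    (e : r * Y + r' * X = 0) : r = 0 ∧ r' = 0 := by
  obtain ⟨hc, hd⟩ := h
  have h₁ : X ∣ r := hc.dvd_of_dvd_mul_right ⟨-r', by linear_combination e⟩
  have h₂ : Y ∣ r' := hc.symm.dvd_of_dvd_mul_right ⟨-r, by linear_combination e⟩
  rcases hd with hd | hd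
  · have := eq_zero_of_dvd hd hr h₁
    subst this
    simpa [hX] using e
  · have := eq_zero_of_dvd hd hr' h₂
    subst this
    simpa [hY] using e

theorem degree_lt_of_natDegree_lt {r : Polynomial ℂ} {n : ℕ} (h : r.natDegree < n) : r.degree < n :=
  (Polynomial.degree_le_natDegree).trans_lt (by exact_mod_cast h)

/-- If X and Y are coprime, their common zero is at infinity: both degrees drop, and (X, -Y) is
already small enough. Otherwise dividing both by their gcd lowers the degrees. -/
theorem exists_of_not_noCommonZero {X Y : Polynomial ℂ} {n m : ℕ} (hX : X ≠ 0) (hY : Y ≠ 0)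
    (hn : X.natDegree ≤ n) (hm : Y.natDegree ≤ m) (h : ¬ NoCommonZero X n Y m) :
    ∃ r r' : Polynomial ℂ, r.degree < n ∧ r'.degree < m ∧ r * Y + r' * X = 0 ∧ r ≠ 0 := by
  by_cases hc : IsCoprime X Y
  · have hd : ¬ (X.natDegree = n ∨ Y.natDegree = m) := fun hd => h ⟨hc, hd⟩
    push Not at hd
    refine ⟨X, -Y, degree_lt_of_natDegree_lt (by omega), ?_, by ring, hX⟩
    exact degree_lt_of_natDegree_lt (by rw [Polynomial.natDegree_neg]; omega)
  · rw [← EuclideanDomain.gcd_isUnit_iff] at hc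
    obtain ⟨a, ha⟩ := EuclideanDomain.gcd_dvd_left X Y
    obtain ⟨b, hb⟩ := EuclideanDomain.gcd_dvd_right X Y
    set g := EuclideanDomain.gcd X Y
    have hg : g ≠ 0 := fun hg => hX (by rw [ha, hg, zero_mul])
    have ha0 : a ≠ 0 := fun h0 => hX (by rw [ha, h0, mul_zero])
    have hb0 : b ≠ 0 := fun h0 => hY (by rw [hb, h0, mul_zero])
    have hgd : 0 < g.natDegree := by
      rw [Nat.pos_iff_ne_zero]
      intro h0
      rw [Polynomial.eq_C_of_natDegree_eq_zero h0, Polynomial.isUnit_C, isUnit_iff_ne_zero] at hc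
      refine hc fun h1 => hg ?_
      rw [Polynomial.eq_C_of_natDegree_eq_zero h0, h1, map_zero]
    have h₁ := Polynomial.natDegree_mul hg ha0
    have h₂ := Polynomial.natDegree_mul hg hb0
    rw [← ha] at h₁
    rw [← hb] at h₂
    refine ⟨a, -b, degree_lt_of_natDegree_lt (by omega), ?_, ?_, ha0⟩
    · exact degree_lt_of_natDegree_lt (by rw [Polynomial.natDegree_neg]; omega)
    · linear_combination a * hb - b * ha

theorem noCommonZero_mul_iff {X Y Y' : Polynomial ℂ} {n m m' : ℕ} (hY : Y ≠ 0) (hY' : Y' ≠ 0)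
    (hm : Y.natDegree ≤ m) (hm' : Y'.natDegree ≤ m') :
    NoCommonZero X n (Y * Y') (m + m') ↔ NoCommonZero X n Y m ∧ NoCommonZero X n Y' m' := by
  rw [NoCommonZero, NoCommonZero, NoCommonZero, IsCoprime.mul_right_iff,
    Polynomial.natDegree_mul hY hY']
  have : Y.natDegree + Y'.natDegree = m + m' ↔ Y.natDegree = m ∧ Y'.natDegree = m' := by omega
  rw [this]
  tauto

/-- The Hankel matrix of a rational function is non-degenerate. -/
theorem hankel_injective {p Q : Polynomial ℂ} {h : ℂ⟦X⟧} (e : h * (Q : ℂ⟦X⟧) = p)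
    (hQ : Q.coeff 0 ≠ 0) (hp : p ≠ 0) (hc : IsCoprime p Q) {n : ℕ}
    (hn : n = max p.natDegree Q.natDegree) (c : Fin n → ℂ)
    (h0 : ∀ m, ∑ k, c k * PowerSeries.coeff (m + k + 1) h = 0) : c = 0 := by
  -- The exponents n - k run through 1, …, n, so C has degree at most n and no constant term. The
  -- Hankel relations say that hC has no terms beyond degree n.
  set C : Polynomial ℂ := ∑ k : Fin n, Polynomial.monomial (n - k) (c k) with hC
  have hCd : C.natDegree ≤ n := Polynomial.natDegree_sum_le_of_forall_le _ _ fun k _ =>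
    (Polynomial.natDegree_monomial_le _).trans (Nat.sub_le _ _)
  have hCc : ∀ k : Fin n, C.coeff (n - k) = c k := by
    intro k
    rw [hC, Polynomial.finsetSum_coeff, Finset.sum_eq_single k]
    · simp
    · intro b _ hb
      rw [Polynomial.coeff_monomial, if_neg]
      intro h
      exact hb (Fin.ext (by omega))
    · simp
  have hC0 : C.coeff 0 = 0 := by
    rw [hC, Polynomial.finsetSum_coeff]
    refine Finset.sum_eq_zero fun b _ => ?_
    rw [Polynomial.coeff_monomial, if_neg (by omega)]
  have hCh : ∀ m, PowerSeries.coeff (n + 1 + m) (h * (C : ℂ⟦X⟧)) = 0 := by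
    intro m
    have hC' : (C : ℂ⟦X⟧) = ∑ k : Fin n, c k • (PowerSeries.X : ℂ⟦X⟧) ^ (n - k : ℕ) := by
      rw [hC]
      ext i
      simp only [Polynomial.coeff_coe, Polynomial.finsetSum_coeff, map_sum,
        Polynomial.coeff_monomial, PowerSeries.coeff_smul, PowerSeries.coeff_X_pow]
      exact Finset.sum_congr rfl fun k _ => by simp [eq_comm]
    rw [hC', Finset.mul_sum, map_sum, ← h0 m]
    refine Finset.sum_congr rfl fun k _ => ?_
    rw [show n + 1 + m = (m + k + 1) + (n - k) by omega, mul_smul_comm,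
      PowerSeries.coeff_smul, PowerSeries.coeff_mul_X_pow, smul_eq_mul]
  by_contra hne
  have hCne : C ≠ 0 := by
    intro h
    exact hne (funext fun k => by rw [← hCc, h]; simp)
  set p₂ : Polynomial ℂ := PowerSeries.trunc (n + 1) (h * (C : ℂ⟦X⟧))
  have hp₂ : (p₂ : ℂ⟦X⟧) = h * C := by
    ext m
    rw [Polynomial.coeff_coe, PowerSeries.coeff_trunc]
    split_ifs with hm
    · rfl
    · obtain ⟨j, rfl⟩ := Nat.exists_eq_add_of_le (not_lt.1 hm)
      rw [hCh]
  have hmul : C * p = p₂ * Q := by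
    apply Polynomial.coe_injective ℂ
    rw [Polynomial.coe_mul, Polynomial.coe_mul, hp₂, ← e]
    ring
  -- Now C = Qw and p₂ = pw with w(0) = 0, so w ≠ 0 has positive degree. One of p, Q has degree n,
  -- hence one of p₂, C would have degree above n.
  obtain ⟨w, hw⟩ : Q ∣ C := hc.symm.dvd_of_dvd_mul_right ⟨p₂, by rw [hmul, mul_comm]⟩
  have hQ0 : Q ≠ 0 := fun h => hQ (by rw [h, Polynomial.coeff_zero])
  have hw0 : w ≠ 0 := fun h => hCne (by rw [hw, h, mul_zero])
  have hp₂' : p₂ = p * w := mul_left_cancel₀ hQ0 (by linear_combination -hmul + p * hw)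
  have hwc : w.coeff 0 = 0 := by
    rw [hw, Polynomial.mul_coeff_zero] at hC0
    exact (mul_eq_zero.1 hC0).resolve_left hQ
  have hwd : 0 < w.natDegree := by
    rw [Nat.pos_iff_ne_zero]
    intro h
    rw [Polynomial.eq_C_of_natDegree_eq_zero h, hwc, map_zero] at hw0
    exact hw0 rfl
  have d₁ := Polynomial.natDegree_mul hQ0 hw0
  rw [← hw] at d₁
  have d₂ := Polynomial.natDegree_mul hp hw0
  rw [← hp₂'] at d₂
  have d₃ : p₂.natDegree < n + 1 := PowerSeries.natDegree_trunc_lt _ n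
  omega

/-- A space of sequences that satisfy a recurrence of order `n`, of dimension at least `n`,
consists of all of them. -/
theorem exists_of_finrank_le {E : Type*} [AddCommGroup E] [Module ℂ E] [FiniteDimensional ℂ E]
    {Q : Polynomial ℂ} {n : ℕ} (hQ : Q.natDegree ≤ n) (hQ0 : Q.coeff 0 ≠ 0)
    (A : ℕ → E →ₗ[ℂ] ℂ) (hA : ∀ x, IsRec Q n fun m => A m x)
    (hinj : ∀ x, (∀ m, A m x = 0) → x = 0) (hn : n ≤ Module.finrank ℂ E)
    (r : Polynomial ℂ) (hr : r.degree < n) :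
    ∃ x, PowerSeries.mk (fun m => A m x) * (Q : ℂ⟦X⟧) = r := by
  -- The coefficients of the numerator below degree n. They determine the sequence, so `L` is
  -- injective, and it is bijective by the lower bound on the dimension.
  let L : E →ₗ[ℂ] (Fin n → ℂ) := LinearMap.pi fun k =>
    ∑ x ∈ antidiagonal (k : ℕ), Q.coeff x.2 • A x.1
  have hL : ∀ x (k : Fin n), L x k =
      PowerSeries.coeff k (PowerSeries.mk (fun m => A m x) * (Q : ℂ⟦X⟧)) := by
    intro x k
    simp only [L, LinearMap.pi_apply, LinearMap.sum_apply, LinearMap.smul_apply, smul_eq_mul,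
      PowerSeries.coeff_mul, PowerSeries.coeff_mk, Polynomial.coeff_coe]
    exact Finset.sum_congr rfl fun _ _ => mul_comm _ _
  have key : ∀ x (r : Polynomial ℂ), r.degree < n → (∀ k : Fin n, L x k = r.coeff k) →
      PowerSeries.mk (fun m => A m x) * (Q : ℂ⟦X⟧) = r := by
    intro x r hr h
    obtain ⟨r', hr', e⟩ := (isRec_iff hQ _).1 (hA x)
    rw [e]
    congr 1
    ext m
    by_cases hm : m < n
    · rw [← Polynomial.coeff_coe, ← e, ← hL x ⟨m, hm⟩, h]
    · have hm' : (n : WithBot ℕ) ≤ m := by exact_mod_cast not_lt.1 hm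
      rw [Polynomial.coeff_eq_zero_of_degree_lt (hr.trans_le hm'),
        Polynomial.coeff_eq_zero_of_degree_lt (hr'.trans_le hm')]
  have hLinj : Function.Injective L := by
    rw [← LinearMap.ker_eq_bot, LinearMap.ker_eq_bot']
    intro x hx
    have := key x 0 (by simp) (fun k => by rw [hx]; simp)
    rw [Polynomial.coe_zero] at this
    have := (mul_eq_zero.1 this).resolve_right (coe_ne_zero hQ0)
    exact hinj x fun m => by rw [← PowerSeries.coeff_mk m fun m => A m x, this, map_zero]
  have hle := LinearMap.finrank_le_finrank_of_injective hLinj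
  have hsurj : Function.Surjective L :=
    (LinearMap.injective_iff_surjective_of_finrank_eq_finrank
      (le_antisymm hle (by simpa using hn))).1 hLinj
  obtain ⟨x, hx⟩ := hsurj fun k => r.coeff k
  exact ⟨x, key x r hr fun k => by rw [hx]⟩

end Recurrence

/-! ## Subspaces stable under the lowering operators -/

section Rep

open Finset.HasAntidiagonal

variable {q : ℂ} {M : Type u} [AddCommGroup M] [Module ℂ M] (ρ : Y q →ₐ[ℂ] Module.End ℂ M)

theorem rep_mul (x y : Y q) (m : M) : ρ (x * y) m = ρ x (ρ y m) := by rw [map_mul]; rfl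

theorem rep_sInv_s (i : Fin 2) (m : M) : ρ (sInvY q i) (ρ (sY q i i 0) m) = m := by
  rw [← rep_mul, sInvY_mul_sY, map_one]; rfl

theorem rep_s_sInv (i : Fin 2) (m : M) : ρ (sY q i i 0) (ρ (sInvY q i) m) = m := by
  rw [← rep_mul, sY_mul_sInvY, map_one]; rfl

theorem rep_e_g (hq₀ : q ≠ 0) (m n : ℕ) (x : M) : ρ (eY q m) (ρ (gY q n) x) =
    kap q • ρ (hY q (m + n + 1)) x - ρ (gY q n) (ρ (eY q m) x) := by
  rw [eq_sub_iff_add_eq, ← rep_mul, ← rep_mul, ← LinearMap.add_apply, ← map_add, eY_mul_gY hq₀,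
    map_smul, LinearMap.smul_apply]

theorem rep_g_g (hq₀ : q ≠ 0) (hq : ∀ n : ℕ, 0 < n → q ^ n ≠ 1) (m n : ℕ) (x : M) :
    ρ (gY q m) (ρ (gY q n) x) = -ρ (gY q n) (ρ (gY q m) x) := by
  rw [eq_neg_iff_add_eq_zero, ← rep_mul, ← rep_mul, ← LinearMap.add_apply, ← map_add,
    gY_mul_gY hq₀ hq, map_zero, LinearMap.zero_apply]

theorem rep_h_g (hq₀ : q ≠ 0) (hq : ∀ n : ℕ, 0 < n → q ^ n ≠ 1) (m n : ℕ) (x : M) :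
    ρ (hY q m) (ρ (gY q n) x) = ρ (gY q n) (ρ (hY q m) x) := by
  rw [← rep_mul, hY_mul_gY hq₀ hq, rep_mul]

theorem rep_d_d (hq₀ : q ≠ 0) (m n : ℕ) (x : M) :
    ρ (dY q m) (ρ (dY q n) x) = ρ (dY q n) (ρ (dY q m) x) := by
  rw [← rep_mul, dY_comm hq₀, rep_mul]

theorem rep_d_zero_g (hq₀ : q ≠ 0) (n : ℕ) (x : M) :
    ρ (dY q 0) (ρ (gY q n) x) = q⁻¹ • ρ (gY q n) (ρ (dY q 0) x) := by
  rw [← rep_mul, dY_zero_mul_gY hq₀, map_smul, LinearMap.smul_apply, rep_mul]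

theorem rep_d_succ_g (hq₀ : q ≠ 0) (m n : ℕ) (x : M) : ρ (dY q (m + 1)) (ρ (gY q n) x) =
    ρ (dY q m) (ρ (gY q (n + 1)) x) - q • ρ (gY q (n + 1)) (ρ (dY q m) x) +
      q⁻¹ • ρ (gY q n) (ρ (dY q (m + 1)) x) := by
  rw [← rep_mul, dY_succ_mul_gY hq₀]
  simp only [map_add, map_sub, map_smul, LinearMap.add_apply, LinearMap.sub_apply,
    LinearMap.smul_apply, rep_mul]

theorem rep_e_d_zero (hq₀ : q ≠ 0) (m : ℕ) (x : M) :
    ρ (eY q m) (ρ (dY q 0) x) = q⁻¹ • ρ (dY q 0) (ρ (eY q m) x) := by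
  rw [← rep_mul, eY_mul_dY_zero hq₀, map_smul, LinearMap.smul_apply, rep_mul]

theorem rep_e_d_succ (hq₀ : q ≠ 0) (m n : ℕ) (x : M) : ρ (eY q m) (ρ (dY q (n + 1)) x) =
    ρ (eY q (m + 1)) (ρ (dY q n) x) + q⁻¹ • ρ (dY q (n + 1)) (ρ (eY q m) x) -
      q • ρ (dY q n) (ρ (eY q (m + 1)) x) := by
  rw [← rep_mul, eY_mul_dY_succ hq₀]
  simp only [map_add, map_sub, map_smul, LinearMap.add_apply, LinearMap.sub_apply,
    LinearMap.smul_apply, rep_mul]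

theorem rep_sInv_g (hq₀ : q ≠ 0) (n : ℕ) (x : M) :
    ρ (sInvY q 1) (ρ (gY q n) x) = q • ρ (gY q n) (ρ (sInvY q 1) x) := by
  have h := rep_d_zero_g ρ hq₀ n (ρ (sInvY q 1) x)
  rw [dY, rep_s_sInv] at h
  rw [← rep_sInv_s ρ 1 (q • ρ (gY q n) (ρ (sInvY q 1) x)), map_smul, h, smul_smul,
    mul_inv_cancel₀ hq₀, one_smul]

theorem rep_b (n : ℕ) (x : M) : ρ (sY q 0 1 n) x =
    ∑ p ∈ antidiagonal n, ρ (dY q p.1) (ρ (eY q p.2) x) := by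
  rw [sY_zero_one, map_sum, LinearMap.sum_apply]
  simp only [rep_mul]

theorem rep_c (n : ℕ) (x : M) : ρ (sY q 1 0 n) x =
    ∑ p ∈ antidiagonal n, ρ (dY q p.1) (ρ (fY q p.2) x) := by
  rw [sY_one_zero, map_sum, LinearMap.sum_apply]
  simp only [rep_mul]

theorem rep_a (n : ℕ) (x : M) : ρ (sY q 0 0 n) x = ∑ p ∈ antidiagonal n,
    (ρ (dY q p.1) (ρ (hY q p.2) x) + ρ (sY q 1 0 p.1) (ρ (eY q p.2) x)) := by
  rw [sY_zero_zero, map_sum, LinearMap.sum_apply]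
  simp only [map_add, LinearMap.add_apply, rep_mul]

/-- The smallest subspace that contains `K` and is stable under the `g_n`. -/
def lowerSpan (K : Submodule ℂ M) : Submodule ℂ M :=
  sInf {N | K ≤ N ∧ ∀ n, ∀ x ∈ N, ρ (gY q n) x ∈ N}

variable {ρ}

theorem le_lowerSpan (K : Submodule ℂ M) : K ≤ lowerSpan ρ K := le_sInf fun _ h => h.1

theorem g_mem_lowerSpan {K : Submodule ℂ M} (n : ℕ) {x : M} (hx : x ∈ lowerSpan ρ K) :
    ρ (gY q n) x ∈ lowerSpan ρ K :=
  (Submodule.mem_sInf).2 fun N h => h.2 n x ((Submodule.mem_sInf).1 hx N h)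

theorem lowerSpan_le {K N : Submodule ℂ M} (h : K ≤ N) (hg : ∀ n, ∀ x ∈ N, ρ (gY q n) x ∈ N) :
    lowerSpan ρ K ≤ N := sInf_le ⟨h, hg⟩

theorem lowerSpan_induction {K : Submodule ℂ M} {C : ∀ x, x ∈ lowerSpan ρ K → Prop}
    (hK : ∀ x (hx : x ∈ K), C x (le_lowerSpan K hx))
    (hg : ∀ n x (hx : x ∈ lowerSpan ρ K), C x hx → C (ρ (gY q n) x) (g_mem_lowerSpan n hx))
    (h0 : C 0 (Submodule.zero_mem _))
    (ha : ∀ x y (hx : x ∈ lowerSpan ρ K) (hy : y ∈ lowerSpan ρ K), C x hx → C y hy →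
      C (x + y) (Submodule.add_mem _ hx hy))
    (hs : ∀ (c : ℂ) x (hx : x ∈ lowerSpan ρ K), C x hx → C (c • x) (Submodule.smul_mem _ c hx))
    {x : M} (hx : x ∈ lowerSpan ρ K) : C x hx := by
  let N : Submodule ℂ M :=
    { carrier := {x | ∃ hx : x ∈ lowerSpan ρ K, C x hx}
      add_mem' := fun hx hy => ⟨Submodule.add_mem _ hx.1 hy.1, ha _ _ _ _ hx.2 hy.2⟩
      zero_mem' := ⟨Submodule.zero_mem _, h0⟩
      smul_mem' := fun c x hx => ⟨Submodule.smul_mem _ c hx.1, hs c x _ hx.2⟩ }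
  have : lowerSpan ρ K ≤ N := lowerSpan_le (fun x hx => ⟨le_lowerSpan K hx, hK x hx⟩)
    fun n x hx => ⟨g_mem_lowerSpan n hx.1, hg n x hx.1 hx.2⟩
  exact (this hx).2

/-- The subalgebra of the elements that preserve `N`. -/
def preserving (ρ : Y q →ₐ[ℂ] Module.End ℂ M) (N : Submodule ℂ M) : Subalgebra ℂ (Y q) where
  carrier := {y | ∀ x ∈ N, ρ y x ∈ N}
  mul_mem' := fun {a b} ha hb x hx => by rw [rep_mul]; exact ha _ (hb _ hx)
  add_mem' := fun {a b} ha hb x hx => by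
    rw [map_add, LinearMap.add_apply]; exact N.add_mem (ha _ hx) (hb _ hx)
  algebraMap_mem' := fun r x hx => by
    rw [AlgHom.commutes, Module.algebraMap_end_apply]; exact N.smul_mem _ hx

/-- The h_n commute with all g_m, so the scalars by which they act on K propagate. -/
theorem h_on_lowerSpan (hq₀ : q ≠ 0) (hq : ∀ n : ℕ, 0 < n → q ^ n ≠ 1) {K : Submodule ℂ M}
    {c : ℕ → ℂ} (hh : ∀ n, ∀ x ∈ K, ρ (hY q n) x = c n • x) (n : ℕ) {x : M}
    (hx : x ∈ lowerSpan ρ K) : ρ (hY q n) x = c n • x := by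
  induction hx using lowerSpan_induction with
  | hK x hx => exact hh n x hx
  | hg m x _ h => rw [rep_h_g ρ hq₀ hq, h, map_smul]
  | h0 => simp
  | ha x y _ _ hx hy => rw [map_add, hx, hy, smul_add]
  | hs r x _ hx => rw [map_smul, hx, smul_comm]

/-- If the highest weight conditions hold on `K`, then the `g_n` generate a submodule from it. -/
theorem act_mem_lowerSpan (hq₀ : q ≠ 0) (hq : ∀ n : ℕ, 0 < n → q ^ n ≠ 1) {K : Submodule ℂ M}
    {c : ℕ → ℂ} (hc : c 0 ≠ 0) (hd : ∀ n, ∀ x ∈ K, ρ (dY q n) x ∈ K)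
    (hd' : ∀ x ∈ K, ρ (sInvY q 1) x ∈ K) (he : ∀ n, ∀ x ∈ K, ρ (eY q n) x = 0)
    (hh : ∀ n, ∀ x ∈ K, ρ (hY q n) x = c n • x) (y : Y q) {x : M} (hx : x ∈ lowerSpan ρ K) :
    ρ y x ∈ lowerSpan ρ K := by
  have Hh : ∀ n, ∀ x ∈ lowerSpan ρ K, ρ (hY q n) x = c n • x := fun n x hx =>
    h_on_lowerSpan hq₀ hq hh n hx
  have Hd : ∀ x ∈ lowerSpan ρ K, ∀ n, ρ (dY q n) x ∈ lowerSpan ρ K := by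
    intro x hx
    induction hx using lowerSpan_induction with
    | hK x hx => exact fun n => le_lowerSpan K (hd n x hx)
    | hg n x hx h =>
      intro m
      -- The index of g must stay free: `rep_d_succ_g` trades d_(m+1) g_n for d_m g_(n+1).
      induction m generalizing n with
      | zero =>
        rw [rep_d_zero_g ρ hq₀]
        exact Submodule.smul_mem _ _ (g_mem_lowerSpan _ (h 0))
      | succ m ih =>
        rw [rep_d_succ_g ρ hq₀]
        exact Submodule.add_mem _ (Submodule.sub_mem _ (ih _)
          (Submodule.smul_mem _ _ (g_mem_lowerSpan _ (h m))))
          (Submodule.smul_mem _ _ (g_mem_lowerSpan _ (h _)))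
    | h0 => simp
    | ha x y _ _ hx hy => intro n; rw [map_add]; exact Submodule.add_mem _ (hx n) (hy n)
    | hs r x _ hx => intro n; rw [map_smul]; exact Submodule.smul_mem _ _ (hx n)
  have Hd' : ∀ x ∈ lowerSpan ρ K, ρ (sInvY q 1) x ∈ lowerSpan ρ K := by
    intro x hx
    induction hx using lowerSpan_induction with
    | hK x hx => exact le_lowerSpan K (hd' x hx)
    | hg n x hx h => rw [rep_sInv_g ρ hq₀]; exact Submodule.smul_mem _ _ (g_mem_lowerSpan _ h)
    | h0 => simp
    | ha x y _ _ hx hy => rw [map_add]; exact Submodule.add_mem _ hx hy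
    | hs r x _ hx => rw [map_smul]; exact Submodule.smul_mem _ _ hx
  have He : ∀ x ∈ lowerSpan ρ K, ∀ n, ρ (eY q n) x ∈ lowerSpan ρ K := by
    intro x hx
    induction hx using lowerSpan_induction with
    | hK x hx => intro n; rw [he n x hx]; exact Submodule.zero_mem _
    | hg n x hx h =>
      intro m
      rw [rep_e_g ρ hq₀, Hh _ _ hx]
      exact Submodule.sub_mem _ (Submodule.smul_mem _ _ (Submodule.smul_mem _ _ hx))
        (g_mem_lowerSpan _ (h m))
    | h0 => simp
    | ha x y _ _ hx hy => intro n; rw [map_add]; exact Submodule.add_mem _ (hx n) (hy n)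
    | hs r x _ hx => intro n; rw [map_smul]; exact Submodule.smul_mem _ _ (hx n)
  have Hc : ∀ n, ∀ x ∈ lowerSpan ρ K, ρ (sY q 1 0 n) x ∈ lowerSpan ρ K := by
    intro n x hx
    rw [rep_c]
    refine Submodule.sum_mem _ fun p _ => Hd _ ?_ _
    rcases p with ⟨a, _ | b⟩
    · simp only [fY_zero, map_zero, LinearMap.zero_apply, Submodule.zero_mem]
    · simp only [fY_succ hq₀, map_smul, LinearMap.smul_apply]
      exact Submodule.smul_mem _ _ (g_mem_lowerSpan _ hx)
  refine subalgebra_eq_top (preserving ρ (lowerSpan ρ K)) ?_ ?_ y x hx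
  · intro i j n x hx
    fin_cases i <;> fin_cases j
    · change ρ (sY q 0 0 n) x ∈ _
      rw [rep_a]
      refine Submodule.sum_mem _ fun p _ => Submodule.add_mem _ ?_ (Hc _ _ (He _ hx _))
      rw [Hh _ _ hx]
      exact Hd _ (Submodule.smul_mem _ _ hx) _
    · change ρ (sY q 0 1 n) x ∈ _
      rw [rep_b]
      exact Submodule.sum_mem _ fun p _ => Hd _ (He _ hx _) _
    · exact Hc n x hx
    · exact Hd x hx n
  · intro i x hx
    fin_cases i
    · change ρ (sInvY q 0) x ∈ _
      -- As s_11^(0) = s_22^(0) h_0 acts as c_0 s_22^(0), its inverse is c_0⁻¹ times that of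
      -- s_22^(0); here c_0 ≠ 0 is needed.
      set y := ρ (sInvY q 1) x with hy
      have hym := Hd' x hx
      have e : ρ (sY q 0 0 0) ((c 0)⁻¹ • y) = x := by
        have h₁ := Hh 0 y hym
        rw [hY_zero, rep_mul] at h₁
        have h₂ := congrArg (ρ (sY q 1 1 0)) h₁
        rw [rep_s_sInv, map_smul, hy, rep_s_sInv] at h₂
        rw [map_smul, h₂, smul_smul, inv_mul_cancel₀ hc, one_smul]
      rw [← e, rep_sInv_s]
      exact Submodule.smul_mem _ _ hym
    · exact Hd' x hx

end Rep

/-! ## Highest weight representations -/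

section HighestWeight

open Finset.HasAntidiagonal

variable {q : ℂ} {M : Type u} [AddCommGroup M] [Module ℂ M]

/-- The eigenvectors of `d_0` for the eigenvalues `q⁻¹`, `q⁻²`, …. -/
def lowerWeight (ρ : Y q →ₐ[ℂ] Module.End ℂ M) : Set M :=
  {x | ∃ k : ℕ, ρ (dY q 0) x = (q⁻¹) ^ (k + 1) • x}

/-- A representation with a highest `ℓ`-weight vector `v` of `d_0`-weight `1`, on which `H(z)` acts
by the scalar series `h`, and that is spanned by `v` and vectors of lower weight. -/
structure IsHighestWeight (ρ : Y q →ₐ[ℂ] Module.End ℂ M) (P : M →ₗ[ℂ] M) (v : M) (h : ℂ⟦X⟧) :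
    Prop where
  act_parity : ∀ y x, ρ (parityY q y) (P x) = P (ρ y x)
  ne_zero : v ≠ 0
  parity_v : ∃ a, P v = sgn a • v
  d_v : ∀ n, ∃ c : ℂ, ρ (dY q n) v = c • v
  d_zero_v : ρ (dY q 0) v = v
  e_v : ∀ n, ρ (eY q n) v = 0
  h_act : ∀ n x, ρ (hY q n) x = PowerSeries.coeff n h • x
  h_zero : PowerSeries.coeff 0 h ≠ 0
  span_eq_top : Submodule.span ℂ (insert v (lowerWeight ρ)) = ⊤

/-- The representation is generated by `v` under the `g_n`. -/
def IsCyclicVector (ρ : Y q →ₐ[ℂ] Module.End ℂ M) (v : M) : Prop :=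
  lowerSpan ρ (ℂ ∙ v) = ⊤

/-- The common kernel of the `e_n` is spanned by `v`. -/
def IsCocyclicVector (ρ : Y q →ₐ[ℂ] Module.End ℂ M) (v : M) : Prop :=
  ∀ x, (∀ n, ρ (eY q n) x = 0) → x ∈ ℂ ∙ v

theorem odd_parity {ρ : Y q →ₐ[ℂ] Module.End ℂ M} {P : M →ₗ[ℂ] M}
    (hP : ∀ y x, ρ (parityY q y) (P x) = P (ρ y x)) {y : Y q} (hy : y ∈ gradY q 1) (x : M) :
    ρ y (P x) = -P (ρ y x) := by
  rw [← hP, mem_superPart.1 hy, sgn_one, map_smul, LinearMap.smul_apply, neg_one_smul, neg_neg]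

theorem even_parity {ρ : Y q →ₐ[ℂ] Module.End ℂ M} {P : M →ₗ[ℂ] M}
    (hP : ∀ y x, ρ (parityY q y) (P x) = P (ρ y x)) {y : Y q} (hy : y ∈ gradY q 0) (x : M) :
    ρ y (P x) = P (ρ y x) := by
  rw [← hP, mem_superPart.1 hy, sgn_zero, one_smul]

/-- Eigenspaces of d_0 are independent, and no q^(-k-1) equals the eigenvalue 1 of v because q is
not a root of unity. -/
theorem notMem_span_lowerWeight (hq : ∀ n : ℕ, 0 < n → q ^ n ≠ 1)
    {ρ : Y q →ₐ[ℂ] Module.End ℂ M} {v : M} (hv : v ≠ 0) (hd : ρ (dY q 0) v = v) :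
    v ∉ Submodule.span ℂ (lowerWeight ρ) := by
  intro hmem
  have h := (Module.End.eigenspaces_iSupIndep (ρ (dY q 0))) 1
  rw [Submodule.disjoint_def] at h
  refine hv (h v (by rw [Module.End.mem_eigenspace_iff, hd, one_smul]) ?_)
  refine (Submodule.span_le.2 ?_) hmem
  rintro x ⟨k, hk⟩
  have hne : (q⁻¹) ^ (k + 1) ≠ 1 := by
    rw [inv_pow]
    exact fun h => hq (k + 1) k.succ_pos (inv_eq_one.1 h)
  exact Submodule.mem_iSup_of_mem ((q⁻¹) ^ (k + 1))
    (Submodule.mem_iSup_of_mem hne (Module.End.mem_eigenspace_iff.2 hk))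

theorem g_mem_lowerWeight (hq₀ : q ≠ 0) {ρ : Y q →ₐ[ℂ] Module.End ℂ M} (n : ℕ) {x : M}
    (hx : x ∈ lowerWeight ρ) : ρ (gY q n) x ∈ lowerWeight ρ := by
  obtain ⟨k, hk⟩ := hx
  exact ⟨k + 1, by rw [rep_d_zero_g ρ hq₀, hk, map_smul, smul_smul, pow_succ' _ (k + 1)]⟩

theorem d_zero_g_of_fixed (hq₀ : q ≠ 0) {ρ : Y q →ₐ[ℂ] Module.End ℂ M} (n : ℕ) {x : M}
    (hx : ρ (dY q 0) x = x) : ρ (dY q 0) (ρ (gY q n) x) = q⁻¹ • ρ (gY q n) x := by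
  rw [rep_d_zero_g ρ hq₀, hx]

theorem g_mem_lowerWeight_of_fixed (hq₀ : q ≠ 0) {ρ : Y q →ₐ[ℂ] Module.End ℂ M} (n : ℕ) {x : M}
    (hx : ρ (dY q 0) x = x) : ρ (gY q n) x ∈ lowerWeight ρ :=
  ⟨0, by rw [d_zero_g_of_fixed hq₀ n hx, zero_add, pow_one]⟩

theorem map_mem_span {A : Set M} (f : Module.End ℂ M) (h : ∀ x ∈ A, f x ∈ Submodule.span ℂ A) {x : M}
    (hx : x ∈ Submodule.span ℂ A) : f x ∈ Submodule.span ℂ A := by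
  have : Submodule.span ℂ A ≤ (Submodule.span ℂ A).comap f := Submodule.span_le.2 h
  exact this hx

theorem lowerSpan_span_eq_top_span (hq₀ : q ≠ 0) {ρ : Y q →ₐ[ℂ] Module.End ℂ M} {v : M}
    (hd : ρ (dY q 0) v = v) (h : lowerSpan ρ (ℂ ∙ v) = ⊤) :
    Submodule.span ℂ (insert v (lowerWeight ρ)) = ⊤ := by
  rw [eq_top_iff, ← h]
  refine lowerSpan_le (Submodule.span_mono (by simp)) fun n x hx => ?_
  refine map_mem_span _ ?_ hx
  rintro y (rfl | hy)
  · exact Submodule.subset_span (Or.inr (g_mem_lowerWeight_of_fixed hq₀ n hd))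
  · exact Submodule.subset_span (Or.inr (g_mem_lowerWeight hq₀ n hy))

theorem d_mem_lowerWeight (hq₀ : q ≠ 0) {ρ : Y q →ₐ[ℂ] Module.End ℂ M} (n : ℕ) {x : M}
    (hx : x ∈ lowerWeight ρ) : ρ (dY q n) x ∈ lowerWeight ρ := by
  obtain ⟨k, hk⟩ := hx
  exact ⟨k, by rw [rep_d_d ρ hq₀, hk, map_smul]⟩

theorem sInv_mem_lowerWeight {ρ : Y q →ₐ[ℂ] Module.End ℂ M} {x : M}
    (hx : x ∈ lowerWeight ρ) : ρ (sInvY q 1) x ∈ lowerWeight ρ := by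
  obtain ⟨k, hk⟩ := hx
  refine ⟨k, ?_⟩
  rw [← map_smul, ← hk, dY, rep_sInv_s, rep_s_sInv]

theorem parity_mem_lowerWeight {ρ : Y q →ₐ[ℂ] Module.End ℂ M} {P : M →ₗ[ℂ] M}
    (hP : ∀ y x, ρ (parityY q y) (P x) = P (ρ y x)) {x : M}
    (hx : x ∈ lowerWeight ρ) : P x ∈ lowerWeight ρ := by
  obtain ⟨k, hk⟩ := hx
  exact ⟨k, by rw [even_parity hP (dY_mem q 0), hk, map_smul]⟩

/-- The vectors of lower weight killed by the `e_n`. -/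
def lowerKernel (ρ : Y q →ₐ[ℂ] Module.End ℂ M) : Submodule ℂ M :=
  Submodule.span ℂ (lowerWeight ρ) ⊓ ⨅ n, LinearMap.ker (ρ (eY q n))

theorem mem_lowerKernel {ρ : Y q →ₐ[ℂ] Module.End ℂ M} {x : M} : x ∈ lowerKernel ρ ↔
    x ∈ Submodule.span ℂ (lowerWeight ρ) ∧ ∀ n, ρ (eY q n) x = 0 := by
  simp [lowerKernel, Submodule.mem_iInf]

/-- The commutation relation rewrites e_m d_(n+1) as terms ending in some e plus e_(m+1) d_n, so
induction on n applies. -/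
theorem d_mem_lowerKernel (hq₀ : q ≠ 0) {ρ : Y q →ₐ[ℂ] Module.End ℂ M} (n : ℕ) {x : M}
    (hx : x ∈ lowerKernel ρ) : ρ (dY q n) x ∈ lowerKernel ρ := by
  rw [mem_lowerKernel] at hx ⊢
  refine ⟨map_mem_span _ (fun y hy => Submodule.subset_span (d_mem_lowerWeight hq₀ n hy)) hx.1, ?_⟩
  induction n with
  | zero => intro m; rw [rep_e_d_zero ρ hq₀, hx.2, map_zero, smul_zero]
  | succ n ih =>
    intro m
    rw [rep_e_d_succ ρ hq₀, ih, hx.2, hx.2, map_zero, map_zero, smul_zero, smul_zero, add_zero,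
      sub_zero]

theorem sInv_mem_lowerKernel (hq₀ : q ≠ 0) {ρ : Y q →ₐ[ℂ] Module.End ℂ M} {x : M}
    (hx : x ∈ lowerKernel ρ) : ρ (sInvY q 1) x ∈ lowerKernel ρ := by
  rw [mem_lowerKernel] at hx ⊢
  refine ⟨map_mem_span _ (fun y hy => Submodule.subset_span (sInv_mem_lowerWeight hy)) hx.1,
    fun m => ?_⟩
  have h := rep_e_d_zero ρ hq₀ m (ρ (sInvY q 1) x)
  rw [dY, rep_s_sInv, hx.2, eq_comm, smul_eq_zero] at h
  have h := h.resolve_left (inv_ne_zero hq₀)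
  rw [← rep_sInv_s ρ 1 (ρ (eY q m) _), h, map_zero]

theorem parity_mem_lowerSpan {ρ : Y q →ₐ[ℂ] Module.End ℂ M} {P : M →ₗ[ℂ] M}
    (hP : ∀ y x, ρ (parityY q y) (P x) = P (ρ y x)) {K : Submodule ℂ M} (hK : ∀ x ∈ K, P x ∈ K)
    {x : M} (hx : x ∈ lowerSpan ρ K) : P x ∈ lowerSpan ρ K := by
  induction hx using lowerSpan_induction with
  | hK x hx => exact le_lowerSpan K (hK x hx)
  | hg n x hx h =>
    rw [← neg_mem_iff, ← odd_parity hP (gY_mem q n)]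
    exact g_mem_lowerSpan n h
  | h0 => simp
  | ha x y _ _ hx hy => rw [map_add]; exact Submodule.add_mem _ hx hy
  | hs r x _ hx => rw [map_smul]; exact Submodule.smul_mem _ _ hx

theorem parity_mem_lowerKernel {ρ : Y q →ₐ[ℂ] Module.End ℂ M} {P : M →ₗ[ℂ] M}
    (hP : ∀ y x, ρ (parityY q y) (P x) = P (ρ y x)) {x : M} (hx : x ∈ lowerKernel ρ) :
    P x ∈ lowerKernel ρ := by
  rw [mem_lowerKernel] at hx ⊢
  refine ⟨map_mem_span _ (fun y hy => Submodule.subset_span (parity_mem_lowerWeight hP hy)) hx.1,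
    fun n => ?_⟩
  rw [odd_parity hP (eY_mem q n), hx.2, map_zero, neg_zero]

/-- The g_n lower the weight, so the submodule generated by `lowerKernel` never reaches v. -/
theorem lowerSpan_lowerKernel_le (hq₀ : q ≠ 0) {ρ : Y q →ₐ[ℂ] Module.End ℂ M} :
    lowerSpan ρ (lowerKernel ρ) ≤ Submodule.span ℂ (lowerWeight ρ) :=
  lowerSpan_le inf_le_left fun n _ hx =>
    map_mem_span _ (fun _ hy => Submodule.subset_span (g_mem_lowerWeight hq₀ n hy)) hx

namespace IsHighestWeight

variable {ρ : Y q →ₐ[ℂ] Module.End ℂ M} {P : M →ₗ[ℂ] M} {v : M} {h : ℂ⟦X⟧}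

theorem act_mem_lowerSpan_lowerKernel (H : IsHighestWeight ρ P v h) (hq₀ : q ≠ 0)
    (hq : ∀ n : ℕ, 0 < n → q ^ n ≠ 1) (y : Y q) {x : M} (hx : x ∈ lowerSpan ρ (lowerKernel ρ)) :
    ρ y x ∈ lowerSpan ρ (lowerKernel ρ) :=
  act_mem_lowerSpan hq₀ hq H.h_zero (fun n _ hx => d_mem_lowerKernel hq₀ n hx)
    (fun _ hx => sInv_mem_lowerKernel hq₀ hx) (fun n _ hx => (mem_lowerKernel.1 hx).2 n)
    (fun n x _ => H.h_act n x) y hx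

theorem parity_mem_lowerSpan_span (H : IsHighestWeight ρ P v h) {x : M}
    (hx : x ∈ lowerSpan ρ (ℂ ∙ v)) : P x ∈ lowerSpan ρ (ℂ ∙ v) := by
  refine parity_mem_lowerSpan H.act_parity (fun x hx => ?_) hx
  obtain ⟨c, rfl⟩ := Submodule.mem_span_singleton.1 hx
  obtain ⟨a, ha⟩ := H.parity_v
  rw [map_smul, ha]
  exact Submodule.smul_mem _ _ (Submodule.smul_mem _ _ (Submodule.mem_span_singleton_self v))

/-- Subtract the component along v: the remainder has lower weight and is still killed by the e_n.
-/
theorem isCocyclicVector_of_lowerKernel (H : IsHighestWeight ρ P v h) (hK : lowerKernel ρ = ⊥) :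
    IsCocyclicVector ρ v := by
  intro x hx
  have hm : x ∈ Submodule.span ℂ (insert v (lowerWeight ρ)) := by
    rw [H.span_eq_top]; trivial
  obtain ⟨c, t, ht, rfl⟩ := Submodule.mem_span_insert.1 hm
  have : t ∈ lowerKernel ρ := mem_lowerKernel.2 ⟨ht, fun n => by
    have := hx n
    rwa [map_add, map_smul, H.e_v, smul_zero, zero_add] at this⟩
  rw [hK, Submodule.mem_bot] at this
  rw [this, add_zero]
  exact Submodule.smul_mem _ _ (Submodule.mem_span_singleton_self v)

/-- The linear form that is `1` on `v` and vanishes on the lower weight spaces. -/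
theorem exists_counit (H : IsHighestWeight ρ P v h) (hq₀ : q ≠ 0)
    (hq : ∀ n : ℕ, 0 < n → q ^ n ≠ 1) :
    ∃ (ε : M →ₗ[ℂ] ℂ) (σ : ℂ), ε v = 1 ∧ (∀ x ∈ lowerWeight ρ, ε x = 0) ∧
      (∀ n x, ε (ρ (gY q n) x) = 0) ∧ σ ≠ 0 ∧ P v = σ • v ∧ ∀ x, ε (P x) = σ * ε x := by
  obtain ⟨ε₀, h₁, h₂⟩ := Submodule.exists_le_ker_of_notMem (notMem_span_lowerWeight hq H.ne_zero H.d_zero_v)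
  set ε : M →ₗ[ℂ] ℂ := (ε₀ v)⁻¹ • ε₀ with hε
  have e₁ : ε v = 1 := by simp [hε, inv_mul_cancel₀ h₁]
  have e₂ : ∀ x ∈ lowerWeight ρ, ε x = 0 := fun x hx => by
    have : ε₀ x = 0 := h₂ (Submodule.subset_span hx)
    simp [hε, this]
  obtain ⟨a, ha⟩ := H.parity_v
  have ext : ∀ f g : M →ₗ[ℂ] ℂ, f v = g v → (∀ x ∈ lowerWeight ρ, f x = g x) → f = g := by
    intro f g hv hl
    refine LinearMap.ext_on H.span_eq_top ?_
    rintro x (rfl | hx)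
    · exact hv
    · exact hl x hx
  refine ⟨ε, sgn a, e₁, e₂, fun n x => ?_, ?_, ha, fun x => ?_⟩
  · have : ε ∘ₗ ρ (gY q n) = 0 := ext _ _
      (by simpa using e₂ _ (g_mem_lowerWeight_of_fixed hq₀ n H.d_zero_v))
      (fun x hx => by simpa using e₂ _ (g_mem_lowerWeight hq₀ n hx))
    exact LinearMap.congr_fun this x
  · intro h0
    have := sgn_mul_self a
    rw [h0] at this
    simp at this
  · have : ε ∘ₗ P = sgn a • ε := ext _ _ (by simp [ha]) (fun x hx => by
      simp [e₂ x hx, e₂ _ (parity_mem_lowerWeight H.act_parity hx)])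
    exact LinearMap.congr_fun this x

end IsHighestWeight

end HighestWeight

/-! ### Submodules of a highest weight module. -/

namespace YModule

variable {q : ℂ} {T : YModule.{u} q} {v : T} {h : ℂ⟦X⟧}

/-- The line of v is stable under the d_n and s_22^(0)⁻¹ and is killed by the e_n, so by
`act_mem_lowerSpan` the g_n alone produce everything. -/
theorem generated_eq_lowerSpan (hq₀ : q ≠ 0) (hq : ∀ n : ℕ, 0 < n → q ^ n ≠ 1)
    (H : IsHighestWeight T.act T.parity v h) : T.generated v = lowerSpan T.act (ℂ ∙ v) := by
  apply le_antisymm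
  · rintro _ ⟨y, rfl⟩
    refine act_mem_lowerSpan hq₀ hq H.h_zero ?_ ?_ ?_ (fun n x _ => H.h_act n x) y
      (le_lowerSpan _ (Submodule.mem_span_singleton_self v))
    · intro n x hx
      obtain ⟨c, rfl⟩ := Submodule.mem_span_singleton.1 hx
      obtain ⟨b, hb⟩ := H.d_v n
      rw [map_smul, hb]
      exact Submodule.smul_mem _ _ (Submodule.smul_mem _ _ (Submodule.mem_span_singleton_self v))
    · intro x hx
      obtain ⟨c, rfl⟩ := Submodule.mem_span_singleton.1 hx
      have : T.act (sInvY q 1) v = v := by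
        conv_lhs => rw [← H.d_zero_v, dY]
        exact rep_sInv_s T.act 1 v
      rw [map_smul, this]
      exact Submodule.smul_mem _ _ (Submodule.mem_span_singleton_self v)
    · intro n x hx
      obtain ⟨c, rfl⟩ := Submodule.mem_span_singleton.1 hx
      rw [map_smul, H.e_v, smul_zero]
  · refine lowerSpan_le ?_ ?_
    · rw [Submodule.span_singleton_le_iff_mem]
      exact ⟨1, by simp⟩
    · rintro n _ ⟨y, rfl⟩
      exact ⟨gY q n * y, by simp⟩

theorem isSub_generated (hq₀ : q ≠ 0) (hq : ∀ n : ℕ, 0 < n → q ^ n ≠ 1)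
    (H : IsHighestWeight T.act T.parity v h) : T.IsSub (T.generated v) := by
  constructor
  · rw [generated_eq_lowerSpan hq₀ hq H]
    exact fun x hx => H.parity_mem_lowerSpan_span hx
  · rintro y _ ⟨z, rfl⟩
    exact ⟨y * z, by simp⟩

theorem mem_generated_self (v : T) : v ∈ T.generated v := ⟨1, by simp⟩

theorem isSub_lowerSpan_lowerKernel (hq₀ : q ≠ 0) (hq : ∀ n : ℕ, 0 < n → q ^ n ≠ 1)
    (H : IsHighestWeight T.act T.parity v h) : T.IsSub (lowerSpan T.act (lowerKernel T.act)) :=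
  ⟨fun _ hx => parity_mem_lowerSpan H.act_parity
      (fun _ hx => parity_mem_lowerKernel H.act_parity hx) hx,
    fun y _ hx => H.act_mem_lowerSpan_lowerKernel hq₀ hq y hx⟩

/-- The submodule generated by `lowerKernel` lies in the lower weights and so misses v; by
simplicity it is zero. -/
theorem isCocyclicVector_of_isSimple (hq₀ : q ≠ 0) (hq : ∀ n : ℕ, 0 < n → q ^ n ≠ 1)
    (H : IsHighestWeight T.act T.parity v h) (hT : T.IsSimple) : IsCocyclicVector T.act v := by
  refine H.isCocyclicVector_of_lowerKernel ?_
  rcases hT.2.2 _ (isSub_lowerSpan_lowerKernel hq₀ hq H) le_top with h0 | h0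
  · rw [eq_bot_iff, ← h0]
    exact le_lowerSpan _
  · refine absurd ?_ (notMem_span_lowerWeight hq H.ne_zero H.d_zero_v)
    refine lowerSpan_lowerKernel_le hq₀ ?_
    rw [h0]
    trivial

/-- A non-zero submodule contains a non-zero vector killed by the `e_n`. -/
theorem exists_ne_zero_of_isSub (hq₀ : q ≠ 0) (hq : ∀ n : ℕ, 0 < n → q ^ n ≠ 1)
    (H : IsHighestWeight T.act T.parity v h) {N : Submodule ℂ T} (hN : T.IsSub N) (h0 : N ≠ ⊥) :
    ∃ x ∈ N, x ≠ 0 ∧ ∀ n, T.act (eY q n) x = 0 := by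
  obtain ⟨x, hx, hx0⟩ := Submodule.exists_mem_ne_zero_of_ne_bot h0
  -- The eigenspace of d_0 for the eigenvalue 1 is the line of v.
  have hfix : ∀ x, T.act (dY q 0) x = x → x ∈ ℂ ∙ v := by
    intro x hx
    have hm : x ∈ Submodule.span ℂ (insert v (lowerWeight T.act)) := by
      rw [H.span_eq_top]; trivial
    obtain ⟨c, t, ht, rfl⟩ := Submodule.mem_span_insert.1 hm
    rw [map_add, map_smul, H.d_zero_v, add_right_inj] at hx
    have ht0 : t = 0 := by
      by_contra hne
      exact notMem_span_lowerWeight hq hne hx ht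
    rw [ht0, add_zero]
    exact Submodule.smul_mem _ _ (Submodule.mem_span_singleton_self v)
  -- Each e_n multiplies the d_0-eigenvalue by q, so it lowers the level k of the filtration.
  -- Starting from a non-zero vector of N, applying e's as long as the result is non-zero must stop
  -- at a vector killed by all of them.
  let L : ℕ → Set T := fun k => {x | ∃ i < k, T.act (dY q 0) x = (q⁻¹) ^ (i + 1) • x}
  have hL : ∀ k, L k ⊆ L (k + 1) := fun k x ⟨i, hi, h⟩ => ⟨i, by omega, h⟩
  have hLm : Monotone L := monotone_nat_of_le_succ hL
  have hF : ∀ k n, ∀ x ∈ Submodule.span ℂ (insert v (L (k + 1))),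
      T.act (eY q n) x ∈ Submodule.span ℂ (insert v (L k)) := by
    intro k n x hx
    have hle : Submodule.span ℂ (insert v (L (k + 1))) ≤
        (Submodule.span ℂ (insert v (L k))).comap (T.act (eY q n)) := by
      refine Submodule.span_le.2 ?_
      rintro y (rfl | ⟨i, hi, hy⟩)
      · simp [H.e_v]
      · have hd : T.act (dY q 0) (T.act (eY q n) y) = (q⁻¹) ^ i • T.act (eY q n) y := by
          have := rep_e_d_zero T.act hq₀ n y
          rw [hy, map_smul, pow_succ', mul_smul] at this
          exact (smul_right_injective _ (inv_ne_zero hq₀) this).symm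
        rcases i with _ | i
        · rw [pow_zero, one_smul] at hd
          exact Submodule.span_mono (by simp) (hfix _ hd)
        · exact Submodule.subset_span (Or.inr ⟨i, by omega, hd⟩)
    exact hle hx
  have hex : ∃ k, x ∈ Submodule.span ℂ (insert v (L k)) := by
    have hdir : Directed (· ≤ ·) fun k => Submodule.span ℂ (insert v (L k)) :=
      Monotone.directed_le fun _ _ hab =>
        Submodule.span_mono (Set.insert_subset_insert (hLm hab))
    rw [← Submodule.mem_iSup_of_directed _ hdir]
    have hm : x ∈ Submodule.span ℂ (insert v (lowerWeight T.act)) := by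
      rw [H.span_eq_top]; trivial
    refine (Submodule.span_le.2 ?_) hm
    rintro y (rfl | ⟨i, hi⟩)
    · exact Submodule.mem_iSup_of_mem 0 (Submodule.subset_span (Or.inl rfl))
    · exact Submodule.mem_iSup_of_mem (i + 1)
        (Submodule.subset_span (Or.inr ⟨i, Nat.lt_succ_self i, hi⟩))
  obtain ⟨k, hk⟩ := hex
  induction k generalizing x with
  | zero =>
    refine ⟨x, hx, hx0, fun n => ?_⟩
    have hx' : x ∈ ℂ ∙ v := by
      refine (Submodule.span_le.2 ?_) hk
      rintro y (rfl | ⟨i, hi, _⟩)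
      · exact Submodule.mem_span_singleton_self _
      · exact absurd hi (Nat.not_lt_zero i)
    obtain ⟨c, rfl⟩ := Submodule.mem_span_singleton.1 hx'
    rw [map_smul, H.e_v, smul_zero]
  | succ k ih =>
    by_cases h1 : ∀ n, T.act (eY q n) x = 0
    · exact ⟨x, hx, hx0, h1⟩
    · push Not at h1
      obtain ⟨n, hn⟩ := h1
      exact ih (T.act (eY q n) x) (hN.2 _ _ hx) hn (hF k n x hk)

/-- `Y v` is the unique simple submodule if and only if `v` spans the kernel of the `e_n`. -/
theorem isSimpleSub_generated_iff (hq₀ : q ≠ 0) (hq : ∀ n : ℕ, 0 < n → q ^ n ≠ 1)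
    (H : IsHighestWeight T.act T.parity v h) [FiniteDimensional ℂ T] :
    (T.IsSimpleSub (T.generated v) ∧ ∀ W : Submodule ℂ T, T.IsSimpleSub W → W = T.generated v) ↔
      IsCocyclicVector T.act v := by
  constructor
  · rintro ⟨-, huniq⟩
    refine H.isCocyclicVector_of_lowerKernel ?_
    by_contra hK
    -- If `lowerKernel` were non-zero, the submodule it generates would contain a minimal, hence
    -- simple, one. By uniqueness this would be Yv, although it misses v.
    let S : Set (Submodule ℂ T) :=
      {W | T.IsSub W ∧ W ≠ ⊥ ∧ W ≤ lowerSpan T.act (lowerKernel T.act)}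
    have hS : S.Nonempty := ⟨lowerSpan T.act (lowerKernel T.act),
      isSub_lowerSpan_lowerKernel hq₀ hq H, fun h => hK (eq_bot_iff.2 (h ▸ le_lowerSpan _)), le_rfl⟩
    obtain ⟨W, ⟨hW₁, hW₂, hW₃⟩, hmin⟩ := wellFounded_lt.has_min S hS
    have hW : T.IsSimpleSub W := by
      refine ⟨hW₁, hW₂, fun W' hW' hle => ?_⟩
      by_contra! hne
      exact hmin W' ⟨hW', hne.1, hle.trans hW₃⟩ (lt_of_le_of_ne hle hne.2)
    have hv : v ∈ W := by
      rw [huniq W hW]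
      exact mem_generated_self v
    exact notMem_span_lowerWeight hq H.ne_zero H.d_zero_v
      (lowerSpan_lowerKernel_le hq₀ (hW₃ hv))
  · intro hc
    -- A non-zero submodule contains a non-zero vector killed by the e_n, here a multiple of v; so
    -- Yv is the smallest non-zero submodule.
    have key : ∀ N : Submodule ℂ T, T.IsSub N → N ≠ ⊥ → T.generated v ≤ N := by
      intro N hN h0
      obtain ⟨x, hx, hx0, hex⟩ := exists_ne_zero_of_isSub hq₀ hq H hN h0
      obtain ⟨c, rfl⟩ := Submodule.mem_span_singleton.1 (hc x hex)
      have hc0 : c ≠ 0 := fun h => hx0 (by rw [h, zero_smul])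
      have hv : v ∈ N := by
        have := N.smul_mem c⁻¹ hx
        rwa [smul_smul, inv_mul_cancel₀ hc0, one_smul] at this
      rintro _ ⟨y, rfl⟩
      exact hN.2 y v hv
    have hne : T.generated v ≠ ⊥ := fun h => H.ne_zero (by
      have := mem_generated_self v
      rwa [h, Submodule.mem_bot] at this)
    refine ⟨⟨isSub_generated hq₀ hq H, hne, fun W' hW' hle => ?_⟩, fun W hW => ?_⟩
    · by_cases h0 : W' = ⊥
      · exact Or.inl h0
      · exact Or.inr (le_antisymm hle (key W' hW' h0))
    · rcases hW.2.2 _ (isSub_generated hq₀ hq H) (key W hW.1 hW.2.1) with h0 | h0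
      · exact absurd h0 hne
      · exact h0.symm

theorem isSimple_iff (hq₀ : q ≠ 0) (hq : ∀ n : ℕ, 0 < n → q ^ n ≠ 1)
    (H : IsHighestWeight T.act T.parity v h) : T.IsSimple ↔ T.generated v = ⊤ ∧
      T.IsSimpleSub (T.generated v) ∧ ∀ W : Submodule ℂ T, T.IsSimpleSub W → W = T.generated v := by
  constructor
  · intro hT
    have e : T.generated v = ⊤ := by
      refine (hT.2.2 _ (isSub_generated hq₀ hq H) le_top).resolve_left fun h => H.ne_zero ?_
      have := mem_generated_self v
      rwa [h, Submodule.mem_bot] at this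
    rw [e]
    exact ⟨rfl, hT, fun W hW => (hT.2.2 W hW.1 le_top).resolve_left hW.2.1⟩
  · rintro ⟨e, hs, -⟩
    rw [e] at hs
    exact hs

end YModule

/-! ## The simple modules attached to rational functions -/

section Rational

open Finset.HasAntidiagonal

variable {q : ℂ} {M : Type u} [AddCommGroup M] [Module ℂ M]

/-- The linear forms that only see `g_m v`. -/
def lowerForms (ρ : Y q →ₐ[ℂ] Module.End ℂ M) (v : M) : Submodule ℂ (M →ₗ[ℂ] ℂ) where
  carrier := {φ | φ v = 0 ∧ ∀ m n x, φ (ρ (gY q m) (ρ (gY q n) x)) = 0}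
  add_mem' := fun ha hb => ⟨by simp [ha.1, hb.1], fun m n x => by simp [ha.2, hb.2]⟩
  zero_mem' := ⟨rfl, fun _ _ _ => rfl⟩
  smul_mem' := fun c _ ha => ⟨by simp [ha.1], fun m n x => by simp [ha.2]⟩

/-- The vectors of weight `q⁻¹` that the `e_n` map to multiples of `v`. -/
def firstLevel (ρ : Y q →ₐ[ℂ] Module.End ℂ M) (v : M) : Submodule ℂ M where
  carrier := {x | ρ (dY q 0) x = q⁻¹ • x ∧ ∀ n, ρ (eY q n) x ∈ ℂ ∙ v}
  add_mem' := fun ha hb => ⟨by rw [map_add, ha.1, hb.1, smul_add], fun n => by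
    rw [map_add]; exact Submodule.add_mem _ (ha.2 n) (hb.2 n)⟩
  zero_mem' := ⟨by simp, fun n => by simp⟩
  smul_mem' := fun c _ ha => ⟨by rw [map_smul, ha.1, smul_comm], fun n => by
    rw [map_smul]; exact Submodule.smul_mem _ _ (ha.2 n)⟩

/-- A finite-dimensional representation with highest weight `h = p / Q`, whose matrix coefficients
are rational functions with denominator `Q` and numerators of degree less than `n`, and with enough
linear forms and vectors next to `v`. -/
structure IsRational (ρ : Y q →ₐ[ℂ] Module.End ℂ M) (v : M) (h : ℂ⟦X⟧) (p Q : Polynomial ℂ)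
    (n : ℕ) : Prop where
  finite : FiniteDimensional ℂ M
  mul_eq : h * (Q : ℂ⟦X⟧) = p
  Q_zero : Q.coeff 0 ≠ 0
  p_zero : p.coeff 0 ≠ 0
  p_le : p.natDegree ≤ n
  Q_le : Q.natDegree ≤ n
  e_rec : IsRec Q n fun m => ρ (eY q m)
  g_rec : IsRec Q n fun m => ρ (gY q m)
  le_forms : n ≤ Module.finrank ℂ (lowerForms ρ v)
  le_level : n ≤ Module.finrank ℂ (firstLevel ρ v)

theorem IsRational.Q_ne_zero {ρ : Y q →ₐ[ℂ] Module.End ℂ M} {v : M} {h : ℂ⟦X⟧}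
    {p Q : Polynomial ℂ} {n : ℕ} (H : IsRational ρ v h p Q n) : Q ≠ 0 := fun h0 =>
  H.Q_zero (by rw [h0, Polynomial.coeff_zero])

theorem IsRational.p_ne_zero {ρ : Y q →ₐ[ℂ] Module.End ℂ M} {v : M} {h : ℂ⟦X⟧}
    {p Q : Polynomial ℂ} {n : ℕ} (H : IsRational ρ v h p Q n) : p ≠ 0 := fun h0 =>
  H.p_zero (by rw [h0, Polynomial.coeff_zero])

variable {ρ : Y q →ₐ[ℂ] Module.End ℂ M} {P : M →ₗ[ℂ] M} {v : M} {h : ℂ⟦X⟧}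
  {p Q : Polynomial ℂ} {n : ℕ}

theorem isRec_end_iff {s : ℕ → Module.End ℂ M} :
    IsRec Q n s ↔ ∀ x, IsRec Q n fun m => s m x := by
  constructor
  · exact fun hs x => hs.map (LinearMap.applyₗ x)
  · intro hs j
    refine LinearMap.ext fun x => ?_
    simpa [LinearMap.sum_apply] using hs x j

/-- B = DE is a triangular system for the e_n v whose diagonal term d_0 is invertible. -/
theorem e_eq_zero_of_b_eq_zero (hb : ∀ n, ρ (sY q 0 1 n) v = 0) (n : ℕ) : ρ (eY q n) v = 0 := by
  induction n using Nat.strong_induction_on with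
  | _ n ih =>
    have h := hb n
    rw [rep_b, Finset.sum_eq_single (0, n)] at h
    · rw [← rep_sInv_s ρ 1 (ρ (eY q n) v)]
      exact (congrArg _ h).trans (map_zero _)
    · rintro ⟨a, b⟩ hab hne
      rw [Finset.HasAntidiagonal.mem_antidiagonal] at hab
      rw [Ne, Prod.ext_iff] at hne
      simp only at hab hne ⊢
      rw [ih b (by omega), map_zero]
    · simp

theorem cyclic_induction (hcyc : IsCyclicVector ρ v) (N : Submodule ℂ M) (hv : v ∈ N)
    (hg : ∀ n, ∀ x ∈ N, ρ (gY q n) x ∈ N) (x : M) : x ∈ N := by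
  have : lowerSpan ρ (ℂ ∙ v) ≤ N :=
    lowerSpan_le ((Submodule.span_singleton_le_iff_mem _ _).2 hv) hg
  rw [hcyc] at this
  exact this trivial

/-- The combination of e's in question kills v. Moving it past g_l produces only a multiple of the
same combination of coefficients of h, which is zero, so its kernel is stable under the g_l. -/
theorem e_rec_of_cyclic (hq₀ : q ≠ 0) (H : IsHighestWeight ρ P v h) (hcyc : IsCyclicVector ρ v)
    (hr : ∀ l, IsRec Q n fun m => PowerSeries.coeff (m + l + 1) h) :
    IsRec Q n fun m => ρ (eY q m) := by
  intro j
  refine LinearMap.ext fun x => ?_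
  refine cyclic_induction hcyc
    (LinearMap.ker (∑ x ∈ antidiagonal n, Q.coeff x.1 • ρ (eY q (x.2 + j)))) ?_ ?_ x
  · simp [H.e_v]
  · intro l x hx
    rw [LinearMap.mem_ker, LinearMap.sum_apply] at hx ⊢
    simp only [LinearMap.smul_apply] at hx ⊢
    simp only [rep_e_g ρ hq₀, H.h_act, smul_sub, Finset.sum_sub_distrib, ← map_smul (ρ (gY q l)),
      ← map_sum (ρ (gY q l)), hx, map_zero, sub_zero]
    have := hr l j
    simp only [smul_smul, ← Finset.sum_smul]
    convert zero_smul ℂ x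
    rw [← mul_zero (kap q), ← this, Finset.mul_sum]
    exact Finset.sum_congr rfl fun _ _ => by rw [smul_eq_mul]; ring

/-- Applied to v, the combination gives a vector killed by all e_m, hence a multiple of v by
cocyclicity. It also has weight q⁻¹, so it is zero. Anticommutation of the g's carries the relation
from v to the whole module. -/
theorem g_rec_of_cyclic (hq₀ : q ≠ 0) (hq : ∀ n : ℕ, 0 < n → q ^ n ≠ 1)
    (H : IsHighestWeight ρ P v h) (hcyc : IsCyclicVector ρ v) (hcoc : IsCocyclicVector ρ v)
    (hr : ∀ l, IsRec Q n fun m => PowerSeries.coeff (m + l + 1) h) :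
    IsRec Q n fun m => ρ (gY q m) := by
  intro j
  refine LinearMap.ext fun x => ?_
  refine cyclic_induction hcyc
    (LinearMap.ker (∑ x ∈ antidiagonal n, Q.coeff x.1 • ρ (gY q (x.2 + j)))) ?_ ?_ x
  · rw [LinearMap.mem_ker, LinearMap.sum_apply]
    simp only [LinearMap.smul_apply]
    set y := ∑ x ∈ antidiagonal n, Q.coeff x.1 • ρ (gY q (x.2 + j)) v with hy
    have h₁ : y ∈ ℂ ∙ v := by
      refine hcoc _ fun m => ?_
      rw [hy, map_sum]
      simp only [map_smul, rep_e_g ρ hq₀, H.h_act, H.e_v, map_zero, sub_zero]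
      have := hr m j
      simp only [smul_smul, ← Finset.sum_smul]
      convert zero_smul ℂ v
      rw [← mul_zero (kap q), ← this, Finset.mul_sum]
      refine Finset.sum_congr rfl fun x _ => ?_
      rw [show m + (x.2 + j) + 1 = x.2 + j + m + 1 by ring, smul_eq_mul]
      ring
    have h₂ : y ∈ Submodule.span ℂ (lowerWeight ρ) := Submodule.sum_mem _ fun x _ =>
      Submodule.smul_mem _ _ (Submodule.subset_span (g_mem_lowerWeight_of_fixed hq₀ _ H.d_zero_v))
    obtain ⟨c, hc⟩ := Submodule.mem_span_singleton.1 h₁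
    by_contra h0
    have hc0 : c ≠ 0 := fun h => h0 (by rw [← hc, h, zero_smul])
    refine notMem_span_lowerWeight hq H.ne_zero H.d_zero_v ?_
    rw [← hc] at h₂
    exact (Submodule.smul_mem_iff _ hc0).1 h₂
  · intro l x hx
    rw [LinearMap.mem_ker, LinearMap.sum_apply] at hx ⊢
    simp only [LinearMap.smul_apply] at hx ⊢
    simp only [rep_g_g ρ hq₀ hq _ l, smul_neg, Finset.sum_neg_distrib, ← map_smul (ρ (gY q l)),
      ← map_sum (ρ (gY q l)), hx, map_zero, neg_zero]

/-- The span of the products of distinct `g_i`, `i < j`, applied to `v`. -/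
def lowerFlag (ρ : Y q →ₐ[ℂ] Module.End ℂ M) (v : M) : ℕ → Submodule ℂ M
  | 0 => ℂ ∙ v
  | j + 1 => lowerFlag ρ v j ⊔ (lowerFlag ρ v j).map (ρ (gY q j))

theorem finiteDimensional_lowerFlag (ρ : Y q →ₐ[ℂ] Module.End ℂ M) (v : M) (j : ℕ) :
    FiniteDimensional ℂ (lowerFlag ρ v j) := by
  induction j with
  | zero => rw [lowerFlag]; infer_instance
  | succ j ih => rw [lowerFlag]; infer_instance

/-- A new factor can be sorted into place up to sign, and a repeated one gives g_j² = 0. -/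
theorem g_mem_lowerFlag (hq₀ : q ≠ 0) (hq : ∀ n : ℕ, 0 < n → q ^ n ≠ 1) (j i : ℕ) (hi : i < j)
    {x : M} (hx : x ∈ lowerFlag ρ v j) : ρ (gY q i) x ∈ lowerFlag ρ v j := by
  induction j generalizing i x with
  | zero => omega
  | succ j ih =>
    rw [lowerFlag] at hx ⊢
    obtain ⟨y, hy, _, ⟨z, hz, rfl⟩, rfl⟩ := Submodule.mem_sup.1 hx
    rw [map_add]
    have hsq : ρ (gY q j) (ρ (gY q j) z) = 0 := by
      have := rep_g_g ρ hq₀ hq j j z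
      rw [eq_neg_iff_add_eq_zero, ← two_smul ℂ, smul_eq_zero] at this
      exact this.resolve_left two_ne_zero
    rcases Nat.lt_succ_iff_lt_or_eq.1 hi with hi | rfl
    · rw [rep_g_g ρ hq₀ hq i j]
      exact Submodule.add_mem _ (Submodule.mem_sup_left (ih i hi hy))
        (Submodule.neg_mem _ (Submodule.mem_sup_right ⟨_, ih i hi hz, rfl⟩))
    · rw [hsq, add_zero]
      exact Submodule.mem_sup_right ⟨y, hy, rfl⟩

/-- Since Q(0) ≠ 0, the recurrence expresses g_m for m ≥ n through g's of smaller index, so the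
products of g_0, …, g_(n-1) applied to v span everything. -/
theorem finiteDimensional_of_cyclic (hq₀ : q ≠ 0) (hq : ∀ n : ℕ, 0 < n → q ^ n ≠ 1)
    (hcyc : IsCyclicVector ρ v) (hQ : Q.coeff 0 ≠ 0) (hg : IsRec Q n fun m => ρ (gY q m)) :
    FiniteDimensional ℂ M := by
  have hv : v ∈ lowerFlag ρ v n := by
    generalize n = k
    induction k with
    | zero => exact Submodule.mem_span_singleton_self v
    | succ k ih => exact Submodule.mem_sup_left ih
  have hmem : ∀ m, ∀ x ∈ lowerFlag ρ v n, ρ (gY q m) x ∈ lowerFlag ρ v n := by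
    intro m
    induction m using Nat.strong_induction_on with
    | _ m ih =>
      intro x hx
      by_cases hm : m < n
      · exact g_mem_lowerFlag hq₀ hq n m hm hx
      · obtain ⟨j, rfl⟩ := Nat.exists_eq_add_of_le (not_lt.1 hm)
        have h := LinearMap.congr_fun (hg j) x
        rw [LinearMap.sum_apply, ← Finset.add_sum_erase _ _
          (show ((0, n) : ℕ × ℕ) ∈ antidiagonal n by simp)] at h
        simp only [LinearMap.smul_apply, LinearMap.zero_apply] at h
        rw [← Submodule.smul_mem_iff _ hQ, eq_neg_of_add_eq_zero_left h]
        refine Submodule.neg_mem _ (Submodule.sum_mem _ fun y hy => Submodule.smul_mem _ _ ?_)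
        rw [Finset.mem_erase, Finset.HasAntidiagonal.mem_antidiagonal, Ne, Prod.ext_iff] at hy
        refine ih _ ?_ x hx
        simp only at hy
        omega
  have htop : lowerFlag ρ v n = ⊤ := by
    rw [eq_top_iff]
    exact fun x _ => cyclic_induction hcyc _ hv hmem x
  have := finiteDimensional_lowerFlag ρ v n
  rw [htop] at this
  exact Module.Finite.equiv Submodule.topEquiv

/-- The forms ε∘e_k with k < n pair with the vectors g_m v to κ h_(k+m+1), so they are independent
by non-degeneracy of the Hankel matrix. -/
theorem le_finrank_lowerForms (hq₀ : q ≠ 0) (hq : ∀ n : ℕ, 0 < n → q ^ n ≠ 1)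
    (H : IsHighestWeight ρ P v h) [FiniteDimensional ℂ M]
    (hh : ∀ c : Fin n → ℂ, (∀ m, ∑ k, c k * PowerSeries.coeff (m + k + 1) h = 0) → c = 0) :
    n ≤ Module.finrank ℂ (lowerForms ρ v) := by
  obtain ⟨ε, σ, h₁, -, h₃, -⟩ := H.exists_counit hq₀ hq
  let φ : Fin n → lowerForms ρ v := fun k => ⟨ε ∘ₗ ρ (eY q k), by simp [H.e_v], fun a b x => by
    rw [LinearMap.comp_apply, rep_e_g ρ hq₀, H.h_act, map_sub, map_smul, map_smul, h₃, h₃]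
    simp⟩
  have hφ : LinearIndependent ℂ φ := by
    rw [Fintype.linearIndependent_iff]
    intro c hc
    refine congrFun (hh c fun m => ?_)
    have := LinearMap.congr_fun (congrArg Subtype.val hc) (ρ (gY q m) v)
    rw [AddSubmonoidClass.coe_finsetSum, LinearMap.sum_apply] at this
    simp only [φ, SetLike.val_smul, LinearMap.smul_apply, LinearMap.comp_apply, rep_e_g ρ hq₀,
      H.h_act, H.e_v, map_zero, sub_zero, map_smul, h₁, smul_eq_mul, mul_one, ZeroMemClass.coe_zero,
      LinearMap.zero_apply] at this
    refine (mul_eq_zero.1 (Eq.trans ?_ this)).resolve_left (kap_ne_zero hq₀ hq)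
    rw [Finset.mul_sum]
    refine Finset.sum_congr rfl fun k _ => ?_
    rw [show m + (k : ℕ) + 1 = k + m + 1 by ring]
    ring
  simpa using hφ.fintype_card_le_finrank

/-- The dual argument: the vectors g_k v with k < n are independent because e_m sends them to κ
h_(m+k+1) v. -/
theorem le_finrank_firstLevel (hq₀ : q ≠ 0) (hq : ∀ n : ℕ, 0 < n → q ^ n ≠ 1)
    (H : IsHighestWeight ρ P v h) [FiniteDimensional ℂ M]
    (hh : ∀ c : Fin n → ℂ, (∀ m, ∑ k, c k * PowerSeries.coeff (m + k + 1) h = 0) → c = 0) :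
    n ≤ Module.finrank ℂ (firstLevel ρ v) := by
  have he : ∀ m k, ρ (eY q m) (ρ (gY q k) v) = (kap q * PowerSeries.coeff (m + k + 1) h) • v := by
    intro m k
    rw [rep_e_g ρ hq₀, H.h_act, H.e_v, map_zero, sub_zero, smul_smul]
  let φ : Fin n → firstLevel ρ v := fun k => ⟨ρ (gY q k) v, d_zero_g_of_fixed hq₀ _ H.d_zero_v,
    fun m => by rw [he]; exact Submodule.smul_mem _ _ (Submodule.mem_span_singleton_self v)⟩
  have hφ : LinearIndependent ℂ φ := by
    rw [Fintype.linearIndependent_iff]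
    intro c hc
    refine congrFun (hh c fun m => ?_)
    have := congrArg (ρ (eY q m)) (congrArg Subtype.val hc)
    rw [AddSubmonoidClass.coe_finsetSum, map_sum] at this
    simp only [φ, SetLike.val_smul, map_smul, he, ZeroMemClass.coe_zero, map_zero, smul_smul,
      ← Finset.sum_smul] at this
    have := (smul_eq_zero.1 this).resolve_right H.ne_zero
    refine (mul_eq_zero.1 (Eq.trans ?_ this)).resolve_left (kap_ne_zero hq₀ hq)
    rw [Finset.mul_sum]
    refine Finset.sum_congr rfl fun k _ => ?_
    ring
  simpa using hφ.fintype_card_le_finrank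

end Rational

/-! ### From the ℓ-weight of a generating vector to the scalar action of H. -/

namespace YModule

variable {q : ℂ} {V : YModule.{u} q}

open Finset.HasAntidiagonal

/-- From e_n v = 0, D v = v and A = DH + CE it follows by induction on n that H acts on v by h; as
the h_n commute with the g_m, which generate from v, H acts by h everywhere. -/
theorem highestWeight_of_generated (hq₀ : q ≠ 0) (hq : ∀ n : ℕ, 0 < n → q ^ n ≠ 1) {v : V}
    {h : ℂ⟦X⟧} (h0 : PowerSeries.coeff 0 h ≠ 0) (hv : v ≠ 0)
    (hp : ∃ p, V.IsHomogeneousOfDegree v p) (hb : ∀ n, V.act (sY q 0 1 n) v = 0)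
    (ha : ∀ n, V.act (sY q 0 0 n) v = PowerSeries.coeff n h • v)
    (hd : ∀ n, V.act (sY q 1 1 n) v = PowerSeries.coeff n (1 : ℂ⟦X⟧) • v)
    (hgen : V.generated v = ⊤) :
    IsHighestWeight V.act V.parity v h ∧ IsCyclicVector V.act v := by
  have hd0 : V.act (dY q 0) v = v := by
    rw [dY, hd]; simp
  have hdn : ∀ n, n ≠ 0 → V.act (dY q n) v = 0 := by
    intro n hn
    rw [dY, hd, PowerSeries.coeff_one, if_neg hn, zero_smul]
  have dinj : ∀ x y : V, V.act (dY q 0) x = V.act (dY q 0) y → x = y := by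
    intro x y hxy
    rw [← rep_sInv_s V.act 1 x, ← rep_sInv_s V.act 1 y]
    exact congrArg _ hxy
  have he := e_eq_zero_of_b_eq_zero hb
  have hh : ∀ n, V.act (hY q n) v = PowerSeries.coeff n h • v := by
    intro n
    induction n using Nat.strong_induction_on with
    | _ n ih =>
      have h := ha n
      simp only [rep_a, he, map_zero, add_zero] at h
      rw [Finset.sum_eq_single (0, n)] at h
      · exact dinj _ _ (by rw [h, map_smul, hd0])
      · rintro ⟨a, b⟩ hab hne
        rw [Finset.HasAntidiagonal.mem_antidiagonal] at hab
        rw [Ne, Prod.ext_iff] at hne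
        simp only at hab hne ⊢
        rw [ih b (by omega), map_smul, hdn a (by omega), smul_zero]
      · simp
  have hdK : ∀ n, ∃ c : ℂ, V.act (dY q n) v = c • v := fun n => ⟨_, hd n⟩
  have hcyc : IsCyclicVector V.act v := by
    rw [IsCyclicVector, eq_top_iff, ← hgen]
    rintro _ ⟨y, rfl⟩
    refine act_mem_lowerSpan (c := fun n => PowerSeries.coeff n h) hq₀ hq h0 ?_ ?_ ?_ ?_ y
      (le_lowerSpan _ (Submodule.mem_span_singleton_self v))
    · intro n x hx
      obtain ⟨c, rfl⟩ := Submodule.mem_span_singleton.1 hx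
      obtain ⟨b, hb⟩ := hdK n
      rw [map_smul, hb]
      exact Submodule.smul_mem _ _ (Submodule.smul_mem _ _ (Submodule.mem_span_singleton_self v))
    · intro x hx
      obtain ⟨c, rfl⟩ := Submodule.mem_span_singleton.1 hx
      have : V.act (sInvY q 1) v = v := dinj _ _ (by rw [hd0]; exact rep_s_sInv V.act 1 v)
      rw [map_smul, this]
      exact Submodule.smul_mem _ _ (Submodule.mem_span_singleton_self v)
    · intro n x hx
      obtain ⟨c, rfl⟩ := Submodule.mem_span_singleton.1 hx
      rw [map_smul, he, smul_zero]
    · intro n x hx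
      obtain ⟨c, rfl⟩ := Submodule.mem_span_singleton.1 hx
      rw [map_smul, hh, smul_comm]
  refine ⟨⟨V.act_parity, hv, hp, hdK, hd0, he, fun n x => ?_, h0,
    lowerSpan_span_eq_top_span hq₀ hd0 hcyc⟩, hcyc⟩
  refine h_on_lowerSpan (ρ := V.act) (K := ℂ ∙ v) hq₀ hq (c := fun n => PowerSeries.coeff n h) ?_ n
    (by rw [show lowerSpan V.act (ℂ ∙ v) = ⊤ from hcyc]; trivial)
  intro n x hx
  obtain ⟨c, rfl⟩ := Submodule.mem_span_singleton.1 hx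
  rw [map_smul, hh, smul_comm]

end YModule

/-! ### Numerator, denominator and expansion of a rational function. -/

section Expansion

variable {f : RatFunc ℂ}

theorem denom_coeff_zero (hf : f.eval (RingHom.id ℂ) 0 = 1) : f.denom.coeff 0 ≠ 0 := by
  intro h
  rw [RatFunc.eval, Polynomial.eval₂_id, Polynomial.eval₂_id, ← Polynomial.coeff_zero_eq_eval_zero,
    ← Polynomial.coeff_zero_eq_eval_zero, h, div_zero] at hf
  exact zero_ne_one hf

theorem num_coeff_zero (hf : f.eval (RingHom.id ℂ) 0 = 1) : f.num.coeff 0 ≠ 0 := by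
  intro h
  rw [RatFunc.eval, Polynomial.eval₂_id, Polynomial.eval₂_id, ← Polynomial.coeff_zero_eq_eval_zero,
    ← Polynomial.coeff_zero_eq_eval_zero, h, zero_div] at hf
  exact zero_ne_one hf

theorem expansion_mul_denom (hf : f.eval (RingHom.id ℂ) 0 = 1) :
    expansion f * (f.denom : ℂ⟦X⟧) = f.num := by
  rw [expansion, mul_assoc, PowerSeries.inv_mul_cancel, mul_one]
  rw [← PowerSeries.coeff_zero_eq_constantCoeff_apply, Polynomial.coeff_coe]
  exact denom_coeff_zero hf

theorem coeff_zero_expansion (hf : f.eval (RingHom.id ℂ) 0 = 1) :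
    PowerSeries.coeff 0 (expansion f) ≠ 0 := by
  intro h
  have := congrArg (PowerSeries.coeff 0) (expansion_mul_denom hf)
  rw [coeff_zero_mul, h, zero_mul, Polynomial.coeff_coe] at this
  exact num_coeff_zero hf this.symm

end Expansion

/-- The order of a rational function: its number of zeros, or of poles. -/
def order (f : RatFunc ℂ) : ℕ := max f.num.natDegree f.denom.natDegree

/-- Simplicity makes the given generator cocyclic, so any highest ℓ-weight vector is a non-zero
multiple of it and has the same ℓ-weight. The numerator and denominator of f are coprime, which is
what the Hankel argument needs. -/
theorem YModule.isRational_of_isSimpleOfHighestLWeight {q : ℂ} (hq₀ : q ≠ 0)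
    (hq : ∀ n : ℕ, 0 < n → q ^ n ≠ 1) {V : YModule.{u} q} {f : RatFunc ℂ}
    (hf : f.eval (RingHom.id ℂ) 0 = 1) (hV : IsSimpleOfHighestLWeight V f) {v : V}
    (hv : V.IsHighestLWeightVector v) :
    IsHighestWeight V.act V.parity v (expansion f) ∧
      IsRational V.act v (expansion f) f.num f.denom (order f) ∧
      IsCyclicVector V.act v ∧ IsCocyclicVector V.act v := by
  obtain ⟨hs, v₀, ⟨h1, -, h3, -⟩, h5, h6, h7, h8⟩ := hV
  obtain ⟨hw₀, hc₀⟩ := highestWeight_of_generated hq₀ hq (coeff_zero_expansion hf) h1 ⟨0, h5⟩ h3 h7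
    h8 h6
  have hcoc₀ := isCocyclicVector_of_isSimple hq₀ hq hw₀ hs
  have he := e_eq_zero_of_b_eq_zero hv.2.2.1
  obtain ⟨c, rfl⟩ := Submodule.mem_span_singleton.1 (hcoc₀ v he)
  have hc : c ≠ 0 := fun h => hv.1 (by rw [h, zero_smul])
  have hgen : V.generated (c • v₀) = ⊤ := by
    rw [eq_top_iff, ← h6]
    rintro _ ⟨y, rfl⟩
    refine ⟨c⁻¹ • y, ?_⟩
    simp [smul_smul, inv_mul_cancel₀ hc]
  obtain ⟨hw, hcyc⟩ := highestWeight_of_generated hq₀ hq (coeff_zero_expansion hf) hv.1 hv.2.1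
    hv.2.2.1 (fun n => by rw [map_smul, h7, smul_comm]) (fun n => by rw [map_smul, h8, smul_comm])
    hgen
  have hcoc := isCocyclicVector_of_isSimple hq₀ hq hw hs
  have hr := isRec_coeff (n := order f) (le_max_right _ _) (le_max_left _ _) (expansion_mul_denom hf)
  have hg := g_rec_of_cyclic hq₀ hq hw hcyc hcoc hr
  have hfin := finiteDimensional_of_cyclic hq₀ hq hcyc (denom_coeff_zero hf) hg
  have hh := hankel_injective (expansion_mul_denom hf) (denom_coeff_zero hf)
    (fun h => num_coeff_zero hf (by rw [h, Polynomial.coeff_zero])) (RatFunc.isCoprime_num_denom f)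
    (n := order f) rfl
  exact ⟨hw, ⟨hfin, expansion_mul_denom hf, denom_coeff_zero hf, num_coeff_zero hf,
    le_max_left _ _, le_max_right _ _, e_rec_of_cyclic hq₀ hw hcyc hr, hg,
    le_finrank_lowerForms hq₀ hq hw hh, le_finrank_firstLevel hq₀ hq hw hh⟩, hcyc, hcoc⟩

/-! ## Tensor products -/

section Convolution

open Finset.HasAntidiagonal

/-- Multiplication by QQ' yields the numerator pb + aQ', where a and b are the numerators of s and
t. Its degree is below n + n' although p and Q' may have full degree. -/
theorem isRec_mul {p Q Q' : Polynomial ℂ} {n n' : ℕ} {h : ℂ⟦X⟧} (hp : p.natDegree ≤ n)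
    (hQ : Q.natDegree ≤ n) (hQ' : Q'.natDegree ≤ n') (e : h * (Q : ℂ⟦X⟧) = p) {s t r : ℕ → ℂ}
    (hs : IsRec Q n s) (ht : IsRec Q' n' t)
    (hr : PowerSeries.mk r = h * PowerSeries.mk t + PowerSeries.mk s) :
    IsRec (Q * Q') (n + n') r := by
  obtain ⟨a, ha, ea⟩ := (isRec_iff hQ s).1 hs
  obtain ⟨b, hb, eb⟩ := (isRec_iff hQ' t).1 ht
  refine (isRec_iff (Polynomial.natDegree_mul_le.trans (add_le_add hQ hQ')) r).2
    ⟨p * b + a * Q', ?_, ?_⟩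
  · have hbig : ∀ {x y : Polynomial ℂ} {i j : ℕ}, x.natDegree ≤ i → y.degree < j →
        (x * y).degree < (i + j : ℕ) := by
      intro x y i j hx hy
      by_cases hy0 : y = 0
      · simp [hy0]
      · rw [← Polynomial.natDegree_lt_iff_degree_lt hy0] at hy
        refine degree_lt_of_natDegree_lt (Polynomial.natDegree_mul_le.trans_lt ?_)
        omega
    refine (Polynomial.degree_add_le _ _).trans_lt (max_lt (hbig hp hb) ?_)
    rw [mul_comm a, add_comm n]
    exact hbig hQ' ha
  · rw [hr, Polynomial.coe_mul, Polynomial.coe_add, Polynomial.coe_mul, Polynomial.coe_mul, ← ea,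
      ← eb, ← e]
    ring

theorem eq_zero_of_mk_eq_zero {s : ℕ → ℂ} {Q r : Polynomial ℂ} (hQ : Q.coeff 0 ≠ 0)
    (e : PowerSeries.mk s * (Q : ℂ⟦X⟧) = r) (hr : r = 0) (m : ℕ) : s m = 0 := by
  rw [hr, Polynomial.coe_zero] at e
  rw [← PowerSeries.coeff_mk m s, (mul_eq_zero.1 e).resolve_right (coe_ne_zero hQ), map_zero]

end Convolution

section Cyclic

variable {q : ℂ} {M : Type u} [AddCommGroup M] [Module ℂ M] {ρ : Y q →ₐ[ℂ] Module.End ℂ M} {v : M}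

/-- A form in `lowerForms` vanishes on v and on anything with two g's in front, so on a cyclic
module only its values on the g_m v remain. -/
theorem lowerForms_eq_zero (hcyc : IsCyclicVector ρ v) {φ : M →ₗ[ℂ] ℂ} (hφ : φ ∈ lowerForms ρ v)
    (h0 : ∀ m, φ (ρ (gY q m) v) = 0) : φ = 0 := by
  let N : Submodule ℂ M := LinearMap.ker φ ⊓ ⨅ m, LinearMap.ker (φ ∘ₗ ρ (gY q m))
  have hN : ∀ x, x ∈ N ↔ φ x = 0 ∧ ∀ m, φ (ρ (gY q m) x) = 0 := by
    intro x
    simp [N, Submodule.mem_iInf]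
  refine LinearMap.ext fun x => ((hN x).1 (cyclic_induction hcyc N ?_ ?_ x)).1
  · exact (hN v).2 ⟨hφ.1, h0⟩
  · intro n x hx
    exact (hN _).2 ⟨((hN x).1 hx).2 n, fun m => hφ.2 m n x⟩

end Cyclic

/-! ### Action on a tensor product when H acts by scalars. -/

namespace YModule

open Finset.HasAntidiagonal

variable {q : ℂ} {V W : YModule.{u} q} {v : V} {w : W} {h h' : ℂ⟦X⟧} {p p' Q Q' : Polynomial ℂ}
  {n n' : ℕ}

/-- The linear form `x ⊗ y ↦ φ(x) ψ(y)`. -/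
def prodForm (φ : V →ₗ[ℂ] ℂ) (ψ : W →ₗ[ℂ] ℂ) : V ⊗[ℂ] W →ₗ[ℂ] ℂ :=
  TensorProduct.dualDistrib ℂ V W (φ ⊗ₜ ψ)

theorem prodForm_tmul (φ : V →ₗ[ℂ] ℂ) (ψ : W →ₗ[ℂ] ℂ) (x : V) (y : W) :
    prodForm φ ψ (x ⊗ₜ y) = φ x * ψ y := TensorProduct.dualDistrib_apply _ _ _ _

theorem tact_e_scalar (hq₀ : q ≠ 0) (hq : ∀ n : ℕ, 0 < n → q ^ n ≠ 1)
    (hV : ∀ n x, V.act (hY q n) x = PowerSeries.coeff n h • x) (n : ℕ) (z : V ⊗[ℂ] W) :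
    tact V W (eY q n) z = ∑ x ∈ antidiagonal n, PowerSeries.coeff x.1 h •
      V.parity.rTensor W ((W.act (eY q x.2)).lTensor V z) + (V.act (eY q n)).rTensor W z := by
  induction z using TensorProduct.induction_on with
  | zero => simp
  | add a b ha hb =>
    simp only [map_add, ha, hb, smul_add, Finset.sum_add_distrib]
    abel
  | tmul x y =>
    simp only [tact_e V W hq₀ hq, hV, LinearMap.rTensor_tmul, LinearMap.lTensor_tmul,
      TensorProduct.smul_tmul']

theorem tact_g_scalar (hq₀ : q ≠ 0) (hq : ∀ n : ℕ, 0 < n → q ^ n ≠ 1)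
    (hW : ∀ n x, W.act (hY q n) x = PowerSeries.coeff n h' • x) (n : ℕ) (z : V ⊗[ℂ] W) :
    tact V W (gY q n) z = ∑ x ∈ antidiagonal n, PowerSeries.coeff x.2 h' •
      (V.act (gY q x.1)).rTensor W z + V.parity.rTensor W ((W.act (gY q n)).lTensor V z) := by
  induction z using TensorProduct.induction_on with
  | zero => simp
  | add a b ha hb =>
    simp only [map_add, ha, hb, smul_add, Finset.sum_add_distrib]
    abel
  | tmul x y =>
    simp only [tact_g V W hq₀ hq, hW, LinearMap.rTensor_tmul, LinearMap.lTensor_tmul,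
      TensorProduct.tmul_smul]

/-- Δ(H) is never computed: h_(m+1) is the anticommutator of e_m and g_0 up to κ, so the coproducts
of E and G suffice. The mixed terms cancel through the parity signs, and h_0 is group-like. -/
theorem tact_h_scalar (hq₀ : q ≠ 0) (hq : ∀ n : ℕ, 0 < n → q ^ n ≠ 1)
    (hV : ∀ n x, V.act (hY q n) x = PowerSeries.coeff n h • x)
    (hW : ∀ n x, W.act (hY q n) x = PowerSeries.coeff n h' • x) (n : ℕ) (z : V ⊗[ℂ] W) :
    tact V W (hY q n) z = PowerSeries.coeff n (h * h') • z := by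
  induction z using TensorProduct.induction_on with
  | zero => simp
  | add a b ha hb => rw [map_add, smul_add, ha, hb]
  | tmul x y =>
    rcases n with _ | m
    · rw [tact_h_zero, hV, hW, coeff_zero_mul, TensorProduct.smul_tmul_smul]
    · have key := rep_e_g (tact V W) hq₀ m 0 (x ⊗ₜ y)
      rw [eq_sub_iff_add_eq] at key
      have hg : ∀ (x : V) (y : W), tact V W (gY q 0) (x ⊗ₜ[ℂ] y : V ⊗[ℂ] W) =
          (PowerSeries.coeff 0 h' • (V.act (gY q 0) x ⊗ₜ[ℂ] y) +
            V.parity x ⊗ₜ[ℂ] W.act (gY q 0) y : V ⊗[ℂ] W) := by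
        intro x y
        rw [tact_g_scalar hq₀ hq hW]
        simp
      have he : ∀ (x : V) (y : W), tact V W (eY q m) (x ⊗ₜ[ℂ] y : V ⊗[ℂ] W) =
          (∑ p ∈ antidiagonal m, PowerSeries.coeff p.1 h • (V.parity x ⊗ₜ[ℂ] W.act (eY q p.2) y) +
            V.act (eY q m) x ⊗ₜ[ℂ] y : V ⊗[ℂ] W) := by
        intro x y
        rw [tact_e_scalar hq₀ hq hV]
        simp
      rw [hg, he] at key
      simp only [map_add, map_sum, map_smul, hg, he, smul_add] at key
      simp only [rep_e_g V.act hq₀, rep_e_g W.act hq₀, hV, hW, parity_parity,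
        odd_parity V.act_parity (gY_mem q 0), odd_parity V.act_parity (eY_mem q m)] at key
      refine smul_right_injective _ (kap_ne_zero hq₀ hq) ?_
      beta_reduce
      have hc : ∀ (a : ℕ) (z : V ⊗[ℂ] W), PowerSeries.coeff a h • PowerSeries.coeff 0 h' • z =
          PowerSeries.coeff 0 h' • PowerSeries.coeff a h • z := fun a z => smul_comm _ _ _
      have hk : ∀ (a b : ℕ) (z : V ⊗[ℂ] W),
          PowerSeries.coeff a h • kap q • PowerSeries.coeff b h' • z =
          kap q • (PowerSeries.coeff a h * PowerSeries.coeff b h') • z := fun a b z => by module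
      simp only [add_zero, TensorProduct.sub_tmul, TensorProduct.tmul_sub, TensorProduct.neg_tmul,
        smul_sub, smul_neg, Finset.sum_sub_distrib, Finset.sum_neg_distrib, Finset.sum_add_distrib,
        ← TensorProduct.smul_tmul', TensorProduct.tmul_smul, hc, hk, ← Finset.smul_sum,
        ← Finset.sum_smul] at key
      rw [← key, PowerSeries.coeff_mul, Finset.Nat.sum_antidiagonal_succ']
      module

end YModule

/-! ### Tensor products of rational highest weight modules are of the same kind. -/

namespace YModule

open Finset.HasAntidiagonal

variable {q : ℂ} {V W : YModule.{u} q} {v : V} {w : W} {h h' : ℂ⟦X⟧} {p p' Q Q' : Polynomial ℂ}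
  {n n' : ℕ}

theorem tmul_mem_lowerWeight (x : V) (y : W) (j k : ℕ) (hx : V.act (dY q 0) x = (q⁻¹) ^ j • x)
    (hy : W.act (dY q 0) y = (q⁻¹) ^ k • y) (hjk : 0 < j + k) :
    (x ⊗ₜ[ℂ] y : V ⊗[ℂ] W) ∈ lowerWeight (tact V W) := by
  refine ⟨j + k - 1, ?_⟩
  rw [tact_d_zero, hx, hy, TensorProduct.smul_tmul_smul, ← pow_add, Nat.sub_add_cancel hjk]

theorem b_highestWeight (HW : IsHighestWeight W.act W.parity w h') (n : ℕ) :
    W.act (sY q 0 1 n) w = 0 := by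
  rw [rep_b]
  simp [HW.e_v]

theorem isHighestWeight_tensor (hq₀ : q ≠ 0) (hq : ∀ n : ℕ, 0 < n → q ^ n ≠ 1)
    (HV : IsHighestWeight V.act V.parity v h) (HW : IsHighestWeight W.act W.parity w h') :
    IsHighestWeight (tact V W) (TensorProduct.map V.parity W.parity) (v ⊗ₜ[ℂ] w : V ⊗[ℂ] W)
      (h * h') where
  act_parity := tensor_act_parity V W
  ne_zero := by
    obtain ⟨ε, -, h₁, -⟩ := HV.exists_counit hq₀ hq
    obtain ⟨ε', -, h₂, -⟩ := HW.exists_counit hq₀ hq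
    intro h0
    have := prodForm_tmul ε ε' v w
    rw [h0, map_zero, h₁, h₂, mul_one] at this
    exact zero_ne_one this
  parity_v := by
    obtain ⟨a, ha⟩ := HV.parity_v
    obtain ⟨b, hb⟩ := HW.parity_v
    exact ⟨a + b, by rw [TensorProduct.map_tmul, ha, hb, sgn_add, TensorProduct.smul_tmul_smul]⟩
  d_v := by
    intro n
    choose a ha using HV.d_v
    choose b hb using HW.d_v
    refine ⟨∑ x ∈ antidiagonal n, a x.1 * b x.2, ?_⟩
    rw [tact_d V W n v w (b_highestWeight HW), Finset.sum_smul]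
    exact Finset.sum_congr rfl fun x _ => by rw [ha, hb, TensorProduct.smul_tmul_smul]
  d_zero_v := by rw [tact_d_zero, HV.d_zero_v, HW.d_zero_v]
  e_v := by
    intro n
    rw [tact_e_scalar hq₀ hq HV.h_act]
    simp [HV.e_v, HW.e_v]
  h_act := tact_h_scalar hq₀ hq HV.h_act HW.h_act
  h_zero := by
    rw [coeff_zero_mul]
    exact mul_ne_zero HV.h_zero HW.h_zero
  span_eq_top := by
    rw [eq_top_iff, ← TensorProduct.map₂_mk_top_top_eq_top, ← HV.span_eq_top, ← HW.span_eq_top,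
      Submodule.map₂_span_span]
    refine Submodule.span_mono ?_
    rintro _ ⟨x, hx, y, hy, rfl⟩
    have hx' : x = v ∨ ∃ k : ℕ, V.act (dY q 0) x = (q⁻¹) ^ (k + 1) • x := hx
    have hy' : y = w ∨ ∃ k : ℕ, W.act (dY q 0) y = (q⁻¹) ^ (k + 1) • y := hy
    rcases hx' with rfl | ⟨j, hj⟩ <;> rcases hy' with rfl | ⟨k, hk⟩
    · exact Or.inl rfl
    · exact Or.inr (tmul_mem_lowerWeight x y 0 (k + 1) (by simp [HV.d_zero_v]) hk (by omega))
    · exact Or.inr (tmul_mem_lowerWeight x y (j + 1) 0 hj (by simp [HW.d_zero_v]) (by omega))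
    · exact Or.inr (tmul_mem_lowerWeight x y (j + 1) (k + 1) hj hk (by omega))

/-- Matrix coefficients of the first tensor factor. -/
theorem isRec_left {s : ℕ → Module.End ℂ V} (hs : IsRec Q n s) (ψ : V ⊗[ℂ] W →ₗ[ℂ] ℂ)
    (z : V ⊗[ℂ] W) : IsRec Q n fun m => ψ ((s m).rTensor W z) :=
  hs.map (ψ ∘ₗ LinearMap.applyₗ z ∘ₗ LinearMap.rTensorHom W)

/-- Matrix coefficients of the second tensor factor. -/
theorem isRec_right {s : ℕ → Module.End ℂ W} (hs : IsRec Q n s) (ψ : V ⊗[ℂ] W →ₗ[ℂ] ℂ)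
    (z : V ⊗[ℂ] W) : IsRec Q n fun m => ψ (V.parity.rTensor W ((s m).lTensor V z)) :=
  hs.map (ψ ∘ₗ V.parity.rTensor W ∘ₗ LinearMap.applyₗ z ∘ₗ LinearMap.lTensorHom V)

/-- Generating-function form of Δ(E) = H⊗E + E⊗1, in the shape that `isRec_mul` takes. -/
theorem mk_e_tensor (hq₀ : q ≠ 0) (hq : ∀ n : ℕ, 0 < n → q ^ n ≠ 1)
    (hV : ∀ n x, V.act (hY q n) x = PowerSeries.coeff n h • x) (ψ : V ⊗[ℂ] W →ₗ[ℂ] ℂ)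
    (z : V ⊗[ℂ] W) : PowerSeries.mk (fun m => ψ (tact V W (eY q m) z)) =
      h * PowerSeries.mk (fun m => ψ (V.parity.rTensor W ((W.act (eY q m)).lTensor V z))) +
        PowerSeries.mk fun m => ψ ((V.act (eY q m)).rTensor W z) := by
  ext m
  rw [PowerSeries.coeff_mk, tact_e_scalar hq₀ hq hV, map_add, map_sum, map_add,
    PowerSeries.coeff_mul]
  simp only [map_smul, PowerSeries.coeff_mk, smul_eq_mul]

theorem mk_g_tensor (hq₀ : q ≠ 0) (hq : ∀ n : ℕ, 0 < n → q ^ n ≠ 1)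
    (hW : ∀ n x, W.act (hY q n) x = PowerSeries.coeff n h' • x) (ψ : V ⊗[ℂ] W →ₗ[ℂ] ℂ)
    (z : V ⊗[ℂ] W) : PowerSeries.mk (fun m => ψ (tact V W (gY q m) z)) =
      h' * PowerSeries.mk (fun m => ψ ((V.act (gY q m)).rTensor W z)) +
        PowerSeries.mk fun m => ψ (V.parity.rTensor W ((W.act (gY q m)).lTensor V z)) := by
  ext m
  rw [PowerSeries.coeff_mk, tact_g_scalar hq₀ hq hW, map_add, map_sum, map_add, mul_comm h',
    PowerSeries.coeff_mul]
  simp only [map_smul, PowerSeries.coeff_mk, smul_eq_mul]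
  congr 1
  exact Finset.sum_congr rfl fun _ _ => mul_comm _ _

theorem isRec_of_forms {M : Type*} [AddCommGroup M] [Module ℂ M] {s : ℕ → Module.End ℂ M}
    (hs : ∀ (ψ : M →ₗ[ℂ] ℂ) z, IsRec Q n fun m => ψ (s m z)) : IsRec Q n s := by
  refine isRec_end_iff.2 fun z j => ?_
  rw [← Module.forall_dual_apply_eq_zero_iff ℂ]
  intro ψ
  simpa using hs ψ z j

/-- The form ε vanishes on the image of every g_n, so only the term 1⊗G of Δ(G) survives, with the
sign σ from moving g_m past the first factor. -/
theorem tact_g_of_counit_left (hq₀ : q ≠ 0) (hq : ∀ n : ℕ, 0 < n → q ^ n ≠ 1)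
    (HW : IsHighestWeight W.act W.parity w h') {ε : V →ₗ[ℂ] ℂ} {σ : ℂ}
    (hg : ∀ n x, ε (V.act (gY q n) x) = 0) (hσ : ∀ x, ε (V.parity x) = σ * ε x)
    (φ' : W →ₗ[ℂ] ℂ) (m : ℕ) (z : V ⊗[ℂ] W) :
    prodForm ε φ' (tact V W (gY q m) z) = σ * prodForm ε (φ' ∘ₗ W.act (gY q m)) z := by
  rw [tact_g_scalar hq₀ hq HW.h_act]
  induction z using TensorProduct.induction_on with
  | zero => simp
  | add a b ha hb =>
    simp only [map_add, smul_add, Finset.sum_add_distrib, mul_add] at ha hb ⊢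
    rw [← ha, ← hb]
    ring
  | tmul x y =>
    simp [prodForm_tmul, hg, hσ, mul_assoc]

theorem tact_g_of_counit_right (hq₀ : q ≠ 0) (hq : ∀ n : ℕ, 0 < n → q ^ n ≠ 1)
    (HW : IsHighestWeight W.act W.parity w h') {ε' : W →ₗ[ℂ] ℂ}
    (hg : ∀ n x, ε' (W.act (gY q n) x) = 0)
    (φ : V →ₗ[ℂ] ℂ) (m : ℕ) (z : V ⊗[ℂ] W) :
    prodForm φ ε' (tact V W (gY q m) z) = ∑ x ∈ antidiagonal m,
      PowerSeries.coeff x.2 h' * prodForm (φ ∘ₗ V.act (gY q x.1)) ε' z := by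
  rw [tact_g_scalar hq₀ hq HW.h_act]
  induction z using TensorProduct.induction_on with
  | zero => simp
  | add a b ha hb =>
    simp only [map_add, smul_add, Finset.sum_add_distrib, mul_add] at ha hb ⊢
    rw [← ha, ← hb]
    ring
  | tmul x y =>
    simp [prodForm_tmul, hg]

/-- Under a form φ⊗ε' or ε⊗φ' the g's act on a single factor only, and there φ and φ' vanish after
two of them. -/
theorem prodForm_add_mem_lowerForms (hq₀ : q ≠ 0) (hq : ∀ n : ℕ, 0 < n → q ^ n ≠ 1)
    (HW : IsHighestWeight W.act W.parity w h') {ε : V →ₗ[ℂ] ℂ} {σ : ℂ} {ε' : W →ₗ[ℂ] ℂ}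
    (hg : ∀ n x, ε (V.act (gY q n) x) = 0) (hσ : ∀ x, ε (V.parity x) = σ * ε x)
    (hg' : ∀ n x, ε' (W.act (gY q n) x) = 0) {φ : V →ₗ[ℂ] ℂ} {φ' : W →ₗ[ℂ] ℂ}
    (hφ : φ ∈ lowerForms V.act v) (hφ' : φ' ∈ lowerForms W.act w) :
    prodForm φ ε' + prodForm ε φ' ∈ lowerForms (tact V W) (v ⊗ₜ[ℂ] w : V ⊗[ℂ] W) := by
  have z₁ : ∀ ψ : W →ₗ[ℂ] ℂ, prodForm (0 : V →ₗ[ℂ] ℂ) ψ = 0 := fun ψ => by simp [prodForm]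
  have z₂ : ∀ ψ : V →ₗ[ℂ] ℂ, prodForm ψ (0 : W →ₗ[ℂ] ℂ) = 0 := fun ψ => by simp [prodForm]
  refine ⟨by simp [prodForm_tmul, hφ.1, hφ'.1], fun a b z => ?_⟩
  rw [LinearMap.add_apply, tact_g_of_counit_left hq₀ hq HW hg hσ, tact_g_of_counit_left hq₀ hq HW hg hσ,
    tact_g_of_counit_right hq₀ hq HW hg']
  have e₁ : ∀ a b, (φ' ∘ₗ W.act (gY q a)) ∘ₗ W.act (gY q b) = 0 := fun a b =>
    LinearMap.ext fun y => hφ'.2 a b y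
  have e₂ : ∀ a b, (φ ∘ₗ V.act (gY q a)) ∘ₗ V.act (gY q b) = 0 := fun a b =>
    LinearMap.ext fun y => hφ.2 a b y
  simp only [tact_g_of_counit_right hq₀ hq HW hg', e₁, e₂, z₁, z₂]
  simp

theorem tmul_add_mem_firstLevel (hq₀ : q ≠ 0) (hq : ∀ n : ℕ, 0 < n → q ^ n ≠ 1)
    (HV : IsHighestWeight V.act V.parity v h) (HW : IsHighestWeight W.act W.parity w h')
    {x : V} {y : W} (hx : x ∈ firstLevel V.act v) (hy : y ∈ firstLevel W.act w) :
    (x ⊗ₜ[ℂ] w + v ⊗ₜ[ℂ] y : V ⊗[ℂ] W) ∈ firstLevel (tact V W) (v ⊗ₜ[ℂ] w : V ⊗[ℂ] W) := by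
  constructor
  · rw [map_add, tact_d_zero, tact_d_zero, HV.d_zero_v, HW.d_zero_v, hx.1, hy.1, smul_add,
      TensorProduct.smul_tmul', TensorProduct.tmul_smul]
  · intro n
    have hm : ∀ {a : V} {b : W}, a ∈ ℂ ∙ v → b ∈ ℂ ∙ w →
        (a ⊗ₜ[ℂ] b : V ⊗[ℂ] W) ∈ ℂ ∙ (v ⊗ₜ[ℂ] w : V ⊗[ℂ] W) := by
      intro a b ha hb
      obtain ⟨c, rfl⟩ := Submodule.mem_span_singleton.1 ha
      obtain ⟨d, rfl⟩ := Submodule.mem_span_singleton.1 hb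
      rw [TensorProduct.smul_tmul_smul]
      exact Submodule.smul_mem _ _ (Submodule.mem_span_singleton_self _)
    have hw := Submodule.mem_span_singleton_self (R := ℂ) w
    have hPv : V.parity v ∈ ℂ ∙ v := by
      obtain ⟨a, ha⟩ := HV.parity_v
      rw [ha]
      exact Submodule.smul_mem _ _ (Submodule.mem_span_singleton_self _)
    simp only [tact_e_scalar hq₀ hq HV.h_act, map_add, LinearMap.rTensor_tmul,
      LinearMap.lTensor_tmul, HV.e_v, HW.e_v, TensorProduct.tmul_zero, TensorProduct.zero_tmul,
      zero_add, add_zero]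
    exact Submodule.add_mem _ (Submodule.sum_mem _ fun k _ => Submodule.smul_mem _ _
      (hm hPv (hy.2 _))) (hm (hx.2 n) hw)

theorem mem_lowerWeight_of_mem_firstLevel {M : Type u} [AddCommGroup M] [Module ℂ M]
    {ρ : Y q →ₐ[ℂ] Module.End ℂ M} {v x : M} (hx : x ∈ firstLevel ρ v) : x ∈ lowerWeight ρ :=
  ⟨0, by rw [hx.1, zero_add, pow_one]⟩

/-- The fraction pp'/(QQ') need not be reduced, so the Hankel argument does not apply to the
product. The n + n' forms and vectors come from the factors instead, as φ⊗ε' + ε⊗φ' and x⊗w + v⊗y.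
-/
theorem isRational_tensor (hq₀ : q ≠ 0) (hq : ∀ n : ℕ, 0 < n → q ^ n ≠ 1)
    (HV : IsHighestWeight V.act V.parity v h) (HW : IsHighestWeight W.act W.parity w h')
    (RV : IsRational V.act v h p Q n) (RW : IsRational W.act w h' p' Q' n') :
    IsRational (tact V W) (v ⊗ₜ[ℂ] w : V ⊗[ℂ] W) (h * h') (p * p') (Q * Q') (n + n') := by
  have := RV.finite
  have := RW.finite
  obtain ⟨ε, σ, hε₁, hε₂, hε₃, hσ₀, hσ₁, hσ₂⟩ := HV.exists_counit hq₀ hq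
  obtain ⟨ε', σ', hε'₁, hε'₂, hε'₃, -⟩ := HW.exists_counit hq₀ hq
  refine ⟨inferInstance, ?_, ?_, ?_, ?_, ?_, ?_, ?_, ?_, ?_⟩
  · rw [Polynomial.coe_mul, Polynomial.coe_mul, ← RV.mul_eq, ← RW.mul_eq]
    ring
  · rw [Polynomial.mul_coeff_zero]
    exact mul_ne_zero RV.Q_zero RW.Q_zero
  · rw [Polynomial.mul_coeff_zero]
    exact mul_ne_zero RV.p_zero RW.p_zero
  · exact Polynomial.natDegree_mul_le.trans (add_le_add RV.p_le RW.p_le)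
  · exact Polynomial.natDegree_mul_le.trans (add_le_add RV.Q_le RW.Q_le)
  · exact isRec_of_forms fun ψ z => isRec_mul RV.p_le RV.Q_le RW.Q_le RV.mul_eq
      (isRec_left RV.e_rec ψ z) (isRec_right RW.e_rec ψ z) (mk_e_tensor hq₀ hq HV.h_act ψ z)
  -- In Δ(G) the series H stands in the second factor, so the two factors exchange roles.
  · rw [mul_comm, add_comm]
    exact isRec_of_forms fun ψ z => isRec_mul RW.p_le RW.Q_le RV.Q_le RW.mul_eq
      (isRec_right RW.g_rec ψ z) (isRec_left RV.g_rec ψ z) (mk_g_tensor hq₀ hq HW.h_act ψ z)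
  · let A : (lowerForms V.act v × lowerForms W.act w) →ₗ[ℂ]
        lowerForms (tact V W) (v ⊗ₜ[ℂ] w : V ⊗[ℂ] W) :=
      LinearMap.codRestrict _
        (((TensorProduct.dualDistrib ℂ V W ∘ₗ (TensorProduct.mk ℂ _ _).flip ε').coprod
          (TensorProduct.dualDistrib ℂ V W ∘ₗ TensorProduct.mk ℂ _ _ ε)) ∘ₗ
          LinearMap.prodMap (lowerForms V.act v).subtype (lowerForms W.act w).subtype)
        fun φ => prodForm_add_mem_lowerForms hq₀ hq HW hε₃ hσ₂ hε'₃ φ.1.2 φ.2.2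
    have hA : ∀ φ x y, (A φ : V ⊗[ℂ] W →ₗ[ℂ] ℂ) (x ⊗ₜ y) =
        (φ.1 : V →ₗ[ℂ] ℂ) x * ε' y + ε x * (φ.2 : W →ₗ[ℂ] ℂ) y := by
      intro φ x y
      change (prodForm (φ.1 : V →ₗ[ℂ] ℂ) ε' + prodForm ε (φ.2 : W →ₗ[ℂ] ℂ)) (x ⊗ₜ y) = _
      rw [LinearMap.add_apply, prodForm_tmul, prodForm_tmul]
    have hinj : Function.Injective A := by
      rw [← LinearMap.ker_eq_bot, LinearMap.ker_eq_bot']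
      intro φ hφ
      have key : ∀ x y, (φ.1 : V →ₗ[ℂ] ℂ) x * ε' y + ε x * (φ.2 : W →ₗ[ℂ] ℂ) y = 0 := by
        intro x y
        rw [← hA, hφ]
        rfl
      refine Prod.ext (Subtype.ext (LinearMap.ext fun x => ?_))
        (Subtype.ext (LinearMap.ext fun y => ?_))
      · simpa [hε'₁, φ.2.2.1] using key x w
      · simpa [hε₁, φ.1.2.1] using key v y
    have := LinearMap.finrank_le_finrank_of_injective hinj
    rw [Module.finrank_prod] at this
    exact (add_le_add RV.le_forms RW.le_forms).trans this
  · let A : (firstLevel V.act v × firstLevel W.act w) →ₗ[ℂ]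
        firstLevel (tact V W) (v ⊗ₜ[ℂ] w : V ⊗[ℂ] W) :=
      LinearMap.codRestrict _
        ((((TensorProduct.mk ℂ V W).flip w).coprod (TensorProduct.mk ℂ V W v)) ∘ₗ
          LinearMap.prodMap (firstLevel V.act v).subtype (firstLevel W.act w).subtype)
        fun z => tmul_add_mem_firstLevel hq₀ hq HV HW z.1.2 z.2.2
    have hinj : Function.Injective A := by
      rw [← LinearMap.ker_eq_bot, LinearMap.ker_eq_bot']
      intro z hz
      have key : ((z.1 : V) ⊗ₜ[ℂ] w + v ⊗ₜ[ℂ] (z.2 : W) : V ⊗[ℂ] W) = 0 := congrArg Subtype.val hz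
      refine Prod.ext (Subtype.ext ?_) (Subtype.ext ?_)
      · refine (Module.forall_dual_apply_eq_zero_iff ℂ _).1 fun ψ => ?_
        have := congrArg (prodForm ψ ε') key
        rw [map_add, prodForm_tmul, prodForm_tmul, hε'₁, hε'₂ _ (mem_lowerWeight_of_mem_firstLevel z.2.2)] at this
        simpa using this
      · refine (Module.forall_dual_apply_eq_zero_iff ℂ _).1 fun ψ => ?_
        have := congrArg (prodForm ε ψ) key
        rw [map_add, prodForm_tmul, prodForm_tmul, hε₁, hε₂ _ (mem_lowerWeight_of_mem_firstLevel z.1.2)] at this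
        simpa using this
    have := LinearMap.finrank_le_finrank_of_injective hinj
    rw [Module.finrank_prod] at this
    exact (add_le_add RV.le_level RW.le_level).trans this

end YModule

/-! ### Cyclicity and cocyclicity of a tensor product. -/

namespace YModule

open Finset.HasAntidiagonal

variable {q : ℂ} {V W : YModule.{u} q} {v : V} {w : W} {h h' : ℂ⟦X⟧} {p p' Q Q' : Polynomial ℂ}
  {n n' : ℕ}

/-- For z in N, a form vanishing on N gives ap' + bQ = 0 with deg a < n and deg b < n'. Absence of
common zeros forces a = b = 0, so N is stable under the g_m of each factor separately, and cyclicity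
of both factors fills V⊗W. -/
theorem isCyclicVector_tensor (hq₀ : q ≠ 0) (hq : ∀ n : ℕ, 0 < n → q ^ n ≠ 1)
    (HW : IsHighestWeight W.act W.parity w h')
    (RV : IsRational V.act v h p Q n) (RW : IsRational W.act w h' p' Q' n')
    (cV : IsCyclicVector V.act v) (cW : IsCyclicVector W.act w) (hc : NoCommonZero Q n p' n') :
    IsCyclicVector (tact V W) (v ⊗ₜ[ℂ] w : V ⊗[ℂ] W) := by
  set N := lowerSpan (tact V W) (ℂ ∙ (v ⊗ₜ[ℂ] w : V ⊗[ℂ] W)) with hN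
  have hvw : (v ⊗ₜ[ℂ] w : V ⊗[ℂ] W) ∈ N := le_lowerSpan _ (Submodule.mem_span_singleton_self _)
  have key : ∀ z ∈ N, ∀ m, (V.act (gY q m)).rTensor W z ∈ N ∧
      V.parity.rTensor W ((W.act (gY q m)).lTensor V z) ∈ N := by
    intro z hz m
    rw [← Subspace.forall_mem_dualAnnihilator_apply_eq_zero_iff N,
      ← Subspace.forall_mem_dualAnnihilator_apply_eq_zero_iff N, ← forall₂_and]
    intro ψ hψ
    have hψ' : ∀ m, ψ (tact V W (gY q m) z) = 0 := fun m =>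
      (Submodule.mem_dualAnnihilator ψ).1 hψ _ (g_mem_lowerSpan m hz)
    have e := mk_g_tensor hq₀ hq HW.h_act ψ z
    simp only [hψ'] at e
    obtain ⟨a, ha, ea⟩ := (isRec_iff RV.Q_le _).1 (isRec_left RV.g_rec ψ z)
    obtain ⟨b, hb, eb⟩ := (isRec_iff RW.Q_le _).1 (isRec_right RW.g_rec ψ z)
    have e' : a * p' + b * Q = 0 := by
      apply Polynomial.coe_injective ℂ
      rw [Polynomial.coe_add, Polynomial.coe_mul, Polynomial.coe_mul, ← ea, ← eb, ← RW.mul_eq,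
        Polynomial.coe_zero]
      have e₀ : (PowerSeries.mk fun _ : ℕ => (0 : ℂ)) = 0 := by ext; simp
      rw [e₀] at e
      linear_combination -(Q : ℂ⟦X⟧) * (Q' : ℂ⟦X⟧) * e
    obtain ⟨ha0, hb0⟩ := hc.eq_zero RV.Q_ne_zero RW.p_ne_zero ha hb e'
    exact ⟨eq_zero_of_mk_eq_zero RV.Q_zero ea ha0 m, eq_zero_of_mk_eq_zero RW.Q_zero eb hb0 m⟩
  have h₁ : ∀ x : V, (x ⊗ₜ[ℂ] w : V ⊗[ℂ] W) ∈ N :=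
    cyclic_induction cV (N.comap ((TensorProduct.mk ℂ V W).flip w)) hvw fun m x hx =>
      (key _ hx m).1
  have h₂ : ∀ (y : W) (x : V), (x ⊗ₜ[ℂ] y : V ⊗[ℂ] W) ∈ N := by
    intro y
    have := cyclic_induction cW (⨅ x : V, N.comap (TensorProduct.mk ℂ V W x))
      (by simpa [Submodule.mem_iInf] using h₁) (fun m y hy => ?_) y
    · simpa [Submodule.mem_iInf] using this
    · rw [Submodule.mem_iInf] at hy ⊢
      intro x
      -- The action of g_m on the second factor comes with the parity of the first; starting from
      -- `V.parity x` undoes it.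
      have := (key _ (hy (V.parity x)) m).2
      rwa [TensorProduct.mk_apply, LinearMap.lTensor_tmul, LinearMap.rTensor_tmul,
        parity_parity] at this
  rw [IsCyclicVector, eq_top_iff]
  rintro z -
  induction z using TensorProduct.induction_on with
  | zero => exact Submodule.zero_mem _
  | add a b ha hb => exact Submodule.add_mem _ ha hb
  | tmul x y => exact h₂ y x

/-- The map ε⊗id sends v⊗w to w, is onto W, and carries g_m on V⊗W to σ g_m on W. -/
theorem isCyclicVector_of_tensor (hq₀ : q ≠ 0) (hq : ∀ n : ℕ, 0 < n → q ^ n ≠ 1)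
    (HV : IsHighestWeight V.act V.parity v h) (HW : IsHighestWeight W.act W.parity w h')
    (hc : IsCyclicVector (tact V W) (v ⊗ₜ[ℂ] w : V ⊗[ℂ] W)) : IsCyclicVector W.act w := by
  obtain ⟨ε, σ, hε₁, hε₂, hε₃, hσ₀, hσ₁, hσ₂⟩ := HV.exists_counit hq₀ hq
  set N := lowerSpan W.act (ℂ ∙ w) with hN
  have hw : w ∈ N := le_lowerSpan _ (Submodule.mem_span_singleton_self _)
  have key := cyclic_induction hc
    (N.comap ((TensorProduct.lid ℂ W).toLinearMap ∘ₗ ε.rTensor W)) (by simpa [hε₁] using hw) ?_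
  · rw [IsCyclicVector, eq_top_iff]
    rintro y -
    simpa [hε₁] using key (v ⊗ₜ y)
  · intro m z hz
    have e : ((TensorProduct.lid ℂ W).toLinearMap ∘ₗ ε.rTensor W) (tact V W (gY q m) z) =
        σ • W.act (gY q m) (((TensorProduct.lid ℂ W).toLinearMap ∘ₗ ε.rTensor W) z) := by
      rw [tact_g_scalar hq₀ hq HW.h_act]
      clear hz
      induction z using TensorProduct.induction_on with
      | zero => simp
      | add a b ha hb =>
        simp only [map_add, smul_add, Finset.sum_add_distrib] at ha hb ⊢
        rw [← ha, ← hb]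
        abel
      | tmul x y => simp [hε₃, hσ₂, mul_smul]
    rw [Submodule.mem_comap, e]
    exact Submodule.smul_mem _ _ (g_mem_lowerSpan m hz)

/-- A common zero gives r ≠ 0 and r' with rp' + r'Q = 0. Forms φ, φ' whose series on G are r/Q and
σ⁻¹r'/Q' exist by dimension count. The form φ⊗ε' + ε⊗φ' then vanishes on all g_m(v⊗w), hence
everywhere, which forces φ = 0 and r = 0. -/
theorem noCommonZero_of_isCyclicVector (hq₀ : q ≠ 0) (hq : ∀ n : ℕ, 0 < n → q ^ n ≠ 1)
    (HV : IsHighestWeight V.act V.parity v h) (HW : IsHighestWeight W.act W.parity w h')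
    (RV : IsRational V.act v h p Q n) (RW : IsRational W.act w h' p' Q' n')
    (cV : IsCyclicVector V.act v) (cW : IsCyclicVector W.act w)
    (hc : IsCyclicVector (tact V W) (v ⊗ₜ[ℂ] w : V ⊗[ℂ] W)) : NoCommonZero Q n p' n' := by
  have := RV.finite
  have := RW.finite
  obtain ⟨ε, σ, hε₁, hε₂, hε₃, hσ₀, hσ₁, hσ₂⟩ := HV.exists_counit hq₀ hq
  obtain ⟨ε', σ', hε'₁, hε'₂, hε'₃, -⟩ := HW.exists_counit hq₀ hq
  by_contra hno
  obtain ⟨r, r', hr, hr', e, hr0⟩ := exists_of_not_noCommonZero RV.Q_ne_zero RW.p_ne_zero RV.Q_le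
    RW.p_le hno
  obtain ⟨⟨φ, hφ⟩, hφr⟩ := exists_of_finrank_le (E := lowerForms V.act v) RV.Q_le RV.Q_zero
    (fun m => LinearMap.applyₗ (V.act (gY q m) v) ∘ₗ (lowerForms V.act v).subtype)
    (fun φ => RV.g_rec.map ((φ : V →ₗ[ℂ] ℂ) ∘ₗ LinearMap.applyₗ v))
    (fun φ h0 => Subtype.ext (lowerForms_eq_zero cV φ.2 h0)) RV.le_forms r hr
  obtain ⟨⟨φ', hφ'⟩, hφr'⟩ := exists_of_finrank_le (E := lowerForms W.act w) RW.Q_le RW.Q_zero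
    (fun m => LinearMap.applyₗ (W.act (gY q m) w) ∘ₗ (lowerForms W.act w).subtype)
    (fun φ => RW.g_rec.map ((φ : W →ₗ[ℂ] ℂ) ∘ₗ LinearMap.applyₗ w))
    (fun φ h0 => Subtype.ext (lowerForms_eq_zero cW φ.2 h0)) RW.le_forms (σ⁻¹ • r')
    ((Polynomial.degree_smul_le _ _).trans_lt hr')
  change PowerSeries.mk (fun m => φ (V.act (gY q m) v)) * _ = _ at hφr
  change PowerSeries.mk (fun m => φ' (W.act (gY q m) w)) * _ = _ at hφr'
  have hΦ := prodForm_add_mem_lowerForms (v := v) (w := w) hq₀ hq HW hε₃ hσ₂ hε'₃ hφ hφ'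
  have hzero : prodForm φ ε' + prodForm ε φ' = 0 := by
    refine lowerForms_eq_zero hc hΦ ?_
    have e₁ := mk_g_tensor hq₀ hq HW.h_act (prodForm φ ε' + prodForm ε φ')
      (v ⊗ₜ[ℂ] w : V ⊗[ℂ] W)
    simp only [LinearMap.rTensor_tmul, LinearMap.lTensor_tmul] at e₁
    simp only [LinearMap.add_apply (prodForm φ ε') (prodForm ε φ') (_ ⊗ₜ _), prodForm_tmul, hε₃,
      hε'₃, hε'₁, hσ₂, hε₁, mul_one, zero_mul, mul_zero, add_zero, zero_add] at e₁
    have e₂ : (PowerSeries.mk fun m => σ * φ' (W.act (gY q m) w)) =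
        σ • PowerSeries.mk fun m => φ' (W.act (gY q m) w) := by
      ext m
      simp
    rw [e₂] at e₁
    have e₃ : PowerSeries.mk (fun m => (prodForm φ ε' + prodForm ε φ')
        (tact V W (gY q m) (v ⊗ₜ[ℂ] w : V ⊗[ℂ] W))) * (Q * Q' : Polynomial ℂ) =
        ((0 : Polynomial ℂ) : ℂ⟦X⟧) := by
      rw [e₁, ← e, Polynomial.coe_add, Polynomial.coe_mul, Polynomial.coe_mul, Polynomial.coe_mul,
        ← hφr, ← RW.mul_eq]
      have e₄ : (r' : ℂ⟦X⟧) = σ • (PowerSeries.mk (fun m => φ' (W.act (gY q m) w)) * Q') := by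
        rw [hφr', ← Polynomial.coe_smul, smul_smul, mul_inv_cancel₀ hσ₀, one_smul]
      rw [e₄, add_mul, smul_mul_assoc, smul_mul_assoc]
      congr 1
      · ring
      · congr 1; ring
    refine eq_zero_of_mk_eq_zero (Q := Q * Q') ?_ e₃ rfl
    rw [Polynomial.mul_coeff_zero]
    exact mul_ne_zero RV.Q_zero RW.Q_zero
  have hφ0 : φ = 0 := by
    refine LinearMap.ext fun x => ?_
    have := LinearMap.congr_fun hzero (x ⊗ₜ w)
    rw [LinearMap.add_apply, prodForm_tmul, prodForm_tmul, hε'₁, hφ'.1] at this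
    simpa using this
  refine hr0 (Polynomial.coe_injective ℂ ?_)
  rw [← hφr, hφ0, Polynomial.coe_zero]
  have e₀ : (PowerSeries.mk fun m => (0 : V →ₗ[ℂ] ℂ) (V.act (gY q m) v)) = 0 := by
    ext; simp
  rw [e₀, zero_mul]

/-- Cyclicity is assumed for the first factor only and is part of the equivalence for the second, as
an induction peeling off the first factor requires. -/
theorem isCyclicVector_tensor_iff (hq₀ : q ≠ 0) (hq : ∀ n : ℕ, 0 < n → q ^ n ≠ 1)
    (HV : IsHighestWeight V.act V.parity v h) (HW : IsHighestWeight W.act W.parity w h')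
    (RV : IsRational V.act v h p Q n) (RW : IsRational W.act w h' p' Q' n')
    (cV : IsCyclicVector V.act v) : IsCyclicVector (tact V W) (v ⊗ₜ[ℂ] w : V ⊗[ℂ] W) ↔
      NoCommonZero Q n p' n' ∧ IsCyclicVector W.act w := by
  constructor
  · intro hc
    have cW := isCyclicVector_of_tensor hq₀ hq HV HW hc
    exact ⟨noCommonZero_of_isCyclicVector hq₀ hq HV HW RV RW cV cW hc, cW⟩
  · rintro ⟨hc, cW⟩
    exact isCyclicVector_tensor hq₀ hq HW RV RW cV cW hc

theorem eq_zero_of_slices {z : V ⊗[ℂ] W}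
    (hz : ∀ ψ : W →ₗ[ℂ] ℂ, ((TensorProduct.rid ℂ V).toLinearMap ∘ₗ ψ.lTensor V) z = 0) : z = 0 := by
  classical
  let B := Module.Basis.ofVectorSpace ℂ W
  refine (TensorProduct.equivFinsuppOfBasisRight (M := V) B).injective ?_
  rw [map_zero]
  refine Finsupp.ext fun i => ?_
  rw [Finsupp.zero_apply, ← hz (B.coord i)]
  clear hz
  induction z using TensorProduct.induction_on with
  | zero => simp
  | add a b ha hb => simp only [map_add, Finsupp.add_apply, ha, hb]
  | tmul x y => simp

/-- Dual of `isCyclicVector_tensor`: if all e_m kill z, every form gives aQ' + bp = 0, so a = b = 0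
and z is killed by the e_m of each factor separately. -/
theorem isCocyclicVector_tensor (hq₀ : q ≠ 0) (hq : ∀ n : ℕ, 0 < n → q ^ n ≠ 1)
    (HV : IsHighestWeight V.act V.parity v h)
    (RV : IsRational V.act v h p Q n) (RW : IsRational W.act w h' p' Q' n')
    (cV : IsCocyclicVector V.act v) (cW : IsCocyclicVector W.act w) (hc : NoCommonZero p n Q' n') :
    IsCocyclicVector (tact V W) (v ⊗ₜ[ℂ] w : V ⊗[ℂ] W) := by
  intro z hz
  have key : ∀ m, (V.act (eY q m)).rTensor W z = 0 ∧
      V.parity.rTensor W ((W.act (eY q m)).lTensor V z) = 0 := by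
    intro m
    rw [← Module.forall_dual_apply_eq_zero_iff ℂ, ← Module.forall_dual_apply_eq_zero_iff ℂ,
      ← forall_and]
    intro ψ
    have e := mk_e_tensor hq₀ hq HV.h_act ψ z
    simp only [hz, map_zero] at e
    obtain ⟨a, ha, ea⟩ := (isRec_iff RV.Q_le _).1 (isRec_left RV.e_rec ψ z)
    obtain ⟨b, hb, eb⟩ := (isRec_iff RW.Q_le _).1 (isRec_right RW.e_rec ψ z)
    have e' : a * Q' + b * p = 0 := by
      apply Polynomial.coe_injective ℂ
      rw [Polynomial.coe_add, Polynomial.coe_mul, Polynomial.coe_mul, ← ea, ← eb, ← RV.mul_eq,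
        Polynomial.coe_zero]
      have e₀ : (PowerSeries.mk fun _ : ℕ => (0 : ℂ)) = 0 := by ext; simp
      rw [e₀] at e
      linear_combination -(Q : ℂ⟦X⟧) * (Q' : ℂ⟦X⟧) * e
    obtain ⟨ha0, hb0⟩ := hc.eq_zero RV.p_ne_zero RW.Q_ne_zero ha hb e'
    exact ⟨eq_zero_of_mk_eq_zero RV.Q_zero ea ha0 m, eq_zero_of_mk_eq_zero RW.Q_zero eb hb0 m⟩
  obtain ⟨ε, σ, hε₁, -, -, hσ₀, hσ₁, hσ₂⟩ := HV.exists_counit hq₀ hq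
  have hslice : ∀ ψ : W →ₗ[ℂ] ℂ,
      ((TensorProduct.rid ℂ V).toLinearMap ∘ₗ ψ.lTensor V) z ∈ ℂ ∙ v := by
    intro ψ
    refine cV _ fun m => ?_
    have e : ∀ z : V ⊗[ℂ] W, V.act (eY q m) (((TensorProduct.rid ℂ V).toLinearMap ∘ₗ ψ.lTensor V) z) =
        ((TensorProduct.rid ℂ V).toLinearMap ∘ₗ ψ.lTensor V) ((V.act (eY q m)).rTensor W z) := by
      intro z
      induction z using TensorProduct.induction_on with
      | zero => simp
      | add a b ha hb => simp only [map_add, ha, hb]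
      | tmul x y => simp
    rw [e, (key m).1, map_zero]
  -- All slices of z along forms on W lie on the line of v, so z is a pure tensor; its second
  -- component is read off by ε.
  obtain ⟨y, rfl⟩ : ∃ y : W, z = v ⊗ₜ y := by
    set y := ((TensorProduct.lid ℂ W).toLinearMap ∘ₗ ε.rTensor W) z with hy
    refine ⟨y, sub_eq_zero.1 (eq_zero_of_slices fun ψ => ?_)⟩
    obtain ⟨c, hc⟩ := Submodule.mem_span_singleton.1 (hslice ψ)
    have e₁ : ε (((TensorProduct.rid ℂ V).toLinearMap ∘ₗ ψ.lTensor V) z) = ψ y := by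
      rw [hy]
      clear hy hz key hslice hc
      induction z using TensorProduct.induction_on with
      | zero => simp
      | add a b ha hb => simp only [map_add, ha, hb]
      | tmul x y => simp [mul_comm]
    have e₂ := e₁
    rw [← hc, map_smul, hε₁, smul_eq_mul, mul_one] at e₂
    rw [map_sub, ← hc, e₂]
    simp
  have hye : ∀ m, W.act (eY q m) y = 0 := by
    intro m
    have := congrArg ((TensorProduct.lid ℂ W).toLinearMap ∘ₗ ε.rTensor W) (key m).2
    simpa [hσ₂, hε₁, hσ₀] using this
  obtain ⟨c, rfl⟩ := Submodule.mem_span_singleton.1 (cW y hye)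
  rw [TensorProduct.tmul_smul]
  exact Submodule.smul_mem _ _ (Submodule.mem_span_singleton_self _)

theorem isCocyclicVector_of_tensor (hq₀ : q ≠ 0) (hq : ∀ n : ℕ, 0 < n → q ^ n ≠ 1)
    (HV : IsHighestWeight V.act V.parity v h)
    (hc : IsCocyclicVector (tact V W) (v ⊗ₜ[ℂ] w : V ⊗[ℂ] W)) : IsCocyclicVector W.act w := by
  obtain ⟨ε, σ, hε₁, -⟩ := HV.exists_counit hq₀ hq
  intro y hy
  have := hc (v ⊗ₜ y) fun m => by
    rw [tact_e_scalar hq₀ hq HV.h_act]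
    simp [HV.e_v, hy]
  obtain ⟨c, hcy⟩ := Submodule.mem_span_singleton.1 this
  have := congrArg ((TensorProduct.lid ℂ W).toLinearMap ∘ₗ ε.rTensor W) hcy
  simp only [LinearMap.comp_apply, map_smul, LinearMap.rTensor_tmul, LinearEquiv.coe_coe,
    TensorProduct.lid_tmul, hε₁, one_smul] at this
  rw [← this]
  exact Submodule.smul_mem _ _ (Submodule.mem_span_singleton_self _)

/-- Counterpart of `lowerForms_eq_zero`: the e_m x are multiples of v, detected by ε. If they
vanish, x is a multiple of v, also detected by ε. -/
theorem eq_zero_of_mem_firstLevel {M : Type u} [AddCommGroup M] [Module ℂ M]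
    {ρ : Y q →ₐ[ℂ] Module.End ℂ M} {v : M} (hcoc : IsCocyclicVector ρ v) {ε : M →ₗ[ℂ] ℂ}
    (h₁ : ε v = 1) {x : M} (hx : x ∈ firstLevel ρ v) (h₂ : ε x = 0)
    (h0 : ∀ m, ε (ρ (eY q m) x) = 0) : x = 0 := by
  have he : ∀ m, ρ (eY q m) x = 0 := by
    intro m
    obtain ⟨c, hc⟩ := Submodule.mem_span_singleton.1 (hx.2 m)
    have := h0 m
    rw [← hc, map_smul, h₁, smul_eq_mul, mul_one] at this
    rw [← hc, this, zero_smul]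
  obtain ⟨c, hc⟩ := Submodule.mem_span_singleton.1 (hcoc x he)
  rw [← hc, map_smul, h₁, smul_eq_mul, mul_one] at h₂
  rw [← hc, h₂, zero_smul]

/-- From rQ' + r'p = 0 with r ≠ 0, choose x and y whose series under E are r/Q and σ⁻¹r'/Q'. Then
x⊗w + v⊗y is killed by all e_m and has lower weight, so it is zero; this forces x = 0 and r = 0. -/
theorem noCommonZero_of_isCocyclicVector (hq₀ : q ≠ 0) (hq : ∀ n : ℕ, 0 < n → q ^ n ≠ 1)
    (HV : IsHighestWeight V.act V.parity v h) (HW : IsHighestWeight W.act W.parity w h')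
    (RV : IsRational V.act v h p Q n) (RW : IsRational W.act w h' p' Q' n')
    (cV : IsCocyclicVector V.act v) (cW : IsCocyclicVector W.act w)
    (hc : IsCocyclicVector (tact V W) (v ⊗ₜ[ℂ] w : V ⊗[ℂ] W)) : NoCommonZero p n Q' n' := by
  have := RV.finite
  have := RW.finite
  obtain ⟨ε, σ, hε₁, hε₂, hε₃, hσ₀, hσ₁, hσ₂⟩ := HV.exists_counit hq₀ hq
  obtain ⟨ε', σ', hε'₁, hε'₂, hε'₃, -⟩ := HW.exists_counit hq₀ hq
  by_contra hno
  obtain ⟨r, r', hr, hr', e, hr0⟩ := exists_of_not_noCommonZero RV.p_ne_zero RW.Q_ne_zero RV.p_le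
    RW.Q_le hno
  obtain ⟨⟨x, hx⟩, hxr⟩ := exists_of_finrank_le (E := firstLevel V.act v) RV.Q_le RV.Q_zero
    (fun m => ε ∘ₗ V.act (eY q m) ∘ₗ (firstLevel V.act v).subtype)
    (fun x => RV.e_rec.map (ε ∘ₗ LinearMap.applyₗ (x : V)))
    (fun x h0 => Subtype.ext (eq_zero_of_mem_firstLevel cV hε₁ x.2
      (hε₂ _ (mem_lowerWeight_of_mem_firstLevel x.2)) h0)) RV.le_level r hr
  obtain ⟨⟨y, hy⟩, hyr⟩ := exists_of_finrank_le (E := firstLevel W.act w) RW.Q_le RW.Q_zero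
    (fun m => ε' ∘ₗ W.act (eY q m) ∘ₗ (firstLevel W.act w).subtype)
    (fun x => RW.e_rec.map (ε' ∘ₗ LinearMap.applyₗ (x : W)))
    (fun x h0 => Subtype.ext (eq_zero_of_mem_firstLevel cW hε'₁ x.2
      (hε'₂ _ (mem_lowerWeight_of_mem_firstLevel x.2)) h0)) RW.le_level (σ⁻¹ • r')
    ((Polynomial.degree_smul_le _ _).trans_lt hr')
  change PowerSeries.mk (fun m => ε (V.act (eY q m) x)) * _ = _ at hxr
  change PowerSeries.mk (fun m => ε' (W.act (eY q m) y)) * _ = _ at hyr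
  have hz := tmul_add_mem_firstLevel hq₀ hq HV HW hx hy
  have hz0 : (x ⊗ₜ[ℂ] w + v ⊗ₜ[ℂ] y : V ⊗[ℂ] W) = 0 := by
    refine eq_zero_of_mem_firstLevel hc (ε := prodForm ε ε')
      (by rw [prodForm_tmul, hε₁, hε'₁, mul_one]) hz ?_ ?_
    · rw [map_add, prodForm_tmul, prodForm_tmul, hε₂ _ (mem_lowerWeight_of_mem_firstLevel hx),
        hε'₂ _ (mem_lowerWeight_of_mem_firstLevel hy), zero_mul, mul_zero, add_zero]
    · have e₁ := mk_e_tensor hq₀ hq HV.h_act (prodForm ε ε')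
        (x ⊗ₜ[ℂ] w + v ⊗ₜ[ℂ] y : V ⊗[ℂ] W)
      simp only [map_add (LinearMap.rTensor _ _), map_add (LinearMap.lTensor _ _),
        LinearMap.rTensor_tmul, LinearMap.lTensor_tmul, HW.e_v, HV.e_v,
        TensorProduct.tmul_zero, TensorProduct.zero_tmul, zero_add, add_zero, prodForm_tmul, hσ₂,
        hε₁, hε'₁, mul_one] at e₁
      have e₂ : (PowerSeries.mk fun m => σ * ε' (W.act (eY q m) y)) =
          σ • PowerSeries.mk fun m => ε' (W.act (eY q m) y) := by
        ext m
        simp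
      rw [e₂] at e₁
      have e₃ : PowerSeries.mk (fun m => prodForm ε ε'
          (tact V W (eY q m) (x ⊗ₜ[ℂ] w + v ⊗ₜ[ℂ] y : V ⊗[ℂ] W))) * (Q * Q' : Polynomial ℂ) =
          ((0 : Polynomial ℂ) : ℂ⟦X⟧) := by
        rw [e₁, ← e, Polynomial.coe_add, Polynomial.coe_mul, Polynomial.coe_mul, Polynomial.coe_mul,
          ← hxr, ← RV.mul_eq]
        have e₄ : (r' : ℂ⟦X⟧) = σ • (PowerSeries.mk (fun m => ε' (W.act (eY q m) y)) * Q') := by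
          rw [hyr, ← Polynomial.coe_smul, smul_smul, mul_inv_cancel₀ hσ₀, one_smul]
        rw [e₄, add_mul, mul_smul_comm, smul_mul_assoc, smul_mul_assoc, add_comm]
        congr 1
        · ring
        · congr 1; ring
      refine eq_zero_of_mk_eq_zero (Q := Q * Q') ?_ e₃ rfl
      rw [Polynomial.mul_coeff_zero]
      exact mul_ne_zero RV.Q_zero RW.Q_zero
  have hx0 : x = 0 := by
    refine (Module.forall_dual_apply_eq_zero_iff ℂ _).1 fun ψ => ?_
    have := congrArg (prodForm ψ ε') hz0
    rw [map_add, prodForm_tmul, prodForm_tmul, hε'₁,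
      hε'₂ _ (mem_lowerWeight_of_mem_firstLevel hy)] at this
    simpa using this
  refine hr0 (Polynomial.coe_injective ℂ ?_)
  rw [← hxr, hx0, Polynomial.coe_zero]
  have e₀ : (PowerSeries.mk fun m => ε (V.act (eY q m) 0)) = 0 := by
    ext; simp
  rw [e₀, zero_mul]

theorem isCocyclicVector_tensor_iff (hq₀ : q ≠ 0) (hq : ∀ n : ℕ, 0 < n → q ^ n ≠ 1)
    (HV : IsHighestWeight V.act V.parity v h) (HW : IsHighestWeight W.act W.parity w h')
    (RV : IsRational V.act v h p Q n) (RW : IsRational W.act w h' p' Q' n')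
    (cV : IsCocyclicVector V.act v) : IsCocyclicVector (tact V W) (v ⊗ₜ[ℂ] w : V ⊗[ℂ] W) ↔
      NoCommonZero p n Q' n' ∧ IsCocyclicVector W.act w := by
  constructor
  · intro hc
    have cW := isCocyclicVector_of_tensor hq₀ hq HV hc
    exact ⟨noCommonZero_of_isCocyclicVector hq₀ hq HV HW RV RW cV cW hc, cW⟩
  · rintro ⟨hc, cW⟩
    exact isCocyclicVector_tensor hq₀ hq HV RV RW cV cW hc

end YModule

/-! ### Common zeros on the Riemann sphere. -/

section Zeros

/-- `A` and `B` are the conditions at infinity; at finite points, coprimality over ℂ means having no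
common root. -/
theorem sphere_inter_eq_empty_iff (X Y : Polynomial ℂ) (A B : Prop) :
    {x : OnePoint ℂ | (∃ a : ℂ, x = a ∧ X.eval a = 0) ∨ (x = OnePoint.infty ∧ A)} ∩
      {x : OnePoint ℂ | (∃ a : ℂ, x = a ∧ Y.eval a = 0) ∨ (x = OnePoint.infty ∧ B)} = ∅ ↔
      IsCoprime X Y ∧ ¬ (A ∧ B) := by
  rw [Polynomial.isCoprime_iff_aeval_ne_zero_of_isAlgClosed ℂ ℂ, Set.eq_empty_iff_forall_notMem]
  simp only [Polynomial.coe_aeval_eq_eval, Set.mem_inter_iff, Set.mem_ofPred_eq]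
  constructor
  · intro h
    refine ⟨fun a => ?_, fun hAB => h OnePoint.infty ⟨Or.inr ⟨rfl, hAB.1⟩, Or.inr ⟨rfl, hAB.2⟩⟩⟩
    by_contra! hne
    exact h a ⟨Or.inl ⟨a, rfl, hne.1⟩, Or.inl ⟨a, rfl, hne.2⟩⟩
  · rintro ⟨h₁, h₂⟩ x ⟨⟨a, rfl, ha⟩ | ⟨rfl, hA⟩, ⟨b, hb, hb'⟩ | ⟨hx, hB⟩⟩
    · rw [OnePoint.coe_eq_coe] at hb
      subst hb
      exact (h₁ a).elim (fun h => h ha) fun h => h hb'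
    · exact OnePoint.coe_ne_infty a hx
    · exact OnePoint.infty_ne_coe b hb
    · exact h₂ ⟨hA, hB⟩

variable (f g : RatFunc ℂ)

/-- Relative to the order, a denominator of full degree means no pole at infinity, and a numerator
of full degree means no zero there. -/
theorem noCommonZero_denom_num :
    NoCommonZero f.denom (order f) g.num (order g) ↔ poles f ∩ zeros g = ∅ := by
  rw [poles, zeros, sphere_inter_eq_empty_iff, NoCommonZero, order, order]
  refine and_congr_right fun _ => ?_
  omega

theorem noCommonZero_num_denom :
    NoCommonZero f.num (order f) g.denom (order g) ↔ zeros f ∩ poles g = ∅ := by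
  rw [poles, zeros, sphere_inter_eq_empty_iff, NoCommonZero, order, order]
  refine and_congr_right fun _ => ?_
  omega

end Zeros

/-! ### Induction over the tensor factors. -/

namespace YModule

variable {q : ℂ}

/-- The tail of the product is in general not simple, and its fraction p/Q not reduced. Only the
zeros of p and Q matter for the next step, so they are recorded through `NoCommonZero` against an
arbitrary X. -/
theorem tensorFamily_spec (hq₀ : q ≠ 0) (hq : ∀ n : ℕ, 0 < n → q ^ n ≠ 1)
    (s : ℕ) (f : Fin (s + 1) → RatFunc ℂ) (hf : ∀ i, (f i).eval (RingHom.id ℂ) 0 = 1)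
    (V : Fin (s + 1) → YModule.{u} q) (hV : ∀ i, IsSimpleOfHighestLWeight (V i) (f i))
    (v : ∀ i, V i) (hv : ∀ i, (V i).IsHighestLWeightVector (v i)) :
    ∃ (h : ℂ⟦X⟧) (p Q : Polynomial ℂ) (n : ℕ),
      IsHighestWeight (tensorFamily s V).act (tensorFamily s V).parity (tensorVector s V v) h ∧
      IsRational (tensorFamily s V).act (tensorVector s V v) h p Q n ∧
      (∀ X m, NoCommonZero X m p n ↔ ∀ j, NoCommonZero X m (f j).num (order (f j))) ∧
      (∀ X m, NoCommonZero X m Q n ↔ ∀ j, NoCommonZero X m (f j).denom (order (f j))) ∧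
      (IsCyclicVector (tensorFamily s V).act (tensorVector s V v) ↔ ∀ i j, i < j →
        NoCommonZero (f i).denom (order (f i)) (f j).num (order (f j))) ∧
      (IsCocyclicVector (tensorFamily s V).act (tensorVector s V v) ↔ ∀ i j, i < j →
        NoCommonZero (f i).num (order (f i)) (f j).denom (order (f j))) := by
  induction s with
  | zero =>
    obtain ⟨H, R, hc, hcc⟩ := isRational_of_isSimpleOfHighestLWeight hq₀ hq (hf 0) (hV 0) (hv 0)
    refine ⟨_, _, _, _, H, R, fun X m => ?_, fun X m => ?_, ?_, ?_⟩
    · exact ⟨fun h j => by rwa [Fin.fin_one_eq_zero j], fun h => h 0⟩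
    · exact ⟨fun h j => by rwa [Fin.fin_one_eq_zero j], fun h => h 0⟩
    · exact ⟨fun _ i j hij => absurd hij (by omega), fun _ => hc⟩
    · exact ⟨fun _ i j hij => absurd hij (by omega), fun _ => hcc⟩
  | succ s ih =>
    obtain ⟨h', p', Q', n', H', R', hp', hQ', hc', hcc'⟩ := ih (fun i => f i.succ)
      (fun i => hf i.succ) (fun i => V i.succ) (fun i => hV i.succ) (fun i => v i.succ)
      (fun i => hv i.succ)
    obtain ⟨H, R, hc, hcc⟩ := isRational_of_isSimpleOfHighestLWeight hq₀ hq (hf 0) (hV 0) (hv 0)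
    have hsplit : ∀ C : Fin (s + 1 + 1) → Fin (s + 1 + 1) → Prop, (∀ i j, i < j → C i j) ↔
        (∀ j : Fin (s + 1), C 0 j.succ) ∧ ∀ i j : Fin (s + 1), i < j → C i.succ j.succ := by
      intro C
      constructor
      · exact fun h => ⟨fun j => h _ _ (Fin.succ_pos j), fun i j hij => h _ _ (Fin.succ_lt_succ_iff.2 hij)⟩
      · rintro ⟨h₁, h₂⟩ i j hij
        induction j using Fin.cases with
        | zero => exact absurd hij (Fin.not_lt_zero i)
        | succ j =>
          induction i using Fin.cases with
          | zero => exact h₁ j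
          | succ i => exact h₂ i j (Fin.succ_lt_succ_iff.1 hij)
    refine ⟨_, _, _, _, isHighestWeight_tensor hq₀ hq H H', isRational_tensor hq₀ hq H H' R R',
      fun X m => ?_, fun X m => ?_, ?_, ?_⟩
    · rw [noCommonZero_mul_iff R.p_ne_zero R'.p_ne_zero R.p_le R'.p_le, hp']
      exact (Fin.forall_fin_succ (P := fun j => NoCommonZero X m (f j).num (order (f j)))).symm
    · rw [noCommonZero_mul_iff R.Q_ne_zero R'.Q_ne_zero R.Q_le R'.Q_le, hQ']
      exact (Fin.forall_fin_succ (P := fun j => NoCommonZero X m (f j).denom (order (f j)))).symm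
    · refine (isCyclicVector_tensor_iff hq₀ hq H H' R R' hc).trans ?_
      rw [hp', hc', hsplit]
    · refine (isCocyclicVector_tensor_iff hq₀ hq H H' R R' hcc).trans ?_
      rw [hQ', hcc', hsplit]

end YModule

end QYangian

end

theorem mainTheorem2 (q : ℂ) (hq₀ : q ≠ 0) (hq : ∀ n : ℕ, 0 < n → q ^ n ≠ 1)
    (s : ℕ) (f : Fin (s + 1) → RatFunc ℂ) (hf : ∀ i, (f i).eval (RingHom.id ℂ) 0 = 1)
    (V : Fin (s + 1) → QYangian.YModule.{u} q)
    (hV : ∀ i, QYangian.IsSimpleOfHighestLWeight (V i) (f i))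
    (v : ∀ i, V i) (hv : ∀ i, (V i).IsHighestLWeightVector (v i)) :
    let T : QYangian.YModule.{u} q := QYangian.YModule.tensorFamily s V
    let w : T := QYangian.YModule.tensorVector s V v
    (T.generated w = ⊤ ↔
      ∀ i j, i < j → QYangian.poles (f i) ∩ QYangian.zeros (f j) = ∅) ∧
    ((T.IsSimpleSub (T.generated w) ∧
        ∀ W : Submodule ℂ T, T.IsSimpleSub W → W = T.generated w) ↔
      ∀ i j, i < j → QYangian.zeros (f i) ∩ QYangian.poles (f j) = ∅) ∧
    (T.IsSimple ↔
      ∀ i j, i ≠ j → QYangian.poles (f i) ∩ QYangian.zeros (f j) = ∅) := by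
  intro T w
  obtain ⟨h, p, Q, n, H, R, -, -, hc, hcc⟩ :=
    QYangian.YModule.tensorFamily_spec hq₀ hq s f hf V hV v hv
  have := R.finite
  have ha : T.generated w = ⊤ ↔
      ∀ i j, i < j → QYangian.poles (f i) ∩ QYangian.zeros (f j) = ∅ := by
    rw [QYangian.YModule.generated_eq_lowerSpan hq₀ hq H]
    refine hc.trans (forall₃_congr fun i j _ => QYangian.noCommonZero_denom_num _ _)
  have hb := (QYangian.YModule.isSimpleSub_generated_iff hq₀ hq H).trans
    (hcc.trans (forall₃_congr fun i j _ => QYangian.noCommonZero_num_denom _ _))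
  refine ⟨ha, hb, (QYangian.YModule.isSimple_iff hq₀ hq H).trans ?_⟩
  -- For i > j the condition on (i, j) in (c) is the one on (j, i) in (b), with the intersection
  -- written in the other order.
  refine (and_congr ha hb).trans ⟨?_, ?_⟩
  · rintro ⟨h₁, h₂⟩ i j hij
    rcases lt_or_gt_of_ne hij with h | h
    · exact h₁ i j h
    · rw [Set.inter_comm]
      exact h₂ j i h
  · intro h
    refine ⟨fun i j hij => h i j hij.ne, fun i j hij => ?_⟩
    rw [Set.inter_comm]
    exact h j i hij.ne'
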